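/- Let $(M,h^a,\omega^a{}_b)$ be a smooth teleparallel geometry on a four-dimensional manifold, written in a complex null coframe $(h^1,h^2,h^3,h^4)=(n,\ell,\bar m,m)$: $n,\ell$ are real one-forms, $m$ is a complex one-form, $n,\ell,\bar m,m$ are pointwise linearly independent over $\mathbb C$, the metric is $g=\eta_{ab}h^a\otimes h^b=-(n\otimes\ell+\ell\otimes n)+m\otimes\bar m+\bar m\otimes m$, and the spin connection $\omega^a{}_b=\omega^a{}_{bc}h^c$ is real (complex conjugation exchanges the indices $3$ and $4$), metric compatible ($\omega_{ab}=-\omega_{ba}$, with $\omega_{ab}=\eta_{ac}\omega^c{}_b$) and flat ($d\omega^a{}_b+\omega^a{}_c\wedge\omega^c{}_b=0$). Let $T^a=dh^a+\omega^a{}_b\wedge h^b=\tfrac12T^a{}_{bc}\,h^b\wedge h^c$ be its torsion and $T_{abc}=\eta_{ad}T^d{}_{bc}$, and let the boost weight of $T_{abc}$ be the number of its indices equal to $1$ minus the number of its indices equal to $2$. Suppose that the torsion is of alignment type II or more special with respect to this coframe, that is, all components $T_{abc}$ of positive boost weight vanish, and that $\kappa=\sigma=\rho=0$, where $\kappa=-\omega_{311}$,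 $\sigma=-\omega_{313}$, $\rho=-\omega_{314}$ and $\omega_{abc}=\eta_{ad}\omega^d{}_{bc}$. Then around every point of $M$ there are smooth local coordinates $(u,v,x^1,x^2)$ and smooth real functions $\lambda,\theta$ such that the coframe obtained by the boost and spin $\ell'=e^{\lambda}\ell$, $n'=e^{-\lambda}n$, $m'=e^{i\theta}m$ has the form $$\ell'=du,\qquad n'=dv+H(u,v,x^1,x^2)\,du+W_i(u,v,x^1,x^2)\,dx^i,$$ $$m'=M_0(u,v,x^1,x^2)\,du+M_1(u,x^1,x^2)\,(dx^1+i\,dx^2),$$ where $H,W_1,W_2$ are smooth real-valued functions and $M_0,M_1$ are smooth complex-valued functions. -/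

import Mathlib

open scoped Manifold ContDiff

namespace Teleparallel

/-- The model space of a four-dimensional manifold. -/
abbrev R4 : Type := EuclideanSpace ℝ (Fin 4)

/-- The coordinate vector `∂_μ` of `ℝ⁴`. -/
noncomputable def basisVec (μ : Fin 4) : R4 := EuclideanSpace.single μ 1

/-- (Not necessarily smooth) one-forms on `M` with values in `F`, where `F` is `ℝ` or `ℂ`. -/
abbrev OneForm (M : Type*) [TopologicalSpace M] [ChartedSpace R4 M]
    (F : Type*) [NormedAddCommGroup F] [NormedSpace ℝ F] : Type _ :=
  ∀ p : M, TangentSpace (𝓡 4) p →L[ℝ] F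

/-- The expression of a one-form in the local coordinates `φ`, that is, its pull-back along `φ⁻¹`:
at a coordinate value `x`, it maps `w = (dx⁰, …, dx³)` to `∑ μ, α_μ(x) dx^μ`. -/
noncomputable def inChart {M : Type*} [TopologicalSpace M] [ChartedSpace R4 M]
    {F : Type*} [NormedAddCommGroup F] [NormedSpace ℝ F]
    (φ : OpenPartialHomeomorph M R4) (α : OneForm M F) (x : R4) : R4 →L[ℝ] F :=
  (α (φ.symm x)).comp (mfderiv (𝓡 4) (𝓡 4) φ.symm x)

/-- The component `α_μ` of a one-form in the local coordinates `φ`. -/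
noncomputable def component {M : Type*} [TopologicalSpace M] [ChartedSpace R4 M]
    {F : Type*} [NormedAddCommGroup F] [NormedSpace ℝ F]
    (φ : OpenPartialHomeomorph M R4) (α : OneForm M F) (μ : Fin 4) (x : R4) : F :=
  inChart φ α x (basisVec μ)

/-- Smoothness of a one-form: its components are smooth in every chart of the atlas. -/
def SmoothForm {M : Type*} [TopologicalSpace M] [ChartedSpace R4 M]
    {F : Type*} [NormedAddCommGroup F] [NormedSpace ℝ F] (α : OneForm M F) : Prop :=
  ∀ φ ∈ atlas R4 M, ∀ μ : Fin 4, ContDiffOn ℝ ∞ (component φ α μ) φ.target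

/-- The partial derivative `∂_μ f`. -/
noncomputable def pd (μ : Fin 4) (f : R4 → ℂ) (x : R4) : ℂ :=
  fderiv ℝ f x (basisVec μ)

/-- The frame metric `η_{ab}` of the complex null gauge.
The indices `1, 2, 3, 4` of the coframe `(n, ℓ, m̄, m)` are `0, 1, 2, 3` here. -/
def eta : Matrix (Fin 4) (Fin 4) ℂ :=
  !![0, -1, 0, 0; -1, 0, 0, 0; 0, 0, 0, 1; 0, 0, 1, 0]

/-- The four one-forms `h⁰ = n`, `h¹ = ℓ`, `h² = m̄`, `h³ = m`, all regarded as complex-valued. -/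
noncomputable def nullForms {M : Type*} [TopologicalSpace M] [ChartedSpace R4 M]
    (n ℓ : OneForm M ℝ) (m : OneForm M ℂ) : Fin 4 → OneForm M ℂ :=
  ![fun p => Complex.ofRealCLM.comp (n p),
    fun p => Complex.ofRealCLM.comp (ℓ p),
    fun p => (Complex.conjCLE : ℂ →L[ℝ] ℂ).comp (m p),
    m]

/-- The coordinate components `R^a_{b μ ν}` of the curvature of `ω^a_b`. -/
noncomputable def curvature {M : Type*} [TopologicalSpace M] [ChartedSpace R4 M]
    (conn : Fin 4 → Fin 4 → OneForm M ℂ) (φ : OpenPartialHomeomorph M R4)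
    (a b μ ν : Fin 4) (x : R4) : ℂ :=
  pd μ (component φ (conn a b) ν) x - pd ν (component φ (conn a b) μ) x
    + ∑ c, component φ (conn a c) μ x * component φ (conn c b) ν x
    - ∑ c, component φ (conn a c) ν x * component φ (conn c b) μ x

/-- A smooth teleparallel geometry on a four-dimensional manifold, expressed in a complex null
coframe `(n, ℓ, m̄, m)`: the coframe, whose metric is
`g = -(n ⊗ ℓ + ℓ ⊗ n) + m̄ ⊗ m + m ⊗ m̄`, and a metric compatible spin connection `ω^a_b`
with vanishing curvature. -/
structure NullGeometry (M : Type*) [TopologicalSpace M] [ChartedSpace R4 M] where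
  n : OneForm M ℝ
  ℓ : OneForm M ℝ
  m : OneForm M ℂ
  conn : Fin 4 → Fin 4 → OneForm M ℂ
  smooth_n : SmoothForm n
  smooth_ℓ : SmoothForm ℓ
  smooth_m : SmoothForm m
  smooth_conn : ∀ a b, SmoothForm (conn a b)
  /-- `n, ℓ, m̄, m` form a basis of the complexified cotangent space at each point. -/
  independent : ∀ p : M, LinearIndependent ℂ (fun a => nullForms n ℓ m a p)
  /-- The connection is real: complex conjugation exchanges the indices of `m̄` and `m`. -/
  real_conn : ∀ a b p w, (starRingEnd ℂ) (conn a b p w) = conn (Equiv.swap 2 3 a) (Equiv.swap 2 3 b) p w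
  /-- Metric compatibility, `ω_{ab} + ω_{ba} = 0`. -/
  antisymm : ∀ a b p w, ∑ c, eta a c * conn c b p w + ∑ c, eta b c * conn c a p w = 0
  flat : ∀ φ ∈ atlas R4 M, ∀ a b μ ν, ∀ x ∈ φ.target, curvature conn φ a b μ ν x = 0

namespace NullGeometry

/-- The coframe `h^a`. -/
noncomputable def coframe {M : Type*} [TopologicalSpace M] [ChartedSpace R4 M]
    (G : NullGeometry M) : Fin 4 → OneForm M ℂ :=
  nullForms G.n G.ℓ G.m

/-- The coordinate components of the dual frame: the entry `(μ, b)` is `h_b^μ`. -/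
noncomputable def frame {M : Type*} [TopologicalSpace M] [ChartedSpace R4 M]
    (G : NullGeometry M) (φ : OpenPartialHomeomorph M R4) (x : R4) : Matrix (Fin 4) (Fin 4) ℂ :=
  (Matrix.of fun a μ => component φ (G.coframe a) μ x)⁻¹

/-- `T^a_{μ ν} = ∂_μ h^a_ν - ∂_ν h^a_μ + ω^a_{b μ} h^b_ν - ω^a_{b ν} h^b_μ`. -/
noncomputable def torsionCoord {M : Type*} [TopologicalSpace M] [ChartedSpace R4 M]
    (G : NullGeometry M) (φ : OpenPartialHomeomorph M R4) (a μ ν : Fin 4) (x : R4) : ℂ :=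
  pd μ (component φ (G.coframe a) ν) x - pd ν (component φ (G.coframe a) μ) x
    + ∑ b, component φ (G.conn a b) μ x * component φ (G.coframe b) ν x
    - ∑ b, component φ (G.conn a b) ν x * component φ (G.coframe b) μ x

/-- The frame components `T_{abc} = η_{ad} T^d_{μ ν} h_b^μ h_c^ν`. -/
noncomputable def torsion {M : Type*} [TopologicalSpace M] [ChartedSpace R4 M]
    (G : NullGeometry M) (φ : OpenPartialHomeomorph M R4) (a b c : Fin 4) (x : R4) : ℂ :=
  ∑ d, ∑ μ, ∑ ν, eta a d * G.torsionCoord φ d μ ν x * G.frame φ x μ b * G.frame φ x ν c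

/-- The frame components `ω_{abc} = η_{ad} ω^d_{b μ} h_c^μ`. -/
noncomputable def spinCoeff {M : Type*} [TopologicalSpace M] [ChartedSpace R4 M]
    (G : NullGeometry M) (φ : OpenPartialHomeomorph M R4) (a b c : Fin 4) (x : R4) : ℂ :=
  ∑ d, ∑ μ, eta a d * component φ (G.conn d b) μ x * G.frame φ x μ c

/-- The Newman-Penrose scalar `κ = -ω_{311}` (with indices from `1` to `4`). -/
noncomputable def kappa {M : Type*} [TopologicalSpace M] [ChartedSpace R4 M]
    (G : NullGeometry M) (φ : OpenPartialHomeomorph M R4) (x : R4) : ℂ :=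
  - G.spinCoeff φ 2 0 0 x

/-- The Newman-Penrose scalar `σ = -ω_{313}` (with indices from `1` to `4`). -/
noncomputable def sigma {M : Type*} [TopologicalSpace M] [ChartedSpace R4 M]
    (G : NullGeometry M) (φ : OpenPartialHomeomorph M R4) (x : R4) : ℂ :=
  - G.spinCoeff φ 2 0 2 x

/-- The Newman-Penrose scalar `ρ = -ω_{314}` (with indices from `1` to `4`). -/
noncomputable def rho {M : Type*} [TopologicalSpace M] [ChartedSpace R4 M]
    (G : NullGeometry M) (φ : OpenPartialHomeomorph M R4) (x : R4) : ℂ :=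
  - G.spinCoeff φ 2 0 3 x

end NullGeometry

/-- The contribution of a lower frame index to the boost weight of a component: under the boost
`(ℓ, n) ↦ (e^λ ℓ, e^{-λ} n)` a component is multiplied by `e^{bλ}`, `b` the sum of these. -/
def boostWeight : Fin 4 → ℤ := ![1, -1, 0, 0]

/-- The torsion is of alignment type II (or more special) relative to the null coframe:
all its components of positive boost weight vanish. -/
def NullGeometry.TorsionTypeII {M : Type*} [TopologicalSpace M] [ChartedSpace R4 M]
    (G : NullGeometry M) : Prop :=
  ∀ a b c : Fin 4, 0 < boostWeight a + boostWeight b + boostWeight c →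
    ∀ φ ∈ atlas R4 M, ∀ x ∈ φ.target, G.torsion φ a b c x = 0

end Teleparallel

/-!
The normal form follows from two consequences of the hypotheses, collected in `IsAdmissible`. The
scalars `κ, σ, ρ` are the components of `ω_{20}` (counting indices from `0`) along the frame vectors
tangent to the kernel of `ℓ`, so on this kernel `ω^3_0` vanishes, and by reality and antisymmetry so
do `ω^2_0`, `ω^1_2`, `ω^1_3`. All torsion components `T_{0bc}` and `T_{20c}` with `b, c ≠ 1` have
positive boost weight. Cartan's first structure equation (`cartan_structure`) then says, see
`isAdmissible_inChart`:

* `dℓ(X, Y) = 0` whenever `ℓ(X) = ℓ(Y) = 0`, so the kernel of `ℓ` is integrable;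
* if `ℓ(X) = m(X) = 0`, then `dm(X, Y) = i ψ m(Y)` for all `Y` in the kernel of `ℓ`, with a real `ψ`:
  along the null direction dual to `n`, the form `m` only rotates modulo `ℓ`.

The rest is local analysis on `ℝ⁴`. Flowing along the frame vectors dual to `Re m`, `Im m` and `n`
gives coordinates in which `∂_1` is the null direction and, by Frobenius' theorem, `ℓ` is a multiple
of `dy⁰` (`exists_flow_coordinates`). By the rotation property, the conformal structure that `m`
induces on the surfaces `y⁰, y¹ = const`, that is, the ratio `ν = m_3 / m_2`, is independent of `y¹`
(`IsFlowAdapted.ratio_eventually_eq`). Hence a solution `w` of the Beltrami equation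
`∂_3 w = ν ∂_2 w` that is independent of `y¹` makes `m` a multiple of `dw` modulo `dy⁰`
(`exists_isothermal_coordinates`). With `u = y⁰`, `x¹ + i x² = w` and `∂_1 v = ℓ_0`, a boost by
`-log ℓ_u` and a spin by `-arg m_{x¹}` produce the normal form
(`exists_hasNormalForm_of_isNormalUpToGauge`), and the remaining factor `M₁ = |m_{x¹}|` does not
depend on `v`, again because `m` only rotates.

Two analytic facts have to be proved with smooth dependence on parameters.

* The flow of a smooth vector field is smooth (`exists_smooth_flow`): the integral equation is solved
  by the inverse function theorem in the space of continuous paths, where superposition with a smooth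
  map is a smooth operator (`contDiff_superposition`).
* The Beltrami equation with smooth `ν` close to `i` has smooth local solutions
  (`exists_beltrami_solution`). After rescaling and periodization, all four coordinates are treated
  as variables on a torus and the equation becomes `g = δ (1 + S g)`, with `δ = ν - i` and a Fourier
  multiplier `S` of modulus at most one in the two active directions. Its Neumann series converges in
  the Wiener algebra, with polynomial weights of every order (`exists_rapidDecay_fixedPoint`), so
  the solution is smooth in all variables at once.
-/

open Set Filter Topology MeasureTheory

namespace Teleparallel

/-! ### Local inverses and cut-offs -/

/-- The smooth inverse function theorem, with a domain so small that the derivative is invertible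
everywhere on it. -/
theorem exists_smooth_local_inverse {E F : Type*} [NormedAddCommGroup E] [NormedSpace ℝ E]
    [CompleteSpace E] [NormedAddCommGroup F] [NormedSpace ℝ F] {f : E → F} {a : E} {f' : E ≃L[ℝ] F}
    (hf : ∀ᶠ x in 𝓝 a, ContDiffAt ℝ ∞ f x) (hf' : HasFDerivAt f (f' : E →L[ℝ] F) a)
    {s : Set E} (hs : s ∈ 𝓝 a) :
    ∃ e : OpenPartialHomeomorph E F, a ∈ e.source ∧ e.source ⊆ s ∧ (e : E → F) = f ∧
      ContDiffOn ℝ ∞ e e.source ∧ ContDiffOn ℝ ∞ e.symm e.target ∧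
      ∀ x ∈ e.source, ∃ A : E ≃L[ℝ] F, HasFDerivAt f (A : E →L[ℝ] F) x := by
  have h1 : ContDiffAt ℝ ∞ f a := hf.self_of_nhds
  have hcont : ContinuousAt (fderiv ℝ f) a :=
    (h1.fderiv_right (m := 0) (by simp)).continuousAt
  have h2 : ∀ᶠ x in 𝓝 a, fderiv ℝ f x ∈ range ((↑) : (E ≃L[ℝ] F) → E →L[ℝ] F) := by
    apply hcont
    apply ContinuousLinearEquiv.isOpen.mem_nhds
    rw [hf'.fderiv]; exact ⟨f', rfl⟩
  obtain ⟨U, hU, hUo, haU⟩ := mem_nhds_iff.1 (hf.and (h2.and hs))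
  set e0 := h1.toOpenPartialHomeomorph f hf' (by simp) with he0
  have hinv : ∀ x ∈ U, ∃ A : E ≃L[ℝ] F, HasFDerivAt f (A : E →L[ℝ] F) x := by
    intro x hx
    obtain ⟨A, hA⟩ := (hU hx).2.1
    exact ⟨A, hA ▸ ((hU hx).1.differentiableAt (by simp)).hasFDerivAt⟩
  have hcoe : (e0 : E → F) = f := h1.toOpenPartialHomeomorph_coe hf' (by simp)
  have hsrc : (e0.restrOpen U hUo).source = e0.source ∩ U := e0.restrOpen_source U hUo
  refine ⟨e0.restrOpen U hUo, ?_, ?_, hcoe, ?_, ?_, ?_⟩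
  · rw [hsrc]
    exact ⟨h1.mem_toOpenPartialHomeomorph_source hf' (by simp), haU⟩
  · rw [hsrc]; exact fun x hx => (hU hx.2).2.2
  · intro x hx
    rw [hsrc] at hx
    exact (hU hx.2).1.contDiffWithinAt
  · intro y hy
    have hx := (e0.restrOpen U hUo).map_target hy
    rw [hsrc] at hx
    obtain ⟨A, hA⟩ := hinv _ hx.2
    apply ContDiffAt.contDiffWithinAt
    exact (e0.restrOpen U hUo).contDiffAt_symm hy (f₀' := A) hA (hU hx.2).1
  · intro x hx
    rw [hsrc] at hx
    exact hinv x hx.2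

/-- A function that is smooth near `a` agrees near `a` with a globally smooth function of compact
support. -/
theorem exists_contDiff_hasCompactSupport_eventuallyEq {E F : Type*} [NormedAddCommGroup E]
    [NormedSpace ℝ E] [FiniteDimensional ℝ E] [NormedAddCommGroup F] [NormedSpace ℝ F]
    {f : E → F} {a : E} (hf : ∀ᶠ x in 𝓝 a, ContDiffAt ℝ ∞ f x) :
    ∃ g : E → F, ContDiff ℝ ∞ g ∧ HasCompactSupport g ∧ g =ᶠ[𝓝 a] f := by
  obtain ⟨r, hr, hball⟩ := Metric.eventually_nhds_iff_ball.1 hf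
  -- cut off inside the ball on which `f` is smooth
  let χ : ContDiffBump a := ⟨r / 4, r / 2, by positivity, by linarith⟩
  refine ⟨fun x => χ x • f x, ?_, ?_, ?_⟩
  · rw [contDiff_iff_contDiffAt]
    intro x
    by_cases hx : x ∈ Metric.ball a r
    · exact χ.contDiff.contDiffAt.smul (hball x hx)
    · have : (fun x => χ x • f x) =ᶠ[𝓝 x] fun _ => 0 := by
        have hxs : x ∉ tsupport χ := by
          rw [χ.tsupport_eq]
          intro h
          apply hx
          rw [Metric.mem_closedBall] at h
          rw [Metric.mem_ball]
          have : χ.rOut = r / 2 := rfl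
          linarith
        filter_upwards [notMem_tsupport_iff_eventuallyEq.1 hxs] with y hy
        simp [hy]
      exact contDiffAt_const.congr_of_eventuallyEq this
  · exact HasCompactSupport.smul_right χ.hasCompactSupport
  · filter_upwards [χ.eventuallyEq_one] with y hy
    simp [hy]

/-! ### Superposition operators -/

section Superposition

universe u
variable {K : Type*} [TopologicalSpace K] [CompactSpace K]
variable {E F : Type u} [NormedAddCommGroup E] [NormedSpace ℝ E]
  [NormedAddCommGroup F] [NormedSpace ℝ F]

/-- The superposition operator `γ ↦ f ∘ γ` on continuous maps from a compact space. -/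
def superposition {f : E → F} (hf : Continuous f) (γ : C(K, E)) : C(K, F) :=
  ⟨fun t => f (γ t), hf.comp γ.continuous⟩

/-- The pointwise action of a continuous family of operators on a continuous map. -/
noncomputable def pointwiseApply :
    C(K, E →L[ℝ] F) →L[ℝ] C(K, E) →L[ℝ] C(K, F) :=
  LinearMap.mkContinuous₂
    (LinearMap.mk₂ ℝ (fun (A : C(K, E →L[ℝ] F)) (h : C(K, E)) =>
        (⟨fun t => A t (h t), A.continuous.clm_apply h.continuous⟩ : C(K, F)))
      (fun A B h => by ext t; simp) (fun c A h => by ext t; simp)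
      (fun A h h' => by ext t; simp) (fun c A h => by ext t; simp)) 1
    (fun A h => by
      rw [one_mul, ContinuousMap.norm_le _ (by positivity)]
      intro t
      exact ((A t).le_opNorm (h t)).trans
        (mul_le_mul (A.norm_coe_le_norm t) (h.norm_coe_le_norm t) (norm_nonneg _)
          (norm_nonneg (E := C(K, E →L[ℝ] F)) A)))

/-- The superposition operator is differentiable for the supremum norm, and its derivative is the
pointwise action of the superposition with `fderiv f`. -/
theorem hasFDerivAt_superposition {f : E → F} (hf : ContDiff ℝ 1 f) (γ : C(K, E)) :
    HasFDerivAt (superposition (K := K) hf.continuous)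
      (pointwiseApply (superposition (hf.continuous_fderiv (by simp)) γ)) γ := by
  rw [hasFDerivAt_iff_isLittleO_nhds_zero, Asymptotics.isLittleO_iff]
  intro ε hε
  -- the first-order remainder is small uniformly on `K`, by compactness
  have key : ∀ᶠ v in 𝓝 (0 : E), ∀ t ∈ (univ : Set K),
      ‖f (γ t + v) - f (γ t) - fderiv ℝ f (γ t) v‖ ≤ ε * ‖v‖ := by
    apply isCompact_univ.eventually_forall_of_forall_eventually
    intro t₀ _
    have hs := (hf.contDiffAt (x := γ t₀)).hasStrictFDerivAt (by simp)
    have hs' := (hasStrictFDerivAt_iff_isLittleO.1 hs).def (half_pos hε)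
    have hc : Tendsto (fun p : E × K => (γ p.2 + p.1, γ p.2)) (𝓝 (0, t₀)) (𝓝 (γ t₀, γ t₀)) := by
      have : Continuous (fun p : E × K => (γ p.2 + p.1, γ p.2)) := by fun_prop
      simpa using this.tendsto (0, t₀)
    have hd : ∀ᶠ p : E × K in 𝓝 (0, t₀), ‖fderiv ℝ f (γ p.2) - fderiv ℝ f (γ t₀)‖ < ε / 2 := by
      have h1 : Continuous (fun p : E × K => fderiv ℝ f (γ p.2) - fderiv ℝ f (γ t₀)) :=
        ((hf.continuous_fderiv (by simp)).comp (γ.continuous.comp continuous_snd)).sub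
          continuous_const
      have := h1.norm.tendsto (0, t₀)
      simp only [sub_self, norm_zero] at this
      exact this.eventually (gt_mem_nhds (half_pos hε))
    have := (hc.eventually hs').and hd
    refine this.mono ?_
    rintro ⟨v, t⟩ ⟨h1, h2⟩
    simp only [add_sub_cancel_left] at h1
    calc ‖f (γ t + v) - f (γ t) - fderiv ℝ f (γ t) v‖
        = ‖(f (γ t + v) - f (γ t) - fderiv ℝ f (γ t₀) v)
            - (fderiv ℝ f (γ t) - fderiv ℝ f (γ t₀)) v‖ := by
          congr 1; simp
      _ ≤ ε / 2 * ‖v‖ + ε / 2 * ‖v‖ := by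
          refine (norm_sub_le _ _).trans (add_le_add h1 ?_)
          exact (ContinuousLinearMap.le_opNorm _ _).trans (by gcongr)
      _ = ε * ‖v‖ := by ring
  obtain ⟨δ, hδ, hball⟩ := Metric.eventually_nhds_iff_ball.1 key
  filter_upwards [Metric.ball_mem_nhds (0 : C(K, E)) hδ] with h hh
  rw [ContinuousMap.norm_le _ (by positivity)]
  intro t
  have hlt : ‖h t‖ ≤ ‖h‖ := h.norm_coe_le_norm t
  have := hball (h t) (by simpa using hlt.trans_lt (by simpa using hh)) t (mem_univ t)
  exact this.trans (by gcongr)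

/-- Induction on the order: the derivative is again a superposition, now with `fderiv ℝ f`, whose
values lie in another space, so that the codomain has to vary. -/
theorem contDiff_superposition_nat (n : ℕ) :
    ∀ {F : Type u} [NormedAddCommGroup F] [NormedSpace ℝ F] {f : E → F} (hc : Continuous f)
      (_ : ContDiff ℝ n f), ContDiff ℝ n (superposition (K := K) hc) := by
  induction n with
  | zero =>
    intro F _ _ f hc _
    rw [Nat.cast_zero, contDiff_zero]
    exact ContinuousMap.continuous_postcomp ⟨f, hc⟩
  | succ n ih =>
    intro F _ _ f hc hf
    have h1 : ContDiff ℝ 1 f := hf.of_le (by simp)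
    have hd : ContDiff ℝ n (fderiv ℝ f) := hf.fderiv_right (by simp)
    rw [Nat.cast_succ, contDiff_succ_iff_hasFDerivAt]
    refine ⟨fun γ => pointwiseApply (superposition hd.continuous γ), ?_, fun γ =>
      hasFDerivAt_superposition h1 γ⟩
    exact pointwiseApply.contDiff.comp (ih hd.continuous hd)

theorem contDiff_superposition {f : E → F} (hf : ContDiff ℝ ∞ f) :
    ContDiff ℝ ∞ (superposition (K := K) hf.continuous) :=
  contDiff_infty.2 fun n => contDiff_superposition_nat n hf.continuous (hf.of_le (mod_cast le_top))

end Superposition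

/-! ### Smooth flows of vector fields -/

section Flow

universe u
variable {E : Type u} [NormedAddCommGroup E] [NormedSpace ℝ E] [CompleteSpace E]

/-- The operator `γ ↦ (t ↦ ∫₀ᵗ γ)` on paths parametrized by the unit interval. Outside the interval
the integrand is extended by its end values, which does not affect the integral. -/
noncomputable def pathIntegral : C(unitInterval, E) →L[ℝ] C(unitInterval, E) :=
  LinearMap.mkContinuous
    { toFun := fun γ => ⟨fun t => ∫ r in (0 : ℝ)..t, γ.IccExtend zero_le_one r, by
        exact (intervalIntegral.continuous_primitive
          (fun a b => ((γ.IccExtend zero_le_one).continuous.intervalIntegrable a b)) 0).comp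
            continuous_subtype_val⟩
      map_add' := fun γ γ' => by
        ext t
        exact intervalIntegral.integral_add ((γ.IccExtend zero_le_one).continuous.intervalIntegrable _ _)
          ((γ'.IccExtend zero_le_one).continuous.intervalIntegrable _ _)
      map_smul' := fun c γ => by
        ext t
        exact intervalIntegral.integral_smul c _ } 1
    (fun γ => by
      rw [ContinuousMap.norm_le _ (by positivity)]
      intro t
      have : ‖∫ r in (0 : ℝ)..t, γ.IccExtend zero_le_one r‖ ≤ ‖γ‖ * |(t : ℝ) - 0| :=
        intervalIntegral.norm_integral_le_of_norm_le_const fun r _ => γ.norm_coe_le_norm _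
      refine this.trans ?_
      rw [one_mul, sub_zero, abs_of_nonneg t.2.1]
      exact mul_le_of_le_one_right (norm_nonneg _) t.2.2)

/-- `γ` is the path on the unit interval with `γ 0 = x` and velocity `s • X`, in integral form. -/
def IsIntegralPath {X : E → E} (hX : Continuous X) (s : ℝ) (x : E) (γ : C(unitInterval, E)) :
    Prop :=
  γ = ContinuousMap.const _ x + s • pathIntegral (superposition hX γ)

/-- An integral path is the restriction of a function on the line that solves the differential
equation on `[0, 1]`. -/
theorem IsIntegralPath.exists_hasDerivAt {X : E → E} {hX : Continuous X} {s : ℝ} {x : E}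
    {γ : C(unitInterval, E)} (h : IsIntegralPath hX s x γ) :
    ∃ c : ℝ → E, c 0 = x ∧ (∀ r : unitInterval, c r = γ r) ∧
      ∀ r ∈ Icc (0 : ℝ) 1, HasDerivAt c (s • X (c r)) r := by
  set f : ℝ → E := ⇑((superposition hX γ).IccExtend zero_le_one) with hf
  have hfc : Continuous f := ContinuousMap.continuous _
  have hval : ∀ r : unitInterval, x + s • ∫ q in (0 : ℝ)..r, f q = γ r := by
    intro r
    conv_rhs => rw [h]
    rfl
  refine ⟨fun r => x + s • ∫ q in (0 : ℝ)..r, f q, by simp, hval, ?_⟩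
  intro r hr
  have h1 : X (x + s • ∫ q in (0 : ℝ)..r, f q) = f r := by
    rw [hval ⟨r, hr⟩]
    exact (Set.IccExtend_of_mem zero_le_one (superposition hX γ) hr).symm
  rw [h1]
  exact ((intervalIntegral.integral_hasDerivAt_right (hfc.intervalIntegrable _ _)
    (hfc.stronglyMeasurableAtFilter _ _) hfc.continuousAt).const_smul s).const_add x

/-- The path with speed `t s` ends where the path with speed `s` is at time `t`, by uniqueness of
solutions. -/
theorem IsIntegralPath.apply_one_eq {X : E → E} {hX : Continuous X} {L : NNReal}
    (hL : LipschitzWith L X) {s : ℝ} {x : E} {γ γ' : C(unitInterval, E)}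
    (h : IsIntegralPath hX s x γ) (t : unitInterval) (h' : IsIntegralPath hX (t * s) x γ') :
    γ' 1 = γ t := by
  obtain ⟨c, c0, cγ, cd⟩ := h.exists_hasDerivAt
  obtain ⟨c', c0', cγ', cd'⟩ := h'.exists_hasDerivAt
  have hd : ∀ r ∈ Icc (0 : ℝ) 1,
      HasDerivAt (fun r => c (t * r)) (((t : ℝ) * s) • X (c (t * r))) r := by
    intro r hr
    have h1 := (cd (t * r) ⟨mul_nonneg t.2.1 hr.1, mul_le_one₀ t.2.2 hr.1 hr.2⟩)
    have h2 : HasDerivAt (fun r : ℝ => (t : ℝ) * r) t r := by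
      simpa using (hasDerivAt_id r).const_mul (t : ℝ)
    have h3 := h1.scomp r h2
    rw [smul_smul] at h3
    exact h3
  have := ODE_solution_unique (v := fun _ y => ((t : ℝ) * s) • X y) (a := 0) (b := 1)
    (fun _ => (lipschitzWith_smul ((t : ℝ) * s)).comp hL)
    (fun r hr => (cd' r hr).continuousAt.continuousWithinAt)
    (fun r hr => (cd' r (Ico_subset_Icc_self hr)).hasDerivWithinAt)
    (fun r hr => (hd r hr).continuousAt.continuousWithinAt)
    (fun r hr => (hd r (Ico_subset_Icc_self hr)).hasDerivWithinAt) (by simp [c0, c0'])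
    (right_mem_Icc.2 zero_le_one)
  simpa [cγ, ← cγ'] using this

/-- The solution of `γ = x + s ∫ X ∘ γ` depends smoothly on `(s, x)`, by the implicit function
theorem in the Banach space of paths; its end point is then a smooth function of `(s, x)`. -/
theorem exists_smooth_integralPath {X : E → E} (hX : ContDiff ℝ ∞ X) (x₀ : E) :
    ∃ γ : ℝ × E → C(unitInterval, E), ∀ᶠ p in 𝓝 ((0 : ℝ), x₀),
      ContDiffAt ℝ ∞ γ p ∧ IsIntegralPath hX.continuous p.1 p.2 (γ p) := by
  let P := C(unitInterval, E)
  let κ : E →L[ℝ] P := ContinuousLinearMap.const ℝ unitInterval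
  let J : P →L[ℝ] P := pathIntegral
  let N : P → P := superposition hX.continuous
  have hN : ContDiff ℝ ∞ N := contDiff_superposition hX
  -- `γ` is an integral path for `(s, x)` exactly if `G (s, x, γ) = (s, x, 0)`
  let G : ℝ × E × P → ℝ × E × P := fun q => (q.1, q.2.1, q.2.2 - κ q.2.1 - q.1 • J (N q.2.2))
  have hG : ContDiff ℝ ∞ G := by
    have : ContDiff ℝ ∞ fun q : ℝ × E × P => J (N q.2.2) :=
      J.contDiff.comp (hN.comp (contDiff_snd.comp contDiff_snd))
    exact contDiff_fst.prodMk ((contDiff_fst.comp contDiff_snd).prodMk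
      (((contDiff_snd.comp contDiff_snd).sub
        (κ.contDiff.comp (contDiff_fst.comp contDiff_snd))).sub (contDiff_fst.smul this)))
  let q₀ : ℝ × E × P := (0, x₀, κ x₀)
  let w : P := J (N (κ x₀))
  let fst' : ℝ × E × P →L[ℝ] ℝ := ContinuousLinearMap.fst ℝ ℝ (E × P)
  let mid' : ℝ × E × P →L[ℝ] E :=
    (ContinuousLinearMap.fst ℝ E P).comp (ContinuousLinearMap.snd ℝ ℝ (E × P))
  let snd' : ℝ × E × P →L[ℝ] P :=
    (ContinuousLinearMap.snd ℝ E P).comp (ContinuousLinearMap.snd ℝ ℝ (E × P))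
  -- the derivative of `G` at `q₀` is triangular with identities on the diagonal, since `s = 0` there
  let A : (ℝ × E × P) ≃L[ℝ] (ℝ × E × P) := ContinuousLinearEquiv.equivOfInverse
    (fst'.prod (mid'.prod (snd' - κ.comp mid' - fst'.smulRight w)))
    (fst'.prod (mid'.prod (snd' + κ.comp mid' + fst'.smulRight w)))
    (fun q => Prod.ext (by simp [fst']) (Prod.ext (by simp [fst', mid']) (by
      simp only [fst', mid', snd', ContinuousLinearMap.prod_apply, add_apply,
        sub_apply, ContinuousLinearMap.comp_apply,
        ContinuousLinearMap.smulRight_apply, ContinuousLinearMap.coe_fst', ContinuousLinearMap.coe_snd']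
      abel)))
    (fun q => Prod.ext (by simp [fst']) (Prod.ext (by simp [fst', mid']) (by
      simp only [fst', mid', snd', ContinuousLinearMap.prod_apply, add_apply,
        sub_apply, ContinuousLinearMap.comp_apply,
        ContinuousLinearMap.smulRight_apply, ContinuousLinearMap.coe_fst', ContinuousLinearMap.coe_snd']
      abel)))
  have hA : HasFDerivAt G (A : (ℝ × E × P) →L[ℝ] (ℝ × E × P)) q₀ := by
    have h1 : HasFDerivAt (fun q : ℝ × E × P => q.1) fst' q₀ := fst'.hasFDerivAt
    have h2 : HasFDerivAt (fun q : ℝ × E × P => q.2.1) mid' q₀ := mid'.hasFDerivAt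
    have h3 : HasFDerivAt (fun q : ℝ × E × P => q.2.2) snd' q₀ := snd'.hasFDerivAt
    have h4 : HasFDerivAt (fun q : ℝ × E × P => J (N q.2.2))
        (fderiv ℝ (fun q : ℝ × E × P => J (N q.2.2)) q₀) q₀ := by
      refine DifferentiableAt.hasFDerivAt ?_
      exact (J.contDiff.comp (hN.comp (contDiff_snd.comp contDiff_snd))).differentiable
        (by simp) _
    have h5 := h1.prodMk (h2.prodMk ((h3.sub (κ.hasFDerivAt.comp q₀ h2)).sub (h1.smul h4)))
    refine h5.congr_fderiv ?_
    have : q₀.1 = 0 := rfl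
    rw [this, zero_smul, zero_add]
    rfl
  obtain ⟨e, hq₀, -, he, -, hes, -⟩ := exists_smooth_local_inverse
    (Eventually.of_forall fun x => hG.contDiffAt) hA univ_mem
  have hGq₀ : G q₀ = (0, x₀, 0) := by simp [G, q₀]
  refine ⟨fun p => (e.symm (p.1, p.2, 0)).2.2, ?_⟩
  have hι : ContDiff ℝ ∞ fun p : ℝ × E => (p.1, p.2, (0 : P)) :=
    contDiff_fst.prodMk (contDiff_snd.prodMk contDiff_const)
  have hmem : ∀ᶠ p in 𝓝 ((0 : ℝ), x₀), (p.1, p.2, (0 : P)) ∈ e.target := by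
    apply hι.continuous.continuousAt
    refine e.open_target.mem_nhds ?_
    have := e.map_source hq₀
    rwa [he, hGq₀] at this
  filter_upwards [hmem] with p hp
  constructor
  · exact (contDiff_snd.comp contDiff_snd).contDiffAt.comp p
      ((hes.contDiffAt (e.open_target.mem_nhds hp)).comp p hι.contDiffAt)
  · have h := e.right_inv hp
    rw [he] at h
    simp only [G, Prod.mk.injEq] at h
    obtain ⟨h1, h2, h3⟩ := h
    rw [h1, h2, sub_sub, sub_eq_zero] at h3
    exact h3

/-- The end points of the integral paths of speed `s` are the flow for the time `s`. -/
theorem exists_smooth_flow_of_lipschitz {X : E → E} (hX : ContDiff ℝ ∞ X) {L : NNReal}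
    (hL : LipschitzWith L X) (x₀ : E) :
    ∃ Φ : ℝ × E → E, (∀ᶠ p in 𝓝 ((0 : ℝ), x₀), ContDiffAt ℝ ∞ Φ p) ∧
      (∀ᶠ p in 𝓝 ((0 : ℝ), x₀), HasDerivAt (fun s => Φ (s, p.2)) (X (Φ p)) p.1) ∧
      ∀ᶠ x in 𝓝 x₀, Φ (0, x) = x := by
  obtain ⟨γ, hγ⟩ := exists_smooth_integralPath hX x₀
  let ev : C(unitInterval, E) →L[ℝ] E := ContinuousMap.evalCLM ℝ 1
  set Φ : ℝ × E → E := fun p => γ p 1 with hΦ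
  have hsm : ∀ p, ContDiffAt ℝ ∞ γ p → ContDiffAt ℝ ∞ Φ p := fun p hp =>
    ev.contDiff.contDiffAt.comp p hp
  obtain ⟨r, hr, hball⟩ := Metric.eventually_nhds_iff_ball.1 hγ
  have hmem : ∀ {s : ℝ} {x : E}, |s| < r → x ∈ Metric.ball x₀ r →
      (s, x) ∈ Metric.ball ((0 : ℝ), x₀) r := by
    intro s x hs hx
    rw [← ball_prod_same]
    exact ⟨by simpa using hs, hx⟩
  have hder : ∀ s x, |s| < r → x ∈ Metric.ball x₀ r →
      HasDerivAt (fun s => Φ (s, x)) (fderiv ℝ Φ (s, x) (1, 0)) s := by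
    intro s x hs hx
    have h1 := ((hsm _ (hball _ (hmem hs hx)).1).differentiableAt (by simp)).hasFDerivAt
    exact h1.comp_hasDerivAt s ((hasDerivAt_id s).prodMk (hasDerivAt_const s x))
  -- for `s ≠ 0`, differentiate `Φ (t s, x) = γ_{s, x} t` with respect to `t` at `t = 1`
  have hne : ∀ s x, s ≠ 0 → |s| < r → x ∈ Metric.ball x₀ r →
      fderiv ℝ Φ (s, x) (1, 0) = X (Φ (s, x)) := by
    intro s x hs0 hs hx
    have hp := (hball _ (hmem hs hx)).2
    obtain ⟨c, c0, cγ, cd⟩ := hp.exists_hasDerivAt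
    have h1 : HasDerivAt (fun t : ℝ => Φ (t * s, x)) (s • fderiv ℝ Φ (s, x) (1, 0)) 1 := by
      have h2 : HasDerivAt (fun t : ℝ => t * s) s 1 := by
        simpa using (hasDerivAt_id (1 : ℝ)).mul_const s
      have h3 := hder s x hs hx
      rw [← one_mul s] at h3
      have h4 := h3.scomp (1 : ℝ) h2
      rw [one_mul] at h4
      exact h4
    have h2 : HasDerivWithinAt c (s • fderiv ℝ Φ (s, x) (1, 0)) (Icc 0 1) 1 := by
      refine h1.hasDerivWithinAt.congr_of_mem ?_ (right_mem_Icc.2 zero_le_one)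
      intro t ht
      have hts : |t * s| < r := by
        rw [abs_mul, abs_of_nonneg ht.1]
        exact (mul_le_of_le_one_left (abs_nonneg s) ht.2).trans_lt hs
      rw [cγ ⟨t, ht⟩]
      exact (hp.apply_one_eq hL ⟨t, ht⟩ (hball _ (hmem hts hx)).2).symm
    have h3 := (cd 1 (right_mem_Icc.2 zero_le_one)).hasDerivWithinAt (s := Icc 0 1)
    have h4 := (uniqueDiffOn_Icc (zero_lt_one' ℝ) 1 (right_mem_Icc.2 zero_le_one)).eq_deriv _ h2 h3
    rw [smul_right_injective E hs0 h4]
    congr 1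
    exact cγ 1
  -- the case `s = 0` follows by continuity
  have hall : ∀ s x, |s| < r → x ∈ Metric.ball x₀ r →
      fderiv ℝ Φ (s, x) (1, 0) = X (Φ (s, x)) := by
    intro s x hs hx
    by_cases h0 : s = 0
    · subst h0
      have hsm0 := hsm _ (hball _ (hmem hs hx)).1
      have hι : ContinuousAt (fun s : ℝ => (s, x)) 0 := by fun_prop
      have hc1 : ContinuousAt (fun s : ℝ => fderiv ℝ Φ (s, x) (1, 0)) 0 :=
        (ContinuousAt.comp (f := fun s : ℝ => (s, x)) (g := fderiv ℝ Φ) (x := (0 : ℝ))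
          (hsm0.fderiv_right (m := 0) (by simp)).continuousAt hι).clm_apply continuousAt_const
      have hc2 : ContinuousAt (fun s : ℝ => X (Φ (s, x))) 0 :=
        hX.continuous.continuousAt.comp
          (ContinuousAt.comp (f := fun s : ℝ => (s, x)) (g := Φ) (x := (0 : ℝ))
            hsm0.continuousAt hι)
      refine tendsto_nhds_unique_of_eventuallyEq (hc1.tendsto.mono_left nhdsWithin_le_nhds)
        (hc2.tendsto.mono_left (nhdsWithin_le_nhds (s := {0}ᶜ))) ?_
      filter_upwards [self_mem_nhdsWithin,
        mem_nhdsWithin_of_mem_nhds (Metric.ball_mem_nhds (0 : ℝ) hr)] with s hs0 hs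
      exact hne s x hs0 (by simpa using hs) hx
    · exact hne s x h0 hs hx
  refine ⟨Φ, hγ.mono fun p hp => hsm p hp.1, ?_, ?_⟩
  · filter_upwards [Metric.ball_mem_nhds ((0 : ℝ), x₀) hr] with p hp
    rw [← ball_prod_same] at hp
    have hp1 : |p.1| < r := by simpa using hp.1
    have := hder p.1 p.2 hp1 hp.2
    rwa [hall p.1 p.2 hp1 hp.2] at this
  · filter_upwards [Metric.ball_mem_nhds x₀ hr] with x hx
    have := (hball _ (hmem (s := 0) (by simpa using hr) hx)).2
    obtain ⟨c, c0, cγ, cd⟩ := this.exists_hasDerivAt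
    have h1 := this.apply_one_eq hL 0 (by simpa using this)
    change γ (0, x) 1 = x
    rw [h1, ← cγ 0]
    exact c0

/-- A vector field that is smooth near `x₀` has a smooth local flow near `x₀`. -/
theorem exists_smooth_flow [FiniteDimensional ℝ E] {X : E → E} {x₀ : E}
    (hX : ∀ᶠ x in 𝓝 x₀, ContDiffAt ℝ ∞ X x) :
    ∃ Φ : ℝ × E → E, (∀ᶠ p in 𝓝 ((0 : ℝ), x₀), ContDiffAt ℝ ∞ Φ p) ∧
      (∀ᶠ p in 𝓝 ((0 : ℝ), x₀), HasDerivAt (fun s => Φ (s, p.2)) (X (Φ p)) p.1) ∧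
      ∀ᶠ x in 𝓝 x₀, Φ (0, x) = x := by
  obtain ⟨Y, hY, hYc, hYX⟩ := exists_contDiff_hasCompactSupport_eventuallyEq hX
  obtain ⟨L, hL⟩ := hY.lipschitzWith_of_hasCompactSupport hYc (by simp)
  obtain ⟨Φ, h1, h2, h3⟩ := exists_smooth_flow_of_lipschitz hY hL x₀
  refine ⟨Φ, h1, ?_, h3⟩
  have hc : Tendsto Φ (𝓝 ((0 : ℝ), x₀)) (𝓝 x₀) := by
    have := h1.self_of_nhds.continuousAt.tendsto
    rwa [h3.self_of_nhds] at this
  filter_upwards [h2, hc.eventually hYX] with p hp hp'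
  rwa [← hp']

end Flow

/-! ### The weighted Wiener algebra -/

section WienerAlgebra

variable {d : Type*}

/-- Convolution of families of Fourier coefficients. It is used for absolutely summable families; a
divergent sum has the value `0`. -/
noncomputable def conv (a b : (d → ℤ) → ℂ) (k : d → ℤ) : ℂ := ∑' l, a (k - l) * b l

/-- The weighted `ℓ¹` norm of a family of Fourier coefficients, with values in `[0, ∞]`. -/
noncomputable def wnorm (w : (d → ℤ) → ENNReal) (c : (d → ℤ) → ℂ) : ENNReal := ∑' k, w k * ‖c k‖ₑ

theorem enorm_tsum_le {ι : Type*} (f : ι → ℂ) : ‖∑' i, f i‖ₑ ≤ ∑' i, ‖f i‖ₑ := by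
  by_cases h : ∑' i, ‖f i‖ₑ = ⊤
  · simp [h]
  have h1 : Summable fun i => ‖f i‖ := by
    have := ENNReal.summable_toReal h
    simpa using this
  rw [← ofReal_norm]
  refine (ENNReal.ofReal_le_ofReal (norm_tsum_le_tsum_norm h1)).trans ?_
  rw [ENNReal.ofReal_tsum_of_nonneg (fun _ => norm_nonneg _) h1]
  simp

/-- A submultiplicative weight makes the weighted `ℓ¹` space a Banach algebra under convolution. -/
theorem wnorm_conv_le {w : (d → ℤ) → ENNReal} (hw : ∀ k l, w (k + l) ≤ w k * w l)
    (a b : (d → ℤ) → ℂ) : wnorm w (conv a b) ≤ wnorm w a * wnorm w b := by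
  calc wnorm w (conv a b)
      ≤ ∑' k, ∑' l, (w (k - l) * ‖a (k - l)‖ₑ) * (w l * ‖b l‖ₑ) := by
        refine ENNReal.tsum_le_tsum fun k => ?_
        refine (mul_le_mul_right (enorm_tsum_le _) _).trans ?_
        rw [← ENNReal.tsum_mul_left]
        refine ENNReal.tsum_le_tsum fun l => ?_
        have := hw (k - l) l
        rw [sub_add_cancel] at this
        rw [enorm_mul]
        calc w k * (‖a (k - l)‖ₑ * ‖b l‖ₑ) ≤ (w (k - l) * w l) * (‖a (k - l)‖ₑ * ‖b l‖ₑ) := by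
              gcongr
          _ = _ := by ring
    _ = ∑' l, (∑' k, w (k - l) * ‖a (k - l)‖ₑ) * (w l * ‖b l‖ₑ) := by
        rw [ENNReal.tsum_comm]
        simp_rw [ENNReal.tsum_mul_right]
    _ = ∑' l, wnorm w a * (w l * ‖b l‖ₑ) := by
        congr 1; ext l; congr 1
        exact (Equiv.subRight l).tsum_eq fun k => w k * ‖a k‖ₑ
    _ = wnorm w a * wnorm w b := ENNReal.tsum_mul_left

theorem wnorm_mono (w : (d → ℤ) → ENNReal) {a b : (d → ℤ) → ℂ} (h : ∀ k, ‖a k‖ ≤ ‖b k‖) :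
    wnorm w a ≤ wnorm w b :=
  ENNReal.tsum_le_tsum fun k => mul_le_mul_right (enorm_le_iff_norm_le.2 (h k)) _

/-- The terms of the Neumann series for `g = a + a * (S g)`, where `S` is a Fourier multiplier. -/
noncomputable def neumannTerm (a S : (d → ℤ) → ℂ) : ℕ → (d → ℤ) → ℂ
  | 0 => a
  | n + 1 => conv a fun l => S l * neumannTerm a S n l

theorem wnorm_neumannTerm_le {w : (d → ℤ) → ENNReal} (hw : ∀ k l, w (k + l) ≤ w k * w l)
    {a S : (d → ℤ) → ℂ} (hS : ∀ k, ‖S k‖ ≤ 1) (n : ℕ) :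
    wnorm w (neumannTerm a S n) ≤ wnorm w a * wnorm w a ^ n := by
  induction n with
  | zero => simp [neumannTerm]
  | succ n ih =>
    refine (wnorm_conv_le hw _ _).trans ?_
    rw [pow_succ']
    gcongr
    refine (wnorm_mono w fun k => ?_).trans ih
    rw [norm_mul]
    exact mul_le_of_le_one_left (norm_nonneg _) (hS k)

theorem tsum_wnorm_neumannTerm_le {w : (d → ℤ) → ENNReal} (hw : ∀ k l, w (k + l) ≤ w k * w l)
    {a S : (d → ℤ) → ℂ} (hS : ∀ k, ‖S k‖ ≤ 1) :
    ∑' n, wnorm w (neumannTerm a S n) ≤ wnorm w a * (1 - wnorm w a)⁻¹ := by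
  rw [← ENNReal.tsum_geometric, ← ENNReal.tsum_mul_left]
  exact ENNReal.tsum_le_tsum (wnorm_neumannTerm_le hw hS)

/-- The sum of the Neumann series for `g = a + a * (S g)`. -/
noncomputable def neumannSum (a S : (d → ℤ) → ℂ) (k : d → ℤ) : ℂ := ∑' n, neumannTerm a S n k

theorem wnorm_neumannSum_le {w : (d → ℤ) → ENNReal} (hw : ∀ k l, w (k + l) ≤ w k * w l)
    {a S : (d → ℤ) → ℂ} (hS : ∀ k, ‖S k‖ ≤ 1) :
    wnorm w (neumannSum a S) ≤ wnorm w a * (1 - wnorm w a)⁻¹ := by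
  refine le_trans ?_ (tsum_wnorm_neumannTerm_le hw hS)
  unfold wnorm
  rw [ENNReal.tsum_comm]
  refine ENNReal.tsum_le_tsum fun k => ?_
  rw [ENNReal.tsum_mul_left]
  gcongr
  exact enorm_tsum_le _

theorem neumannSum_eq {a S : (d → ℤ) → ℂ} (hS : ∀ k, ‖S k‖ ≤ 1) (ha : wnorm (fun _ => 1) a < 1)
    (k : d → ℤ) : neumannSum a S k = a k + conv a (fun l => S l * neumannSum a S l) k := by
  have htot : ∑' n, wnorm (fun _ => 1) (neumannTerm a S n) < ⊤ := by
    refine (tsum_wnorm_neumannTerm_le (fun _ _ => by simp) hS).trans_lt ?_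
    refine ENNReal.mul_lt_top (ha.trans ENNReal.one_lt_top) ?_
    simpa using ha
  have hle : ∀ k, ‖a k‖ₑ ≤ wnorm (fun _ => 1) a := fun k => by
    simpa [wnorm] using ENNReal.le_tsum (f := fun k => ‖a k‖ₑ) k
  have hsum : Summable (Function.uncurry fun n l => a (k - l) * (S l * neumannTerm a S n l)) := by
    have : ∑' p : ℕ × (d → ℤ), ‖a (k - p.2) * (S p.2 * neumannTerm a S p.1 p.2)‖ₑ ≠ ⊤ := by
      rw [ENNReal.tsum_prod']
      refine ne_of_lt (lt_of_le_of_lt ?_ (ENNReal.mul_lt_top (ha.trans ENNReal.one_lt_top) htot))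
      rw [← ENNReal.tsum_mul_left]
      refine ENNReal.tsum_le_tsum fun n => ?_
      unfold wnorm
      rw [← ENNReal.tsum_mul_left]
      refine ENNReal.tsum_le_tsum fun l => ?_
      rw [enorm_mul, enorm_mul]
      have h1 : ‖S l‖ₑ ≤ 1 := by
        rw [← enorm_one (G := ℂ)]; exact enorm_le_iff_norm_le.2 (by simpa using hS l)
      calc ‖a (k - l)‖ₑ * (‖S l‖ₑ * ‖neumannTerm a S n l‖ₑ)
          ≤ wnorm (fun _ => 1) a * (1 * ‖neumannTerm a S n l‖ₑ) := by
            gcongr; exact hle _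
        _ = _ := rfl
    have h2 := ENNReal.summable_toReal this
    simp only [toReal_enorm] at h2
    exact h2.of_norm
  have hsumk : Summable fun n => neumannTerm a S n k := by
    have : ∑' n, ‖neumannTerm a S n k‖ₑ ≠ ⊤ := by
      refine ne_of_lt (lt_of_le_of_lt (ENNReal.tsum_le_tsum fun n => ?_) htot)
      simpa [wnorm] using ENNReal.le_tsum (f := fun k => ‖neumannTerm a S n k‖ₑ) k
    have h2 := ENNReal.summable_toReal this
    simp only [toReal_enorm] at h2
    exact h2.of_norm
  unfold neumannSum
  rw [hsumk.tsum_eq_zero_add]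
  congr 1
  have : ∀ n, neumannTerm a S (n + 1) k = ∑' l, a (k - l) * (S l * neumannTerm a S n l) :=
    fun n => rfl
  simp_rw [this]
  rw [← hsum.tsum_comm]
  unfold conv
  congr 1; ext l
  rw [tsum_mul_left, tsum_mul_left]

variable [Fintype d]

/-- The `ℓ¹` size of a frequency vector. -/
def freqSize (k : d → ℤ) : ℝ := ∑ j, |(k j : ℝ)|

theorem freqSize_nonneg (k : d → ℤ) : 0 ≤ freqSize k :=
  Finset.sum_nonneg fun _ _ => abs_nonneg _

theorem freqSize_add_le (k l : d → ℤ) : freqSize (k + l) ≤ freqSize k + freqSize l := by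
  unfold freqSize
  rw [← Finset.sum_add_distrib]
  exact Finset.sum_le_sum fun j _ => by simpa using abs_add_le (k j : ℝ) (l j)

theorem abs_le_freqSize (k : d → ℤ) (j : d) : |(k j : ℝ)| ≤ freqSize k :=
  Finset.single_le_sum (f := fun j => |(k j : ℝ)|) (fun _ _ => abs_nonneg _) (Finset.mem_univ j)

/-- Families of Fourier coefficients that decay faster than every power of the frequency. -/
def RapidDecay (c : (d → ℤ) → ℂ) : Prop :=
  ∀ N : ℕ, Summable fun k => (1 + freqSize k) ^ N * ‖c k‖

theorem RapidDecay.summable_norm {c : (d → ℤ) → ℂ} (h : RapidDecay c) :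
    Summable fun k => ‖c k‖ := by simpa using h 0

theorem RapidDecay.of_norm_le {c c' : (d → ℤ) → ℂ} (h : RapidDecay c) (C : ℝ) (M : ℕ)
    (hc : ∀ k, ‖c' k‖ ≤ C * (1 + freqSize k) ^ M * ‖c k‖) : RapidDecay c' := by
  intro N
  refine Summable.of_nonneg_of_le (fun k => ?_) (fun k => ?_) ((h (N + M)).mul_left C)
  · have := freqSize_nonneg k
    positivity
  · have := freqSize_nonneg k
    calc (1 + freqSize k) ^ N * ‖c' k‖
        ≤ (1 + freqSize k) ^ N * (C * (1 + freqSize k) ^ M * ‖c k‖) := by gcongr; exact hc k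
      _ = C * ((1 + freqSize k) ^ (N + M) * ‖c k‖) := by ring

/-- The norm with the weight `(1 + ε |k|) ^ N` tends to the `ℓ¹` norm for `ε → 0`, by dominated
convergence. -/
theorem exists_small_weight {a : (d → ℤ) → ℂ} (ha : RapidDecay a) (hsmall : ∑' k, ‖a k‖ < 1 / 2)
    (N : ℕ) : ∃ ε : ℝ, 0 < ε ∧ ε ≤ 1 ∧ ∑' k, (1 + ε * freqSize k) ^ N * ‖a k‖ < 1 / 2 := by
  have h1 : Tendsto (fun ε : ℝ => ∑' k, (1 + ε * freqSize k) ^ N * ‖a k‖) (𝓝[>] 0)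
      (𝓝 (∑' k, ‖a k‖)) := by
    refine tendsto_tsum_of_dominated_convergence (ha N) (fun k => ?_) ?_
    · have : Continuous fun ε : ℝ => (1 + ε * freqSize k) ^ N * ‖a k‖ := by fun_prop
      have h := this.tendsto 0
      simp only [zero_mul, add_zero, one_pow, one_mul] at h
      exact h.mono_left nhdsWithin_le_nhds
    · filter_upwards [Ioc_mem_nhdsGT (zero_lt_one' ℝ)] with ε hε k
      have h0 := freqSize_nonneg k
      have hε0 := hε.1.le
      rw [Real.norm_of_nonneg (by positivity)]
      gcongr
      exact mul_le_of_le_one_left h0 hε.2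
  obtain ⟨ε, h2, h3⟩ := ((h1.eventually (gt_mem_nhds hsmall)).and
    (Ioc_mem_nhdsGT (zero_lt_one' ℝ))).exists
  exact ⟨ε, h3.1, h3.2, h2⟩

/-- The equation `g = a + a * (S g)` with a multiplier `|S| ≤ 1` and a rapidly decaying `a` of small
`ℓ¹` norm has a rapidly decaying solution. The Neumann series converges in `ℓ¹` with the weight
`(1 + ε |k|) ^ N` for every `N`, since `ε` may be chosen, depending on `N`, so small that the
weighted norm of `a` is small as well. -/
theorem exists_rapidDecay_fixedPoint {a S : (d → ℤ) → ℂ} (ha : RapidDecay a)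
    (hS : ∀ k, ‖S k‖ ≤ 1) (hsmall : ∑' k, ‖a k‖ < 1 / 2) :
    ∃ g : (d → ℤ) → ℂ, RapidDecay g ∧ (∀ k, g k = a k + conv a (fun l => S l * g l) k) ∧
      ∑' k, ‖g k‖ < 1 := by
  have hw : ∀ (ε : ℝ), 0 ≤ ε → ∀ N : ℕ, ∀ c : (d → ℤ) → ℂ,
      wnorm (fun k => ENNReal.ofReal ((1 + ε * freqSize k) ^ N)) c
        = ∑' k, ENNReal.ofReal ((1 + ε * freqSize k) ^ N * ‖c k‖) := by
    intro ε hε N c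
    unfold wnorm
    congr 1; ext k
    have := freqSize_nonneg k
    rw [ENNReal.ofReal_mul (by positivity), ofReal_norm]
  have hbound : ∀ (ε : ℝ), 0 ≤ ε → ε ≤ 1 → ∀ N : ℕ,
      ∑' k, (1 + ε * freqSize k) ^ N * ‖a k‖ < 1 / 2 →
      wnorm (fun k => ENNReal.ofReal ((1 + ε * freqSize k) ^ N)) a < 1 / 2 ∧
      wnorm (fun k => ENNReal.ofReal ((1 + ε * freqSize k) ^ N)) (neumannSum a S) < 1 := by
    intro ε hε hε1 N hlt
    have h1 : wnorm (fun k => ENNReal.ofReal ((1 + ε * freqSize k) ^ N)) a < 1 / 2 := by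
      rw [hw ε hε, ← ENNReal.ofReal_tsum_of_nonneg]
      · rw [ENNReal.ofReal_lt_iff_lt_toReal]
        · simpa using hlt
        · exact tsum_nonneg fun k => by have := freqSize_nonneg k; positivity
        · simp
      · intro k; have := freqSize_nonneg k; positivity
      · refine Summable.of_nonneg_of_le (fun k => ?_) (fun k => ?_) (ha N)
        · have := freqSize_nonneg k; positivity
        · have := freqSize_nonneg k
          gcongr
          exact mul_le_of_le_one_left this hε1
    refine ⟨h1, (wnorm_neumannSum_le ?_ hS).trans_lt ?_⟩
    · intro k l
      have hk := freqSize_nonneg k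
      have hl := freqSize_nonneg l
      have hkl := freqSize_nonneg (k + l)
      rw [← ENNReal.ofReal_mul (by positivity), ← mul_pow]
      apply ENNReal.ofReal_le_ofReal
      gcongr
      have := freqSize_add_le k l
      nlinarith [mul_nonneg (mul_nonneg hε hk) (mul_nonneg hε hl)]
    · set q := wnorm (fun k => ENNReal.ofReal ((1 + ε * freqSize k) ^ N)) a with hq
      have hq' : (1 : ENNReal) / 2 < 1 - q := by
        rw [lt_tsub_iff_right]
        calc (1 : ENNReal) / 2 + q < 1 / 2 + 1 / 2 := by
              exact ENNReal.add_lt_add_left (by simp) h1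
          _ = 1 := ENNReal.add_halves 1
      have h2 : (1 - q)⁻¹ < 2 := by
        have := ENNReal.inv_lt_inv.2 hq'
        simpa using this
      calc q * (1 - q)⁻¹ ≤ q * 2 := by gcongr
        _ < 1 / 2 * 2 := by
            exact (ENNReal.mul_lt_mul_iff_left (by simp) (by simp)).2 h1
        _ = 1 := ENNReal.div_mul_cancel (by simp) (by simp)
  -- `N = 0` is the unweighted norm
  have h0 := hbound 0 le_rfl zero_le_one 0 (by simpa using hsmall)
  refine ⟨neumannSum a S, ?_, ?_, ?_⟩
  · intro N
    obtain ⟨ε, hε, hε1, hlt⟩ := exists_small_weight ha hsmall N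
    have h1 := (hbound ε hε.le hε1 N hlt).2
    rw [hw ε hε.le] at h1
    have h2 := ENNReal.summable_toReal (h1.trans ENNReal.one_lt_top).ne
    -- the weights for `ε` and for `1` are equivalent
    refine Summable.of_nonneg_of_le (fun k => ?_) (fun k => ?_) (h2.mul_left ((ε⁻¹) ^ N))
    · have := freqSize_nonneg k; positivity
    · have := freqSize_nonneg k
      rw [ENNReal.toReal_ofReal (by positivity), ← mul_assoc, ← mul_pow]
      gcongr
      rw [mul_add, mul_one, ← mul_assoc, inv_mul_cancel₀ hε.ne', one_mul]
      gcongr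
      exact (one_le_inv₀ hε).2 hε1
  · apply neumannSum_eq hS
    have := h0.1
    simp only [pow_zero, ENNReal.ofReal_one] at this
    exact this.trans_le (by simp)
  · have h1 := h0.2
    simp only [pow_zero, ENNReal.ofReal_one, wnorm, one_mul] at h1
    have h2 := ENNReal.summable_toReal (h1.trans ENNReal.one_lt_top).ne
    simp only [toReal_enorm] at h2
    have h3 := ENNReal.ofReal_tsum_of_nonneg (fun k => norm_nonneg (neumannSum a S k)) h2
    simp only [ofReal_norm] at h3
    rw [← h3] at h1
    simpa using h1

end WienerAlgebra

/-! ### Fourier series -/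

section FourierSeries

variable {d : Type*} [Fintype d]

/-- The linear form `x ↦ 2πi k·x`. -/
noncomputable def freqForm (k : d → ℤ) : (d → ℝ) →L[ℝ] ℂ :=
  ∑ j, (ContinuousLinearMap.proj j : (d → ℝ) →L[ℝ] ℝ).smulRight
    (2 * Real.pi * Complex.I * (k j : ℂ))

/-- The character `x ↦ e^{2πi k·x}`. -/
noncomputable def character (k : d → ℤ) (x : d → ℝ) : ℂ := Complex.exp (freqForm k x)

theorem freqForm_apply (k : d → ℤ) (x : d → ℝ) :
    freqForm k x = ∑ j, (x j : ℂ) * (2 * Real.pi * Complex.I * (k j : ℂ)) := by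
  simp [freqForm]

theorem norm_character (k : d → ℤ) (x : d → ℝ) : ‖character k x‖ = 1 := by
  have : freqForm k x = ((∑ j, x j * (2 * Real.pi * (k j : ℝ)) : ℝ) : ℂ) * Complex.I := by
    rw [freqForm_apply]
    push_cast
    rw [Finset.sum_mul]
    exact Finset.sum_congr rfl fun j _ => by ring
  rw [character, this, Complex.norm_exp_ofReal_mul_I]

theorem character_add_freq (k l : d → ℤ) (x : d → ℝ) :
    character (k + l) x = character k x * character l x := by
  rw [character, character, character, ← Complex.exp_add]
  congr 1
  simp only [freqForm_apply, ← Finset.sum_add_distrib, Pi.add_apply, Int.cast_add]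
  exact Finset.sum_congr rfl fun j _ => by ring

theorem norm_freqForm_le (k : d → ℤ) : ‖freqForm k‖ ≤ 2 * Real.pi * freqSize k := by
  refine ContinuousLinearMap.opNorm_le_bound _ ?_ fun x => ?_
  · have := freqSize_nonneg k
    positivity
  rw [freqForm_apply, freqSize, Finset.mul_sum, Finset.sum_mul]
  refine (norm_sum_le _ _).trans (Finset.sum_le_sum fun j _ => ?_)
  simp only [norm_mul, Complex.norm_real, Complex.norm_I, Complex.norm_ofNat, Complex.norm_intCast,
    mul_one, Real.norm_of_nonneg Real.pi_pos.le]
  have := norm_le_pi_norm x j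
  rw [mul_comm]
  gcongr

/-- The Fourier series with coefficients `c`. -/
noncomputable def fourierSum (c : (d → ℤ) → ℂ) (x : d → ℝ) : ℂ := ∑' k, c k * character k x

theorem summable_fourierSum {c : (d → ℤ) → ℂ} (hc : Summable fun k => ‖c k‖) (x : d → ℝ) :
    Summable fun k => c k * character k x := by
  refine Summable.of_norm ?_
  simpa [norm_character] using hc

/-- Termwise differentiation of a Fourier series. -/
theorem hasFDerivAt_fourierSum {c : (d → ℤ) → ℂ} (hc : RapidDecay c) (x : d → ℝ) :
    HasFDerivAt (fourierSum c) (∑ j, (ContinuousLinearMap.proj j : (d → ℝ) →L[ℝ] ℝ).smulRight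
      (fourierSum (fun k => 2 * Real.pi * Complex.I * (k j : ℂ) * c k) x)) x := by
  have hbase : Summable fun k => 2 * Real.pi * ((1 + freqSize k) ^ 1 * ‖c k‖) :=
    (hc 1).mul_left _
  have hder : ∀ k x, HasFDerivAt (fun x => c k * character k x)
      ((c k * character k x) • freqForm k) x := by
    intro k x
    have := ((freqForm k).hasFDerivAt (x := x)).cexp.const_mul (c k)
    rwa [smul_smul] at this
  have hle : ∀ k x, ‖(c k * character k x) • freqForm k‖
      ≤ 2 * Real.pi * ((1 + freqSize k) ^ 1 * ‖c k‖) := by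
    intro k x
    rw [norm_smul, norm_mul, norm_character, mul_one, pow_one]
    have h0 := freqSize_nonneg k
    calc ‖c k‖ * ‖freqForm k‖ ≤ ‖c k‖ * (2 * Real.pi * freqSize k) := by
          gcongr; exact norm_freqForm_le k
      _ ≤ ‖c k‖ * (2 * Real.pi * (1 + freqSize k)) := by gcongr; linarith
      _ = _ := by ring
  have h1 := hasFDerivAt_tsum hbase hder hle (summable_fourierSum hc.summable_norm 0) x
  refine h1.congr_fderiv ?_
  have hsum : ∀ j, Summable fun k => 2 * Real.pi * Complex.I * (k j : ℂ) * c k * character k x := by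
    intro j
    refine summable_fourierSum (hc.of_norm_le (2 * Real.pi) 1 fun k => ?_).summable_norm x
    simp only [norm_mul, Complex.norm_real, Complex.norm_I, Complex.norm_ofNat,
      Complex.norm_intCast, mul_one, Real.norm_of_nonneg Real.pi_pos.le, pow_one]
    have := abs_le_freqSize k j
    gcongr
    linarith
  have hsum' : Summable fun k => (c k * character k x) • freqForm k :=
    Summable.of_norm_bounded hbase fun k => hle k x
  ext v
  refine ((ContinuousLinearMap.apply ℝ ℂ v).map_tsum hsum').trans ?_
  simp only [sum_apply, ContinuousLinearMap.smulRight_apply,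
    ContinuousLinearMap.proj_apply, fourierSum, smul_apply,
    ContinuousLinearMap.apply_apply]
  simp_rw [← tsum_const_smul'']
  rw [← Summable.tsum_finsetSum fun j _ => (hsum j).const_smul (v j)]
  congr 1; ext k
  rw [freqForm_apply, smul_eq_mul, Finset.mul_sum]
  refine Finset.sum_congr rfl fun j _ => ?_
  rw [Complex.real_smul]
  ring

theorem RapidDecay.derivCoeff {c : (d → ℤ) → ℂ} (hc : RapidDecay c) (j : d) :
    RapidDecay fun k => 2 * Real.pi * Complex.I * (k j : ℂ) * c k := by
  refine hc.of_norm_le (2 * Real.pi) 1 fun k => ?_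
  simp only [norm_mul, Complex.norm_real, Complex.norm_I, Complex.norm_ofNat,
    Complex.norm_intCast, mul_one, Real.norm_of_nonneg Real.pi_pos.le, pow_one]
  have := abs_le_freqSize k j
  gcongr
  linarith

theorem contDiff_fourierSum_nat (n : ℕ) {c : (d → ℤ) → ℂ} (hc : RapidDecay c) :
    ContDiff ℝ n (fourierSum c) := by
  induction n generalizing c with
  | zero =>
    rw [Nat.cast_zero, contDiff_zero]
    exact continuous_iff_continuousAt.2 fun x => (hasFDerivAt_fourierSum hc x).continuousAt
  | succ n ih =>
    rw [Nat.cast_succ, contDiff_succ_iff_hasFDerivAt]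
    refine ⟨_, ?_, hasFDerivAt_fourierSum hc⟩
    refine ContDiff.sum fun j _ => ?_
    exact contDiff_const.smulRight (ih (hc.derivCoeff j))

theorem contDiff_fourierSum {c : (d → ℤ) → ℂ} (hc : RapidDecay c) :
    ContDiff ℝ ∞ (fourierSum c) :=
  contDiff_infty.2 fun n => contDiff_fourierSum_nat n hc

theorem fderiv_fourierSum_single [DecidableEq d] {c : (d → ℤ) → ℂ} (hc : RapidDecay c)
    (x : d → ℝ) (j : d) : fderiv ℝ (fourierSum c) x (Pi.single j 1)
      = fourierSum (fun k => 2 * Real.pi * Complex.I * (k j : ℂ) * c k) x := by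
  rw [(hasFDerivAt_fourierSum hc x).fderiv, sum_apply,
    Finset.sum_eq_single j]
  · simp
  · intro i _ hi
    simp [Pi.single_eq_of_ne hi]
  · simp

theorem fourierSum_conv {a b : (d → ℤ) → ℂ} (ha : Summable fun k => ‖a k‖)
    (hb : Summable fun k => ‖b k‖) (x : d → ℝ) :
    Summable (fun k => conv a b k * character k x) ∧
    fourierSum (conv a b) x = fourierSum a x * fourierSum b x := by
  have ha' : Summable fun k => ‖a k * character k x‖ := by simpa [norm_character] using ha
  have hb' : Summable fun k => ‖b k * character k x‖ := by simpa [norm_character] using hb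
  -- the shear `(k, l) ↦ (k - l, l)` turns the convolution into the Cauchy product
  obtain ⟨e, he⟩ : ∃ e : ((d → ℤ) × (d → ℤ)) ≃ ((d → ℤ) × (d → ℤ)),
      ∀ p, e p = (p.1 - p.2, p.2) :=
    ⟨⟨fun p => (p.1 - p.2, p.2), fun p => (p.1 + p.2, p.2), fun p => by simp, fun p => by simp⟩,
      fun p => rfl⟩
  have hf := summable_mul_of_summable_norm ha' hb'
  have hfe := (e.summable_iff).2 hf
  have hfib : ∀ k, conv a b k * character k x = ∑' l, ((fun p : (d → ℤ) × (d → ℤ) =>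
      (a p.1 * character p.1 x) * (b p.2 * character p.2 x)) ∘ e) (k, l) := by
    intro k
    unfold conv
    rw [← tsum_mul_right]
    refine tsum_congr fun l => ?_
    have : character k x = character (k - l) x * character l x := by
      rw [← character_add_freq, sub_add_cancel]
    rw [Function.comp_apply, he, this]
    ring
  constructor
  · have h1 := hfe.prod
    exact h1.congr fun k => (hfib k).symm
  · unfold fourierSum
    rw [tsum_congr hfib, ← hfe.tsum_prod, tsum_mul_tsum_of_summable_norm ha' hb']
    exact e.tsum_eq fun p : (d → ℤ) × (d → ℤ) =>
      (a p.1 * character p.1 x) * (b p.2 * character p.2 x)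

end FourierSeries

/-! ### Fourier coefficients of smooth periodic functions -/

section FourierCoefficients

variable {d : Type*}

/-- `ℤ^d`-periodicity of a function on `ℝ^d`. -/
def IsPeriodic (F : (d → ℝ) → ℂ) : Prop :=
  ∀ (x : d → ℝ) (n : d → ℤ), F (fun j => x j + n j) = F x

/-- A continuous periodic function descends to the torus. -/
theorem exists_torusLift {F : (d → ℝ) → ℂ} (hF : Continuous F) (hP : IsPeriodic F) :
    ∃ f : C(UnitAddTorus d, ℂ), ∀ x : d → ℝ, f (fun j => (x j : UnitAddCircle)) = F x := by
  have hout : ∀ x : d → ℝ, F (fun j => Quotient.out (x j : UnitAddCircle)) = F x := by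
    intro x
    have : ∀ j, ∃ n : ℤ, Quotient.out (x j : UnitAddCircle) = x j + n := by
      intro j
      have h : ((Quotient.out (x j : UnitAddCircle) - x j : ℝ) : UnitAddCircle) = 0 := by
        rw [AddCircle.coe_sub, sub_eq_zero]
        exact QuotientAddGroup.out_eq' _
      obtain ⟨n, hn⟩ := AddCircle.coe_eq_zero_iff (1 : ℝ) |>.1 h
      refine ⟨n, ?_⟩
      have : (n : ℝ) = Quotient.out (x j : UnitAddCircle) - x j := by simpa using hn
      linarith
    choose n hn using this
    simp_rw [hn]
    exact hP x n
  have hq : IsOpenQuotientMap (Pi.map fun (_ : d) (t : ℝ) => (t : UnitAddCircle)) :=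
    IsOpenQuotientMap.piMap fun _ => QuotientAddGroup.isOpenQuotientMap_mk
  refine ⟨⟨fun τ => F fun j => Quotient.out (τ j), ?_⟩, hout⟩
  rw [← hq.continuous_comp_iff]
  exact hF.congr fun x => (hout x).symm

theorem IsPeriodic.exists_norm_le {F : (d → ℝ) → ℂ} (hF : Continuous F) (hP : IsPeriodic F) :
    ∃ C, 0 ≤ C ∧ ∀ x, ‖F x‖ ≤ C := by
  obtain ⟨f, hf⟩ := exists_torusLift hF hP
  exact ⟨‖f‖, norm_nonneg _, fun x => by rw [← hf]; exact f.norm_coe_le_norm _⟩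

variable [Fintype d]

/-- The half-open unit cube with corner `a`. -/
def unitBox (a : d → ℝ) : Set (d → ℝ) := {x | ∀ i, x i ∈ Ioc (a i) (a i + 1)}

theorem volume_unitBox (a : d → ℝ) : volume (unitBox a) = 1 := by
  have : unitBox a = Set.pi univ fun i => Ioc (a i) (a i + 1) := by
    ext x; simp [unitBox, Set.mem_pi]
  rw [this, Real.volume_pi_Ioc]
  simp

/-- The Fourier coefficients of a periodic function, as integrals over the unit cube. -/
noncomputable def periodCoeff (F : (d → ℝ) → ℂ) (k : d → ℤ) : ℂ :=
  ∫ x in unitBox (0 : d → ℝ), character (-k) x * F x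

theorem mFourier_coe (k : d → ℤ) (x : d → ℝ) :
    UnitAddTorus.mFourier k (fun j => (x j : UnitAddCircle)) = character k x := by
  simp only [UnitAddTorus.mFourier, ContinuousMap.coe_mk, fourier_coe_apply, character,
    freqForm_apply, Complex.exp_sum]
  refine Finset.prod_congr rfl fun j _ => ?_
  congr 1
  simp
  ring

/-- The Fourier coefficients may be computed on any unit cube. -/
theorem IsPeriodic.integral_unitBox {F : (d → ℝ) → ℂ} (hF : Continuous F) (hP : IsPeriodic F)
    (k : d → ℤ) (a : d → ℝ) :
    ∫ x in unitBox a, character (-k) x * F x = periodCoeff F k := by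
  obtain ⟨f, hf⟩ := exists_torusLift hF hP
  have h : ∀ a : d → ℝ, UnitAddTorus.mFourierCoeff f k
      = ∫ x in unitBox a, character (-k) x * F x := by
    intro a
    rw [UnitAddTorus.mFourierCoeff_eq_integral f k a]
    simp_rw [mFourier_coe, hf, smul_eq_mul]
    rfl
  rw [periodCoeff, ← h, ← h]

theorem continuous_character (k : d → ℤ) : Continuous (character k) :=
  Complex.continuous_exp.comp (freqForm k).continuous

theorem norm_periodCoeff_le {F : (d → ℝ) → ℂ} {C : ℝ} (hC : ∀ x, ‖F x‖ ≤ C) (k : d → ℤ) :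
    ‖periodCoeff F k‖ ≤ C := by
  have := norm_setIntegral_le_of_norm_le_const (μ := volume) (s := unitBox (0 : d → ℝ))
    (f := fun x => character (-k) x * F x) (C := C) (by simp [volume_unitBox])
    (fun x _ => by rw [norm_mul, norm_character, one_mul]; exact hC x)
  simpa [periodCoeff, Measure.real, volume_unitBox] using this

theorem character_add (k : d → ℤ) (x y : d → ℝ) :
    character k (x + y) = character k x * character k y := by
  rw [character, map_add, Complex.exp_add]; rfl

theorem character_neg_mul_character (k : d → ℤ) (x : d → ℝ) :
    character (-k) x * character k x = 1 := by
  rw [← character_add_freq, neg_add_cancel]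
  simp [character, freqForm_apply]

theorem IsPeriodic.periodCoeff_translate {F : (d → ℝ) → ℂ} (hF : Continuous F)
    (hP : IsPeriodic F) (k : d → ℤ) (v : d → ℝ) :
    periodCoeff (fun x => F (x + v)) k = character k v * periodCoeff F k := by
  have hpre : (fun x : d → ℝ => x + v) ⁻¹' unitBox v = unitBox 0 := by
    ext x
    simp only [unitBox, mem_preimage, mem_ofPred_eq, Pi.add_apply, mem_Ioc, Pi.zero_apply]
    refine forall_congr' fun i => and_congr ?_ ?_
    · constructor <;> intro h <;> linarith
    · constructor <;> intro h <;> linarith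
  have h1 := (measurePreserving_add_right (volume : Measure (d → ℝ)) v).setIntegral_preimage_emb
    (measurableEmbedding_addRight v) (fun x => character (-k) x * F x) (unitBox v)
  rw [hpre] at h1
  rw [← hP.integral_unitBox hF k v, ← h1, ← integral_const_mul, periodCoeff]
  refine integral_congr_ae (Eventually.of_forall fun x => ?_)
  simp only [character_add]
  linear_combination (-(character (-k) x * F (x + v))) * character_neg_mul_character k v

/-- Convergence of the lattice sum `∑ (1 + |k|) ^ (-(dim + 1))`. -/
theorem summable_freqSize : Summable fun k : d → ℤ => ((1 + freqSize k) ^ (Fintype.card d + 1))⁻¹ := by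
  let b := Pi.basisFun ℝ d
  let L := Submodule.span ℤ (Set.range b)
  have hmem : ∀ k : d → ℤ, (fun j => (k j : ℝ)) ∈ L := by
    intro k
    rw [b.mem_span_iff_repr_mem ℤ]
    intro j
    exact ⟨k j, by simp [b]⟩
  have hrank : Module.finrank ℤ L = Fintype.card d := by
    rw [ZLattice.rank ℝ L]; simp
  -- the shift by `1/2` keeps the lattice points away from the origin
  have h1 := ZLattice.summable_norm_sub_inv_pow L (Fintype.card d + 1) (by omega)
    (fun _ : d => (1 / 2 : ℝ))
  let φ : (d → ℤ) → L := fun k => ⟨fun j => (k j : ℝ), hmem k⟩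
  have hφ : Function.Injective φ := by
    intro k l h
    ext j
    have := congrFun (congrArg Subtype.val h) j
    have h2 : (k j : ℝ) = l j := this
    exact_mod_cast h2
  by_cases hd : Nonempty d
  · refine Summable.of_nonneg_of_le (fun k => ?_) (fun k => ?_) (h1.comp_injective hφ)
    · have := freqSize_nonneg k; positivity
    · have h0 := freqSize_nonneg k
      rw [Function.comp_apply, ← inv_pow]
      gcongr
      · obtain ⟨j⟩ := hd
        have h2 := norm_le_pi_norm (((φ k : L) : d → ℝ) - fun _ : d => (1 / 2 : ℝ)) j
        refine lt_of_lt_of_le ?_ h2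
        rw [norm_pos_iff]
        simp only [Pi.sub_apply, φ]
        intro h
        have h3 : (2 * k j : ℝ) = 1 := by linarith
        have h4 : 2 * k j = 1 := by exact_mod_cast h3
        omega
      · refine (pi_norm_le_iff_of_nonneg (by positivity)).2 fun j => ?_
        simp only [Pi.sub_apply, φ, Real.norm_eq_abs]
        have := abs_le_freqSize k j
        refine (abs_sub _ _).trans ?_
        rw [abs_of_pos (by norm_num : (0 : ℝ) < 1 / 2)]
        linarith
  · have : IsEmpty d := not_nonempty_iff.1 hd
    exact (hasSum_unique _).summable

variable [DecidableEq d]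

/-- The partial derivative in the `j`-th coordinate direction. -/
noncomputable def partialDeriv (j : d) (F : (d → ℝ) → ℂ) (x : d → ℝ) : ℂ :=
  fderiv ℝ F x (Pi.single j 1)

theorem contDiff_partialDeriv {F : (d → ℝ) → ℂ} (hF : ContDiff ℝ ∞ F) (j : d) :
    ContDiff ℝ ∞ (partialDeriv j F) :=
  (hF.fderiv_right (m := ∞) (by simp)).clm_apply contDiff_const

theorem IsPeriodic.partialDeriv {F : (d → ℝ) → ℂ} (hP : IsPeriodic F) (j : d) :
    IsPeriodic (partialDeriv j F) := by
  intro x n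
  have h : (fun y : d → ℝ => F (y + fun j => (n j : ℝ))) = F := funext fun y => hP y n
  have := fderiv_comp_add_right (𝕜 := ℝ) (f := F) (x := x) (fun j => (n j : ℝ))
  rw [h] at this
  simp only [Teleparallel.partialDeriv]
  rw [this]
  rfl

/-- Differentiation multiplies the Fourier coefficients by `2πi k_j`. This is the derivative at
`s = 0` of the effect of a translation by `s` in the `j`-th direction. -/
theorem IsPeriodic.periodCoeff_partialDeriv {F : (d → ℝ) → ℂ} (hF : ContDiff ℝ ∞ F)
    (hP : IsPeriodic F) (j : d) (k : d → ℤ) :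
    periodCoeff (Teleparallel.partialDeriv j F) k
      = 2 * Real.pi * Complex.I * (k j : ℂ) * periodCoeff F k := by
  obtain ⟨C, hC0, hC⟩ := (hP.partialDeriv j).exists_norm_le (contDiff_partialDeriv hF j).continuous
  let e : d → ℝ := Pi.single j 1
  have hfin : IsFiniteMeasure (volume.restrict (unitBox (0 : d → ℝ))) :=
    ⟨by simp [volume_unitBox]⟩
  obtain ⟨B, hB0, hB⟩ := hP.exists_norm_le hF.continuous
  have hline : ∀ (x : d → ℝ) (s : ℝ),
      HasDerivAt (fun s : ℝ => F (x + s • e)) (Teleparallel.partialDeriv j F (x + s • e)) s := by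
    intro x s
    have h1 : HasDerivAt (fun s : ℝ => x + s • e) e s := by
      simpa using ((hasDerivAt_id s).smul_const e).const_add x
    exact ((hF.differentiable (by simp)) _).hasFDerivAt.comp_hasDerivAt s h1
  have hder := (hasDerivAt_integral_of_dominated_loc_of_deriv_le
    (μ := volume.restrict (unitBox (0 : d → ℝ))) (x₀ := (0 : ℝ)) (s := univ)
    (F := fun s x => character (-k) x * F (x + s • e))
    (F' := fun s x => character (-k) x * Teleparallel.partialDeriv j F (x + s • e))
    (bound := fun _ => C) univ_mem ?_ ?_ ?_ ?_ ?_ ?_).2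
  · have h2 : (fun s : ℝ => ∫ x in unitBox (0 : d → ℝ), character (-k) x * F (x + s • e))
        = fun s => character k (s • e) * periodCoeff F k := by
      ext s
      exact hP.periodCoeff_translate hF.continuous k (s • e)
    rw [h2] at hder
    have h3 : HasDerivAt (fun s : ℝ => character k (s • e) * periodCoeff F k)
        (2 * Real.pi * Complex.I * (k j : ℂ) * periodCoeff F k) 0 := by
      have h4 : HasDerivAt (fun s : ℝ => s • e) e 0 := by
        simpa using (hasDerivAt_id (0 : ℝ)).smul_const e
      have h5 := (((freqForm k).hasFDerivAt.comp_hasDerivAt (0 : ℝ) h4).cexp).mul_const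
        (periodCoeff F k)
      have h6 : freqForm k e = 2 * Real.pi * Complex.I * (k j : ℂ) := by
        rw [freqForm_apply, Finset.sum_eq_single j]
        · simp [e]
        · intro i _ hi; simp [e, Pi.single_eq_of_ne hi]
        · simp
      simp only [zero_smul, map_zero, Complex.exp_zero, one_mul, h6, Function.comp_def] at h5
      exact h5
    have := hder.unique h3
    simpa [periodCoeff] using this
  · refine Eventually.of_forall fun s => Continuous.aestronglyMeasurable ?_
    have := continuous_character (-k)
    have := hF.continuous
    fun_prop
  · refine Integrable.of_bound (C := B) ?_ (Eventually.of_forall fun x => ?_)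
    · refine Continuous.aestronglyMeasurable ?_
      have := continuous_character (-k)
      have := hF.continuous
      fun_prop
    · rw [norm_mul, norm_character, one_mul]; exact hB _
  · refine Continuous.aestronglyMeasurable ?_
    have := continuous_character (-k)
    have := (contDiff_partialDeriv hF j).continuous
    fun_prop
  · refine Eventually.of_forall fun x s _ => ?_
    rw [norm_mul, norm_character, one_mul]; exact hC _
  · exact integrable_const C
  · refine Eventually.of_forall fun x s _ => (hline x s).const_mul _

theorem iterate_partialDeriv {F : (d → ℝ) → ℂ} (hF : ContDiff ℝ ∞ F) (hP : IsPeriodic F) (j : d)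
    (M : ℕ) : ContDiff ℝ ∞ ((Teleparallel.partialDeriv j)^[M] F) ∧
      IsPeriodic ((Teleparallel.partialDeriv j)^[M] F) ∧
      ∀ k, periodCoeff ((Teleparallel.partialDeriv j)^[M] F) k
        = (2 * Real.pi * Complex.I * (k j : ℂ)) ^ M * periodCoeff F k := by
  induction M with
  | zero => exact ⟨hF, hP, by simp⟩
  | succ M ih =>
    rw [Function.iterate_succ_apply']
    refine ⟨contDiff_partialDeriv ih.1 j, ih.2.1.partialDeriv j, fun k => ?_⟩
    rw [ih.2.1.periodCoeff_partialDeriv ih.1, ih.2.2, pow_succ']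
    ring

/-- A bound on `F` and its pure derivatives of order `M` gives the decay of order `M` of the Fourier
coefficients. -/
theorem pow_mul_norm_periodCoeff_le [Nonempty d] {F : (d → ℝ) → ℂ} (hF : ContDiff ℝ ∞ F)
    (hP : IsPeriodic F) (M : ℕ) {B : ℝ} (hB : ∀ x, ‖F x‖ ≤ B)
    (hB' : ∀ j x, ‖(Teleparallel.partialDeriv j)^[M] F x‖ ≤ B) (k : d → ℤ) :
    (1 + freqSize k) ^ M * ‖periodCoeff F k‖ ≤ (1 + Fintype.card d) ^ M * B := by
  -- the largest frequency component controls `|k|`, so pure derivatives in its direction suffice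
  obtain ⟨j, hj⟩ := Finite.exists_max fun j => |(k j : ℝ)|
  have h0 := freqSize_nonneg k
  have h1 : freqSize k ≤ Fintype.card d * |(k j : ℝ)| := by
    have := Finset.sum_le_card_nsmul Finset.univ (fun j => |(k j : ℝ)|) _ fun i _ => hj i
    simpa [freqSize] using this
  have hcard : (0 : ℝ) ≤ Fintype.card d := by positivity
  by_cases hk : |(k j : ℝ)| ≤ 1
  · have : freqSize k ≤ Fintype.card d := h1.trans (mul_le_of_le_one_right hcard hk)
    gcongr
    exact norm_periodCoeff_le hB k
  · have hk' : 1 ≤ |(k j : ℝ)| := (not_le.1 hk).le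
    have h2 := norm_periodCoeff_le (hB' j) k
    rw [(iterate_partialDeriv hF hP j M).2.2 k] at h2
    simp only [norm_mul, norm_pow, Complex.norm_real, Complex.norm_I, Complex.norm_ofNat,
      Complex.norm_intCast, mul_one, Real.norm_of_nonneg Real.pi_pos.le] at h2
    have h3 : 1 + freqSize k ≤ (1 + Fintype.card d) * (2 * Real.pi * |(k j : ℝ)|) := by
      have hpi := Real.pi_gt_three
      have : 1 + freqSize k ≤ (1 + Fintype.card d) * |(k j : ℝ)| := by linarith
      refine this.trans ?_
      gcongr
      nlinarith
    calc (1 + freqSize k) ^ M * ‖periodCoeff F k‖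
        ≤ ((1 + Fintype.card d) * (2 * Real.pi * |(k j : ℝ)|)) ^ M * ‖periodCoeff F k‖ := by
          gcongr
      _ = (1 + Fintype.card d) ^ M * ((2 * Real.pi * |(k j : ℝ)|) ^ M * ‖periodCoeff F k‖) := by
          rw [mul_pow]; ring
      _ ≤ _ := by gcongr

theorem IsPeriodic.exists_bound_derivatives {F : (d → ℝ) → ℂ} (hF : ContDiff ℝ ∞ F)
    (hP : IsPeriodic F) (M : ℕ) :
    ∃ B, (∀ x, ‖F x‖ ≤ B) ∧ ∀ j x, ‖(Teleparallel.partialDeriv j)^[M] F x‖ ≤ B := by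
  obtain ⟨B₀, h0, hB₀⟩ := hP.exists_norm_le hF.continuous
  have h := fun j => (iterate_partialDeriv hF hP j M).2.1.exists_norm_le
    (iterate_partialDeriv hF hP j M).1.continuous
  choose B hB0 hB using h
  refine ⟨B₀ + ∑ j, B j, fun x => (hB₀ x).trans ?_, fun j x => (hB j x).trans ?_⟩
  · have := Finset.sum_nonneg fun j (_ : j ∈ Finset.univ) => hB0 j
    linarith
  · have := Finset.single_le_sum (fun j _ => hB0 j) (Finset.mem_univ j)
    linarith

theorem IsPeriodic.rapidDecay_periodCoeff [Nonempty d] {F : (d → ℝ) → ℂ} (hF : ContDiff ℝ ∞ F)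
    (hP : IsPeriodic F) : RapidDecay (periodCoeff F) := by
  intro N
  obtain ⟨B, hB, hB'⟩ := hP.exists_bound_derivatives hF (N + (Fintype.card d + 1))
  refine Summable.of_nonneg_of_le (fun k => ?_) (fun k => ?_) (summable_freqSize.mul_left
    ((1 + Fintype.card d : ℝ) ^ (N + (Fintype.card d + 1)) * B))
  · have := freqSize_nonneg k; positivity
  · have h0 := freqSize_nonneg k
    have := pow_mul_norm_periodCoeff_le hF hP _ hB hB' k
    rw [← div_eq_mul_inv, le_div_iff₀ (by positivity)]
    calc _ = (1 + freqSize k) ^ (N + (Fintype.card d + 1)) * ‖periodCoeff F k‖ := by ring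
      _ ≤ _ := this

theorem IsPeriodic.fourierSum_periodCoeff [Nonempty d] {F : (d → ℝ) → ℂ} (hF : ContDiff ℝ ∞ F)
    (hP : IsPeriodic F) (x : d → ℝ) : fourierSum (periodCoeff F) x = F x := by
  obtain ⟨f, hf⟩ := exists_torusLift hF.continuous hP
  have h : UnitAddTorus.mFourierCoeff f = periodCoeff F := by
    ext k
    rw [UnitAddTorus.mFourierCoeff_eq_integral f k 0]
    simp_rw [mFourier_coe, hf, smul_eq_mul]
    rfl
  have hs : Summable (UnitAddTorus.mFourierCoeff f) := by
    rw [h]; exact (hP.rapidDecay_periodCoeff hF).summable_norm.of_norm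
  have := UnitAddTorus.hasSum_mFourier_series_apply_of_summable hs fun j => (x j : UnitAddCircle)
  simp only [h, mFourier_coe, hf, smul_eq_mul] at this
  exact this.tsum_eq

/-- The `ℓ¹` norm of the Fourier coefficients is controlled by finitely many derivatives. -/
theorem tsum_norm_periodCoeff_le [Nonempty d] {F : (d → ℝ) → ℂ} (hF : ContDiff ℝ ∞ F)
    (hP : IsPeriodic F) {B : ℝ} (hB : ∀ x, ‖F x‖ ≤ B)
    (hB' : ∀ j x, ‖(Teleparallel.partialDeriv j)^[Fintype.card d + 1] F x‖ ≤ B) :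
    ∑' k, ‖periodCoeff F k‖ ≤ ((1 + Fintype.card d : ℝ) ^ (Fintype.card d + 1) *
      ∑' k : d → ℤ, ((1 + freqSize k) ^ (Fintype.card d + 1))⁻¹) * B := by
  rw [mul_right_comm, ← tsum_mul_left]
  refine Summable.tsum_le_tsum (fun k => ?_) (hP.rapidDecay_periodCoeff hF).summable_norm
    (summable_freqSize.mul_left _)
  have h0 := freqSize_nonneg k
  have := pow_mul_norm_periodCoeff_le hF hP _ hB hB' k
  rw [← div_eq_mul_inv, le_div_iff₀ (by positivity), mul_comm]
  exact this

end FourierCoefficients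

/-! ### Local solvability of the Beltrami equation -/

section Beltrami

variable {d : Type*} [Fintype d] [DecidableEq d]

/-- The periodic Beltrami equation `∂_b w = (i + δ) ∂_a w` for small `δ`. With
`g = (∂_b - i ∂_a) w` and `∂_a w = 1 + S g`, where `S` is the Fourier multiplier
`k_a / (k_b - i k_a)` of modulus at most one, it reads `g = δ (1 + S g)`. The other coordinates are
parameters. -/
theorem exists_periodic_beltrami_solution [Nonempty d] {a b : d} (hab : a ≠ b) {δ : (d → ℝ) → ℂ}
    (hδ : ContDiff ℝ ∞ δ) (hP : IsPeriodic δ) (hsmall : ∑' k, ‖periodCoeff δ k‖ < 1 / 2) :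
    ∃ w : (d → ℝ) → ℂ, ContDiff ℝ ∞ w ∧ ∀ x,
      partialDeriv b w x = (Complex.I + δ x) * partialDeriv a w x ∧
      0 < (partialDeriv a w x).re := by
  classical
  let D : (d → ℤ) → ℂ := fun k => (k b : ℂ) - Complex.I * (k a : ℂ)
  let S : (d → ℤ) → ℂ := fun k => (k a : ℂ) / D k
  have hDre : ∀ k, (D k).re = k b := fun k => by simp [D]
  have hDim : ∀ k, (D k).im = -k a := fun k => by simp [D]
  have hD0 : ∀ k, D k = 0 → k a = 0 ∧ k b = 0 := by
    intro k hk
    have h1 := hDre k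
    have h2 := hDim k
    rw [hk] at h1 h2
    simp only [Complex.zero_re, Complex.zero_im] at h1 h2
    constructor
    · have : (k a : ℝ) = 0 := by linarith
      exact_mod_cast this
    · exact_mod_cast h1.symm
  have hS : ∀ k, ‖S k‖ ≤ 1 := by
    intro k
    simp only [S, norm_div, Complex.norm_intCast]
    refine div_le_one_of_le₀ ?_ (norm_nonneg _)
    have := Complex.abs_im_le_norm (D k)
    rwa [hDim, abs_neg] at this
  obtain ⟨g, hg, hfix, hg1⟩ := exists_rapidDecay_fixedPoint (hP.rapidDecay_periodCoeff hδ) hS hsmall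
  -- the mean of `g` over the `(a, b)`-torus
  let β : (d → ℤ) → ℂ := fun k => if D k = 0 then g k else 0
  let f : (d → ℤ) → ℂ := fun k => g k / (2 * Real.pi * Complex.I * D k)
  have hpi : (2 * Real.pi * Complex.I : ℂ) ≠ 0 := by simp [Real.pi_ne_zero]
  have hβ : RapidDecay β := hg.of_norm_le 1 0 fun k => by
    by_cases h : D k = 0 <;> simp [β, h]
  have hf : RapidDecay f := hg.of_norm_le 1 0 fun k => by
    by_cases h : D k = 0
    · simp [f, h]
    · simp only [f, norm_div, norm_mul, Complex.norm_real, Complex.norm_I, Complex.norm_ofNat,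
        mul_one, Real.norm_of_nonneg Real.pi_pos.le, pow_zero, one_mul]
      refine div_le_self (norm_nonneg _) ?_
      have hD1 : 1 ≤ ‖D k‖ := by
        by_cases hb : k b = 0
        · have ha : k a ≠ 0 := by
            intro ha; apply h; simp [D, ha, hb]
          have := Complex.abs_im_le_norm (D k)
          rw [hDim, abs_neg] at this
          refine le_trans ?_ this
          exact_mod_cast Int.one_le_abs ha
        · have := Complex.abs_re_le_norm (D k)
          rw [hDre] at this
          refine le_trans ?_ this
          exact_mod_cast Int.one_le_abs hb
      have hpi3 := Real.pi_gt_three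
      nlinarith
  let xa : (d → ℝ) →L[ℝ] ℂ := Complex.ofRealCLM.comp (ContinuousLinearMap.proj a)
  let xb : (d → ℝ) →L[ℝ] ℂ := Complex.ofRealCLM.comp (ContinuousLinearMap.proj b)
  -- `g - β` is the image of `f` under `∂_b - i ∂_a`, and the part `β` is produced by the linear term
  let w : (d → ℝ) → ℂ := fun x => xa x + (Complex.I + fourierSum β x) * xb x + fourierSum f x
  have hβs := contDiff_fourierSum hβ
  have hfs := contDiff_fourierSum hf
  have hw : ContDiff ℝ ∞ w :=
    (xa.contDiff.add ((contDiff_const.add hβs).mul xb.contDiff)).add hfs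
  have hder : ∀ x j, partialDeriv j w x = xa (Pi.single j 1)
      + ((Complex.I + fourierSum β x) * xb (Pi.single j 1)
        + xb x * fourierSum (fun k => 2 * Real.pi * Complex.I * (k j : ℂ) * β k) x)
      + fourierSum (fun k => 2 * Real.pi * Complex.I * (k j : ℂ) * f k) x := by
    intro x j
    have h1 : HasFDerivAt (fourierSum β) (fderiv ℝ (fourierSum β) x) x :=
      (hβs.differentiable (by simp) x).hasFDerivAt
    have h2 : HasFDerivAt (fourierSum f) (fderiv ℝ (fourierSum f) x) x :=
      (hfs.differentiable (by simp) x).hasFDerivAt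
    have h3 := (xa.hasFDerivAt.add ((h1.const_add Complex.I).mul xb.hasFDerivAt)).add h2
    have h4 : fderiv ℝ w x = _ := h3.fderiv
    rw [partialDeriv, h4, ← fderiv_fourierSum_single hβ, ← fderiv_fourierSum_single hf]
    rfl
  have hβ0 : ∀ x (j : d), (∀ k : d → ℤ, D k = 0 → k j = 0) →
      fourierSum (fun k => 2 * Real.pi * Complex.I * (k j : ℂ) * β k) x = 0 := by
    intro x j hj
    unfold fourierSum
    refine (tsum_congr fun k => ?_).trans tsum_zero
    by_cases h : D k = 0
    · simp [hj k h]
    · simp [β, h]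
  have ha : ∀ x, partialDeriv a w x = 1 + fourierSum (fun k => S k * g k) x := by
    intro x
    rw [hder, hβ0 x a fun k hk => (hD0 k hk).1]
    have e1 : xa (Pi.single a 1) = 1 := by simp [xa]
    have e2 : xb (Pi.single a 1) = 0 := by simp [xb, Pi.single_eq_of_ne hab.symm]
    rw [e1, e2]
    simp only [mul_zero, add_zero]
    congr 2; ext k
    by_cases h : D k = 0
    · simp [S, f, h]
    · simp only [S, f]
      field_simp
  have hb : ∀ x, partialDeriv b w x
      = Complex.I + fourierSum β x
        + fourierSum (fun k => 2 * Real.pi * Complex.I * (k b : ℂ) * f k) x := by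
    intro x
    rw [hder, hβ0 x b fun k hk => (hD0 k hk).2]
    have e1 : xa (Pi.single b 1) = 0 := by simp [xa, Pi.single_eq_of_ne hab]
    have e2 : xb (Pi.single b 1) = 1 := by simp [xb]
    rw [e1, e2]
    simp
  have hSg : Summable fun k => ‖S k * g k‖ := by
    refine hg.summable_norm.of_nonneg_of_le (fun _ => norm_nonneg _) fun k => ?_
    rw [norm_mul]
    exact mul_le_of_le_one_left (norm_nonneg _) (hS k)
  refine ⟨w, hw, fun x => ⟨?_, ?_⟩⟩
  · have hgx : fourierSum g x = δ x * (1 + fourierSum (fun k => S k * g k) x) := by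
      have hδs := (hP.rapidDecay_periodCoeff hδ).summable_norm
      have hc := fourierSum_conv hδs hSg x
      have : fourierSum g x = fourierSum (periodCoeff δ) x
          + fourierSum (conv (periodCoeff δ) fun k => S k * g k) x := by
        unfold fourierSum
        rw [← (summable_fourierSum hδs x).tsum_add hc.1]
        refine tsum_congr fun k => ?_
        rw [hfix k]
        ring
      rw [this, hc.2, hP.fourierSum_periodCoeff hδ]
      ring
    have hsplit : fourierSum g x + Complex.I * fourierSum (fun k => S k * g k) x
        = fourierSum β x + fourierSum (fun k => 2 * Real.pi * Complex.I * (k b : ℂ) * f k) x := by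
      unfold fourierSum
      rw [← tsum_mul_left, ← (summable_fourierSum hβ.summable_norm x).tsum_add
        (summable_fourierSum (hf.derivCoeff b).summable_norm x),
        ← (summable_fourierSum hg.summable_norm x).tsum_add
          ((summable_fourierSum hSg x).mul_left _)]
      refine tsum_congr fun k => ?_
      by_cases h : D k = 0
      · simp [β, S, f, h]
      · simp only [β, S, f, h, if_false]
        have hk : (k b : ℂ) = D k + Complex.I * (k a : ℂ) := by simp [D]
        rw [hk]
        field_simp
        ring
    rw [hb, ha]
    rw [add_assoc, ← hsplit, hgx]
    ring
  · rw [ha, Complex.add_re, Complex.one_re]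
    have h1 : ‖fourierSum (fun k => S k * g k) x‖ < 1 := by
      refine lt_of_le_of_lt ?_ hg1
      unfold fourierSum
      refine (norm_tsum_le_tsum_norm ?_).trans ?_
      · simpa only [norm_mul, norm_character, mul_one] using hSg
      · simp only [norm_mul, norm_character, mul_one]
        simp only [norm_mul] at hSg
        exact Summable.tsum_le_tsum (fun k => mul_le_of_le_one_left (norm_nonneg _) (hS k)) hSg
          hg.summable_norm
    have h2 := neg_abs_le (fourierSum (fun k => S k * g k) x).re
    have h3 := Complex.abs_re_le_norm (fourierSum (fun k => S k * g k) x)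
    linarith

/-- A smooth `1`-periodic function that is the identity near `0`, namely a smooth cut-off of `arcsin`
composed with a sine. -/
theorem exists_periodic_coordinate :
    ∃ ψ : ℝ → ℝ, ContDiff ℝ ∞ ψ ∧ (∀ (t : ℝ) (n : ℤ), ψ (t + n) = ψ t) ∧ ∀ᶠ t in 𝓝 0, ψ t = t := by
  have h : ∀ᶠ s in 𝓝 (0 : ℝ), ContDiffAt ℝ ∞ Real.arcsin s := by
    filter_upwards [Ioo_mem_nhds (by norm_num : (-1 : ℝ) < 0) zero_lt_one] with s hs
    exact Real.contDiffAt_arcsin hs.1.ne' hs.2.ne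
  obtain ⟨φ, hφ, -, hφe⟩ := exists_contDiff_hasCompactSupport_eventuallyEq h
  refine ⟨fun t => φ (Real.sin (2 * Real.pi * t)) / (2 * Real.pi), ?_, ?_, ?_⟩
  · exact (hφ.comp (Real.contDiff_sin.comp (contDiff_const.mul contDiff_id))).div_const _
  · intro t n
    have : 2 * Real.pi * (t + n) = 2 * Real.pi * t + n * (2 * Real.pi) := by ring
    simp only [this, Real.sin_add_int_mul_two_pi]
  · have hc : Tendsto (fun t : ℝ => Real.sin (2 * Real.pi * t)) (𝓝 0) (𝓝 0) := by
      have : Continuous fun t : ℝ => Real.sin (2 * Real.pi * t) := by fun_prop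
      simpa using this.tendsto 0
    filter_upwards [hc.eventually hφe, Ioo_mem_nhds (by norm_num : (-(1 / 4) : ℝ) < 0)
      (by norm_num : (0 : ℝ) < 1 / 4)] with t ht ht'
    have hpi := Real.pi_pos
    rw [ht, Real.arcsin_sin (by nlinarith [ht'.1]) (by nlinarith [ht'.2])]
    field_simp

/-- If `G` is smooth, periodic in the second variable, and vanishes for `ε = 0`, then the Fourier
coefficients of `G (ε, ·)` are small in `ℓ¹` for small `ε`. -/
theorem eventually_tsum_norm_periodCoeff_lt [Nonempty d] {G : ℝ × (d → ℝ) → ℂ}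
    (hG : ContDiff ℝ ∞ G) (hP : ∀ ε, IsPeriodic fun t => G (ε, t)) (h0 : ∀ t, G (0, t) = 0)
    {η : ℝ} (hη : 0 < η) : ∀ᶠ ε in 𝓝 (0 : ℝ), ∑' k, ‖periodCoeff (fun t => G (ε, t)) k‖ < η := by
  have hslice : ∀ {G : ℝ × (d → ℝ) → ℂ}, ContDiff ℝ ∞ G → ∀ ε, ContDiff ℝ ∞ fun t => G (ε, t) :=
    fun hG ε => hG.comp (contDiff_const.prodMk contDiff_id)
  -- the derivatives of the slices depend continuously on `ε`
  have hiter : ∀ (j : d) (M : ℕ), ∃ H : ℝ × (d → ℝ) → ℂ, ContDiff ℝ ∞ H ∧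
      ∀ ε, (partialDeriv j)^[M] (fun t => G (ε, t)) = fun t => H (ε, t) := by
    intro j M
    induction M with
    | zero => exact ⟨G, hG, fun ε => rfl⟩
    | succ M ih =>
      obtain ⟨H, hH, hHe⟩ := ih
      refine ⟨fun p => fderiv ℝ H p (0, Pi.single j 1),
        (hH.fderiv_right (m := ∞) (by simp)).clm_apply contDiff_const, fun ε => ?_⟩
      rw [Function.iterate_succ_apply', hHe ε]
      ext t
      have h1 : HasFDerivAt H (fderiv ℝ H (ε, t)) (ε, t) :=
        (hH.differentiable (by simp) _).hasFDerivAt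
      have h2 : HasFDerivAt (fun t : d → ℝ => (ε, t))
          (ContinuousLinearMap.inr ℝ ℝ (d → ℝ)) t := hasFDerivAt_prodMk_right ε t
      have h3 := (h1.comp t h2).fderiv
      change fderiv ℝ (H ∘ fun t => (ε, t)) t _ = _
      rw [h3]
      rfl
  have hzero : ∀ (j : d) (M : ℕ), (partialDeriv j)^[M] (fun _ : d → ℝ => (0 : ℂ)) = fun _ => 0 := by
    intro j M
    induction M with
    | zero => rfl
    | succ M ih => rw [Function.iterate_succ_apply', ih]; ext x; simp [partialDeriv]
  have hsup : ∀ (j : d) (M : ℕ) {B : ℝ}, 0 < B →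
      ∀ᶠ ε in 𝓝 (0 : ℝ), ∀ t, ‖(partialDeriv j)^[M] (fun t => G (ε, t)) t‖ ≤ B := by
    intro j M B hB
    obtain ⟨H, hH, hHe⟩ := hiter j M
    have hH0 : ∀ t, H (0, t) = 0 := by
      intro t
      have h1 := hHe 0
      simp only [h0] at h1
      rw [hzero] at h1
      exact (congrFun h1 t).symm
    have hK : IsCompact (Icc (0 : d → ℝ) 1) := isCompact_Icc
    have h1 : ∀ᶠ ε in 𝓝 (0 : ℝ), ∀ t ∈ Icc (0 : d → ℝ) 1, ‖H (ε, t)‖ < B := by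
      apply hK.eventually_forall_of_forall_eventually
      intro t _
      have := hH.continuous.norm.tendsto ((0 : ℝ), t)
      rw [hH0, norm_zero] at this
      exact this.eventually (gt_mem_nhds hB)
    filter_upwards [h1] with ε hε t
    have hper := (iterate_partialDeriv (hslice hG ε) (hP ε) j M).2.1 t fun i => -⌊t i⌋
    rw [← hper, hHe]
    refine (hε _ ⟨fun i => ?_, fun i => ?_⟩).le
    · have := Int.floor_le (t i)
      push_cast
      simp only [Pi.zero_apply]
      linarith
    · have := Int.lt_floor_add_one (t i)
      push_cast
      simp only [Pi.one_apply]
      linarith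
  set C : ℝ := (1 + Fintype.card d : ℝ) ^ (Fintype.card d + 1) *
      ∑' k : d → ℤ, ((1 + freqSize k) ^ (Fintype.card d + 1))⁻¹ with hC
  have hC0 : 0 ≤ C := by
    refine mul_nonneg (by positivity) (tsum_nonneg fun k => ?_)
    have := freqSize_nonneg k
    positivity
  have hB : 0 < η / (C + 1) := by positivity
  obtain ⟨j₀⟩ := ‹Nonempty d›
  have hall : ∀ᶠ ε in 𝓝 (0 : ℝ), ∀ j : d, ∀ t,
      ‖(partialDeriv j)^[Fintype.card d + 1] (fun t => G (ε, t)) t‖ ≤ η / (C + 1) :=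
    eventually_all.2 fun j => hsup j _ hB
  filter_upwards [hsup j₀ 0 hB, hall] with ε h1 h2
  refine (tsum_norm_periodCoeff_le (hslice hG ε) (hP ε) h1 h2).trans_lt ?_
  rw [← hC, mul_div_assoc', div_lt_iff₀ (by positivity)]
  nlinarith

/-- Local solvability of the Beltrami equation `∂_b w = ν ∂_a w`, in the normalization `ν 0 = i`.
The remaining coordinates are parameters on which the solution depends smoothly. -/
theorem exists_local_beltrami_solution [Nonempty d] {a b : d} (hab : a ≠ b) {ν : (d → ℝ) → ℂ}
    (hν : ∀ᶠ y in 𝓝 0, ContDiffAt ℝ ∞ ν y) (h0 : ν 0 = Complex.I) :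
    ∃ w : (d → ℝ) → ℂ, ContDiff ℝ ∞ w ∧ (∀ y, 0 < (partialDeriv a w y).re) ∧
      ∀ᶠ y in 𝓝 0, partialDeriv b w y = ν y * partialDeriv a w y := by
  obtain ⟨δ, hδ, -, hδe⟩ := exists_contDiff_hasCompactSupport_eventuallyEq
    (f := fun y => ν y - Complex.I) (hν.mono fun y hy => hy.sub contDiffAt_const)
  obtain ⟨ψ, hψ, hψP, hψe⟩ := exists_periodic_coordinate
  -- `t ↦ δ (ε Ψ t)` is periodic, agrees with the rescaled `δ` near `0`, and is small for small `ε`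
  let Ψ : (d → ℝ) → (d → ℝ) := fun t j => ψ (t j)
  have hΨ : ContDiff ℝ ∞ Ψ := contDiff_pi.2 fun j => hψ.comp (contDiff_apply ℝ ℝ j)
  have hΨe : ∀ᶠ t in 𝓝 (0 : d → ℝ), Ψ t = t := by
    have : ∀ᶠ t in 𝓝 (0 : d → ℝ), ∀ j, ψ (t j) = t j :=
      eventually_all.2 fun j => ((continuous_apply j).tendsto (0 : d → ℝ)).eventually hψe
    filter_upwards [this] with t ht
    ext j; exact ht j
  have hG : ContDiff ℝ ∞ fun p : ℝ × (d → ℝ) => δ (p.1 • Ψ p.2) :=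
    hδ.comp (contDiff_fst.smul (hΨ.comp contDiff_snd))
  have hP : ∀ ε : ℝ, IsPeriodic fun t => δ (ε • Ψ t) := by
    intro ε x n
    have : Ψ (fun j => x j + n j) = Ψ x := by ext j; exact hψP _ _
    simp only [this]
  have hδ0 : δ 0 = 0 := by rw [hδe.self_of_nhds]; simp [h0]
  obtain ⟨ε, hsmall, hε⟩ := (((eventually_tsum_norm_periodCoeff_lt hG hP (by simp [hδ0])
    (by norm_num : (0 : ℝ) < 1 / 2)).filter_mono nhdsWithin_le_nhds).and
      (self_mem_nhdsWithin (s := Ioi (0 : ℝ)))).exists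
  have hε0 : 0 < ε := hε
  obtain ⟨w, hw, hwe⟩ := exists_periodic_beltrami_solution (δ := fun t => δ (ε • Ψ t)) hab
    (hδ.comp (hΨ.const_smul ε)) (hP ε) hsmall
  have hscale : ∀ y (j : d), partialDeriv j (fun y => w (ε⁻¹ • y)) y
      = (ε⁻¹ : ℝ) • partialDeriv j w (ε⁻¹ • y) := by
    intro y j
    rw [partialDeriv, fderiv_comp_smul]
    rfl
  refine ⟨fun y => w (ε⁻¹ • y), hw.comp (contDiff_const_smul _), fun y => ?_, ?_⟩
  · rw [hscale, Complex.real_smul, Complex.re_ofReal_mul]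
    exact mul_pos (inv_pos.2 hε0) (hwe _).2
  · have hc : Tendsto (fun y : d → ℝ => ε⁻¹ • y) (𝓝 0) (𝓝 0) := by
      have : Continuous fun y : d → ℝ => ε⁻¹ • y := by fun_prop
      simpa using this.tendsto 0
    filter_upwards [hc.eventually hΨe, hδe] with y h1 h2
    rw [hscale, hscale, (hwe _).1, h1, smul_smul, mul_inv_cancel₀ hε0.ne', one_smul, h2]
    simp only [Complex.real_smul]
    ring

end Beltrami

/-- The local solvability of the Beltrami equation in the model space, with `y⁰` and `y¹` as
parameters. -/
theorem exists_beltrami_solution {ν : R4 → ℂ} (hν : ∀ᶠ y in 𝓝 0, ContDiffAt ℝ ∞ ν y)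
    (h0 : ν 0 = Complex.I) :
    ∃ w : R4 → ℂ, ContDiff ℝ ∞ w ∧ (∀ y, 0 < (fderiv ℝ w y (basisVec 2)).re) ∧
      ∀ᶠ y in 𝓝 0, fderiv ℝ w y (basisVec 3) = ν y * fderiv ℝ w y (basisVec 2) := by
  let e : R4 ≃L[ℝ] (Fin 4 → ℝ) := EuclideanSpace.equiv (Fin 4) ℝ
  have he : ∀ j, e (basisVec j) = Pi.single j 1 := fun j => by
    ext i; simp [e, basisVec, Pi.single_apply]
  have hs : Tendsto e.symm (𝓝 0) (𝓝 0) := by simpa using e.symm.continuous.tendsto 0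
  have ht : Tendsto e (𝓝 0) (𝓝 0) := by simpa using e.continuous.tendsto 0
  obtain ⟨w, hw, hw1, hw2⟩ := exists_local_beltrami_solution (a := (2 : Fin 4)) (b := 3)
    (by decide) (ν := fun y => ν (e.symm y))
    ((hs.eventually hν).mono fun y hy => hy.comp y e.symm.contDiff.contDiffAt) (by simpa using h0)
  have hd : ∀ y j, fderiv ℝ (fun y => w (e y)) y (basisVec j) = partialDeriv j w (e y) := by
    intro y j
    have h1 : HasFDerivAt w (fderiv ℝ w (e y)) (e y) :=
      (hw.differentiable (by simp) _).hasFDerivAt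
    have h2 := h1.comp y e.hasFDerivAt
    have h3 : fderiv ℝ (fun y => w (e y)) y = _ := h2.fderiv
    rw [h3, partialDeriv, ← he]
    rfl
  refine ⟨fun y => w (e y), hw.comp e.contDiff, fun y => ?_, ?_⟩
  · rw [hd]; exact hw1 _
  · filter_upwards [ht.eventually hw2] with y hy
    rw [hd, hd, hy]
    simp

/-! ### One-forms and coordinates on the model space -/

section Pullback

variable {F : Type*} [NormedAddCommGroup F] [NormedSpace ℝ F]

/-- The exterior derivative of a one-form on the model space, with the convention
`dα(X, Y) = X α(Y) - Y α(X)` for constant vector fields. -/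
noncomputable def extD (α : R4 → R4 →L[ℝ] F) (x X Y : R4) : F :=
  fderiv ℝ α x X Y - fderiv ℝ α x Y X

/-- The pull-back of a one-form along a map of the model space. -/
noncomputable def pullback (f : R4 → R4) (α : R4 → R4 →L[ℝ] F) (y : R4) : R4 →L[ℝ] F :=
  (α (f y)).comp (fderiv ℝ f y)

theorem pullback_apply (f : R4 → R4) (α : R4 → R4 →L[ℝ] F) (y X : R4) :
    pullback f α y X = α (f y) (fderiv ℝ f y X) := rfl

theorem contDiffAt_pullback {f : R4 → R4} {α : R4 → R4 →L[ℝ] F} {y : R4}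
    (hf : ContDiffAt ℝ ∞ f y) (hα : ContDiffAt ℝ ∞ α (f y)) : ContDiffAt ℝ ∞ (pullback f α) y :=
  (hα.comp y hf).clm_comp (hf.fderiv_right (m := ∞) (by simp))

/-- The exterior derivative commutes with pull-backs. -/
theorem extD_pullback {f : R4 → R4} {α : R4 → R4 →L[ℝ] F} {y : R4}
    (hf : ContDiffAt ℝ ∞ f y) (hα : ContDiffAt ℝ ∞ α (f y)) (X Y : R4) :
    extD (pullback f α) y X Y = extD α (f y) (fderiv ℝ f y X) (fderiv ℝ f y Y) := by
  have h1 : HasFDerivAt α (fderiv ℝ α (f y)) (f y) := (hα.differentiableAt (by simp)).hasFDerivAt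
  have h2 : HasFDerivAt f (fderiv ℝ f y) y := (hf.differentiableAt (by simp)).hasFDerivAt
  have h3 : HasFDerivAt (fderiv ℝ f) (fderiv ℝ (fderiv ℝ f) y) y :=
    ((hf.fderiv_right (m := ∞) (by simp)).differentiableAt (by simp)).hasFDerivAt
  have h4 := ((h1.comp y h2).clm_comp h3).fderiv
  have h5 : fderiv ℝ (fderiv ℝ f) y X Y = fderiv ℝ (fderiv ℝ f) y Y X :=
    (hf.isSymmSndFDerivAt (by
    simp only [minSmoothness_of_isRCLikeNormedField]
    exact WithTop.coe_le_coe.2 le_top)).eq X Y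
  have h6 : fderiv ℝ (pullback f α) y = _ := h4
  simp only [extD, h6]
  simp [h5]

theorem pullback_comp {f g : R4 → R4} (α : R4 → R4 →L[ℝ] F) {y : R4}
    (hg : DifferentiableAt ℝ g y) (hf : DifferentiableAt ℝ f (g y)) :
    pullback (f ∘ g) α y = pullback g (pullback f α) y := by
  simp only [pullback, fderiv_comp y hf hg, Function.comp]
  rfl

/-- The derivative of a component of a one-form. -/
theorem fderiv_component {α : R4 → R4 →L[ℝ] F} {x : R4} (hα : ContDiffAt ℝ ∞ α x) (X Y : R4) :
    fderiv ℝ (fun y => α y Y) x X = fderiv ℝ α x X Y := by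
  have h := (hα.differentiableAt (by simp)).hasFDerivAt
  rw [(h.clm_apply (hasFDerivAt_const Y x)).fderiv]
  simp

end Pullback

/-- The pointwise conditions on a null coframe on which the normal form rests: the kernel of `ℓ` is
integrable, and along the common kernel of `ℓ` and `m` the form `m` only rotates modulo `ℓ`. These
conditions are invariant under diffeomorphisms. -/
structure IsAdmissible (n ℓ : R4 → R4 →L[ℝ] ℝ) (m : R4 → R4 →L[ℝ] ℂ) (x : R4) : Prop where
  smooth_n : ContDiffAt ℝ ∞ n x
  smooth_ℓ : ContDiffAt ℝ ∞ ℓ x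
  smooth_m : ContDiffAt ℝ ∞ m x
  nondegenerate : ∀ X, ℓ x X = 0 → n x X = 0 → m x X = 0 → X = 0
  integrable : ∀ X Y, ℓ x X = 0 → ℓ x Y = 0 → extD ℓ x X Y = 0
  rotation : ∀ X, ℓ x X = 0 → m x X = 0 → ∃ ψ : ℝ, ∀ Y, ℓ x Y = 0 →
    extD m x X Y = Complex.I * ψ * m x Y

theorem IsAdmissible.pullback {n ℓ : R4 → R4 →L[ℝ] ℝ} {m : R4 → R4 →L[ℝ] ℂ} {f : R4 → R4} {y : R4}
    (h : IsAdmissible n ℓ m (f y)) (hf : ContDiffAt ℝ ∞ f y)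
    (hinj : Function.Injective (fderiv ℝ f y)) :
    IsAdmissible (pullback f n) (pullback f ℓ) (pullback f m) y where
  smooth_n := contDiffAt_pullback hf h.smooth_n
  smooth_ℓ := contDiffAt_pullback hf h.smooth_ℓ
  smooth_m := contDiffAt_pullback hf h.smooth_m
  nondegenerate X h1 h2 h3 := by
    apply hinj
    rw [map_zero]
    exact h.nondegenerate _ h1 h2 h3
  integrable X Y hX hY := by
    rw [extD_pullback hf h.smooth_ℓ]
    exact h.integrable _ _ hX hY
  rotation X h1 h2 := by
    obtain ⟨ψ, hψ⟩ := h.rotation _ h1 h2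
    refine ⟨ψ, fun Y hY => ?_⟩
    rw [extD_pullback hf h.smooth_m]
    exact hψ _ hY

/-- The vector fields of the frame dual to `(ℓ, n, Re m, Im m)`, and their constant linear
combinations. -/
theorem exists_dual_vectorField {n ℓ : R4 → R4 →L[ℝ] ℝ} {m : R4 → R4 →L[ℝ] ℂ} {x₀ : R4}
    (h : ∀ᶠ x in 𝓝 x₀, IsAdmissible n ℓ m x) (a b : ℝ) (c : ℂ) :
    ∃ X : R4 → R4, ∀ᶠ x in 𝓝 x₀, ContDiffAt ℝ ∞ X x ∧
      ℓ x (X x) = a ∧ n x (X x) = b ∧ m x (X x) = c := by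
  let T : R4 → R4 →L[ℝ] ℝ × ℝ × ℂ := fun x => (ContinuousLinearMap.inl ℝ ℝ (ℝ × ℂ)).comp (ℓ x) +
    (ContinuousLinearMap.inr ℝ ℝ (ℝ × ℂ)).comp ((ContinuousLinearMap.inl ℝ ℝ ℂ).comp (n x) +
      (ContinuousLinearMap.inr ℝ ℝ ℂ).comp (m x))
  refine ⟨fun x => (T x).inverse (a, b, c), h.mono fun x hx => ?_⟩
  have hT : ContDiffAt ℝ ∞ T x :=
    (contDiffAt_const.clm_comp hx.smooth_ℓ).add (contDiffAt_const.clm_comp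
      ((contDiffAt_const.clm_comp hx.smooth_n).add (contDiffAt_const.clm_comp hx.smooth_m)))
  have hTX : ∀ X, T x X = (ℓ x X, n x X, m x X) := fun X => by simp [T]
  have hinj : Function.Injective (T x) := by
    rw [injective_iff_map_eq_zero]
    intro X hX
    simp only [hTX, Prod.mk_eq_zero] at hX
    exact hx.nondegenerate X hX.1 hX.2.1 hX.2.2
  have hdim : Module.finrank ℝ R4 = Module.finrank ℝ (ℝ × ℝ × ℂ) := by
    simp [Module.finrank_prod]
  let e : R4 ≃L[ℝ] ℝ × ℝ × ℂ :=
    (LinearEquiv.ofInjectiveOfFinrankEq (T x : R4 →ₗ[ℝ] ℝ × ℝ × ℂ) hinj hdim).toContinuousLinearEquiv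
  have he : (e : R4 →L[ℝ] ℝ × ℝ × ℂ) = T x := by ext1 v; rfl
  refine ⟨?_, ?_⟩
  · have h2 : ContDiffAt ℝ ∞ ContinuousLinearMap.inverse (T x) := by
      rw [← he]; exact contDiffAt_map_inverse e
    exact (h2.comp x hT).clm_apply contDiffAt_const
  · have h3 : T x ((T x).inverse (a, b, c)) = (a, b, c) := by
      rw [← he, ContinuousLinearMap.inverse_equiv]
      exact e.apply_symm_apply _
    simp only [hTX, Prod.mk.injEq] at h3
    exact h3

section Coordinates

theorem basisVec_apply (μ ν : Fin 4) : (basisVec μ) ν = if ν = μ then 1 else 0 := by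
  simp [basisVec]

theorem eq_sum_basisVec (y : R4) : y = ∑ μ, y μ • basisVec μ := by
  ext ν
  simp [basisVec_apply]

theorem apply_eq_sum {F : Type*} [NormedAddCommGroup F] [NormedSpace ℝ F] (L : R4 →L[ℝ] F)
    (y : R4) : L y = ∑ μ, y μ • L (basisVec μ) := by
  conv_lhs => rw [eq_sum_basisVec y]
  simp

theorem norm_le_of_abs_le {x y : R4} (h : ∀ i, |x i| ≤ |y i|) : ‖x‖ ≤ ‖y‖ := by
  rw [EuclideanSpace.norm_eq, EuclideanSpace.norm_eq]
  apply Real.sqrt_le_sqrt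
  refine Finset.sum_le_sum fun i _ => ?_
  simp only [Real.norm_eq_abs]
  exact pow_le_pow_left₀ (abs_nonneg _) (h i) 2

/-- Shrinking one coordinate does not leave a ball around the origin. -/
theorem shrink_mem_ball {y : R4} {r : ℝ} (hy : y ∈ Metric.ball (0 : R4) r) (j : Fin 4) {t : ℝ}
    (ht : t ∈ Icc (0 : ℝ) 1) :
    (y - y j • basisVec j) + t • (y j • basisVec j) ∈ Metric.ball (0 : R4) r := by
  rw [mem_ball_zero_iff] at hy ⊢
  refine lt_of_le_of_lt (norm_le_of_abs_le fun i => ?_) hy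
  by_cases hi : i = j
  · subst hi
    simp [basisVec_apply, abs_mul, abs_of_nonneg ht.1]
    exact mul_le_of_le_one_left (abs_nonneg _) ht.2
  · simp [basisVec_apply, hi]

theorem flatten_mem_ball {y : R4} {r : ℝ} (hy : y ∈ Metric.ball (0 : R4) r) (j : Fin 4) :
    y - y j • basisVec j ∈ Metric.ball (0 : R4) r := by
  simpa using shrink_mem_ball hy j (left_mem_Icc.2 zero_le_one)

/-- A function that satisfies a homogeneous linear differential inequality along a segment, and
vanishes at its start, vanishes at its end. -/
theorem eq_zero_of_norm_fderiv_le {F : Type*} [NormedAddCommGroup F] [NormedSpace ℝ F]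
    {f : R4 → F} {y v : R4} {K : ℝ} (hd : ∀ t ∈ Icc (0 : ℝ) 1, DifferentiableAt ℝ f (y + t • v))
    (hK : ∀ t ∈ Icc (0 : ℝ) 1, ‖fderiv ℝ f (y + t • v) v‖ ≤ K * ‖f (y + t • v)‖)
    (h0 : f y = 0) : f (y + v) = 0 := by
  have hder : ∀ t ∈ Icc (0 : ℝ) 1,
      HasDerivAt (fun t : ℝ => f (y + t • v)) (fderiv ℝ f (y + t • v) v) t := by
    intro t ht
    have h1 : HasDerivAt (fun t : ℝ => y + t • v) v t := by
      simpa using ((hasDerivAt_id t).smul_const v).const_add y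
    exact (hd t ht).hasFDerivAt.comp_hasDerivAt t h1
  have := eq_zero_of_abs_deriv_le_mul_abs_self_of_eq_zero_right (a := 0) (b := 1)
    (fun t ht => (hder t ht).continuousAt.continuousWithinAt)
    (fun t ht => (hder t (Ico_subset_Icc_self ht)).hasDerivWithinAt) (by simpa using h0)
    (fun t ht => hK t (Ico_subset_Icc_self ht)) 1 (right_mem_Icc.2 zero_le_one)
  simpa using this

theorem hasDerivAt_coordLine {F : Type*} [NormedAddCommGroup F] [NormedSpace ℝ F]
    {f : R4 → F} {y : R4} (hf : ContDiffAt ℝ ∞ f y) (j : Fin 4) :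
    HasDerivAt (fun s : ℝ => f (y + s • basisVec j)) (fderiv ℝ f y (basisVec j)) 0 := by
  have h1 : HasDerivAt (fun s : ℝ => y + s • basisVec j) (basisVec j) 0 := by
    simpa using ((hasDerivAt_id (0 : ℝ)).smul_const (basisVec j)).const_add y
  have h2 : HasFDerivAt f (fderiv ℝ f y) (y + (0 : ℝ) • basisVec j) := by
    simpa using (hf.differentiableAt (by simp)).hasFDerivAt
  exact h2.comp_hasDerivAt 0 h1

theorem tendsto_coordLine (y : R4) (j : Fin 4) :
    Tendsto (fun s : ℝ => y + s • basisVec j) (𝓝 0) (𝓝 y) := by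
  have : Continuous fun s : ℝ => y + s • basisVec j := by fun_prop
  simpa using this.tendsto 0

/-- If a map `Q` does not depend on the coordinate `y^j`, the flow of `X` for the time `y^j` starting
at `Q y` is a map for which `∂_j` corresponds to `X`, and which agrees with `Q` on `y^j = 0`. -/
theorem exists_flow_step {X : R4 → R4} {x₀ : R4} (hX : ∀ᶠ x in 𝓝 x₀, ContDiffAt ℝ ∞ X x)
    {Q : R4 → R4} (hQ : ∀ᶠ y in 𝓝 0, ContDiffAt ℝ ∞ Q y) (hQ0 : Q 0 = x₀) (j : Fin 4)
    (hj : ∀ y (s : ℝ), Q (y + s • basisVec j) = Q y) :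
    ∃ Ψ : R4 → R4, Ψ 0 = x₀ ∧
      (∀ i, i ≠ j → (∀ y (s : ℝ), Q (y + s • basisVec i) = Q y) →
        ∀ y (s : ℝ), Ψ (y + s • basisVec i) = Ψ y) ∧
      ∀ᶠ y in 𝓝 0, ContDiffAt ℝ ∞ Ψ y ∧ fderiv ℝ Ψ y (basisVec j) = X (Ψ y) ∧
        (y j = 0 → Ψ y = Q y ∧ ∀ i, i ≠ j → fderiv ℝ Ψ y (basisVec i) = fderiv ℝ Q y (basisVec i)) := by
  obtain ⟨Φ, h1, h2, h3⟩ := exists_smooth_flow hX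
  have hcoord : ContDiff ℝ ∞ fun y : R4 => y j := by fun_prop
  have hQc : Tendsto Q (𝓝 0) (𝓝 x₀) := by
    rw [← hQ0]; exact hQ.self_of_nhds.continuousAt
  have hc : Tendsto (fun y : R4 => (y j, Q y)) (𝓝 0) (𝓝 ((0 : ℝ), x₀)) := by
    have := (hcoord.continuous.tendsto 0).prodMk_nhds hQc
    simpa using this
  refine ⟨fun y => Φ (y j, Q y), ?_, ?_, ?_⟩
  · simp only [PiLp.zero_apply, hQ0]; exact h3.self_of_nhds
  · intro i hi hQi y s
    simp [hQi, basisVec_apply, hi.symm]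
  · have hid : ∀ᶠ y in 𝓝 (0 : R4), ∀ᶠ y' in 𝓝 y, Φ (0, Q y') = Q y' :=
      (hQc.eventually h3).eventually_nhds
    filter_upwards [hQ, hc.eventually h1, hc.eventually h2, hid] with y hQy hΦ hder hidy
    have hsm : ContDiffAt ℝ ∞ (fun y => Φ (y j, Q y)) y :=
      ContDiffAt.comp (f := fun y : R4 => (y j, Q y)) y hΦ (hcoord.contDiffAt.prodMk hQy)
    refine ⟨hsm, ?_, fun hyj => ⟨?_, fun i hi => ?_⟩⟩
    · have h4 := hasDerivAt_coordLine hsm j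
      have h5 : HasDerivAt (fun s : ℝ => Φ (y j + s, Q y)) (X (Φ (y j, Q y))) 0 := by
        have h6 : HasDerivAt (fun s => Φ (s, Q y)) (X (Φ (y j, Q y))) (y j + 0) := by
          simpa using hder
        exact h6.comp_const_add (y j) 0
      refine h4.unique (h5.congr_of_eventuallyEq (Eventually.of_forall fun s => ?_))
      simp [hj, basisVec_apply]
    · rw [hyj]; exact hidy.self_of_nhds
    · have h4 := hasDerivAt_coordLine hsm i
      have h5 := hasDerivAt_coordLine hQy i
      refine h4.unique (h5.congr_of_eventuallyEq ?_)
      filter_upwards [(tendsto_coordLine y i).eventually hidy] with s hs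
      simpa [basisVec_apply, hi.symm, hyj] using hs

end Coordinates

/-! ### Coordinates adapted to the null congruence -/

section FlowCoordinates

theorem continuousAt_extD {F : Type*} [NormedAddCommGroup F] [NormedSpace ℝ F]
    {α : R4 → R4 →L[ℝ] F} {x : R4} (hα : ContDiffAt ℝ ∞ α x) (X Y : R4) :
    ContinuousAt (fun y => extD α y X Y) x := by
  have h : ContinuousAt (fderiv ℝ α) x := (hα.fderiv_right (m := 0) (by simp)).continuousAt
  exact ((h.clm_apply continuousAt_const).clm_apply continuousAt_const).sub
    ((h.clm_apply continuousAt_const).clm_apply continuousAt_const)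

/-- Where `ℓ_j = 0` and `∂_i ℓ_j = 0`, integrability gives a homogeneous linear equation for the
`∂_j`-derivative of `ℓ_i`. -/
theorem IsAdmissible.norm_fderiv_component_le {n ℓ : R4 → R4 →L[ℝ] ℝ} {m : R4 → R4 →L[ℝ] ℂ} {y : R4}
    (h : IsAdmissible n ℓ m y) {i j : Fin 4} {K : ℝ} (h0 : ℓ y (basisVec 0) ≠ 0)
    (hK : |extD ℓ y (basisVec j) (basisVec 0)| ≤ K * |ℓ y (basisVec 0)|)
    (hj : ℓ y (basisVec j) = 0) (hij : fderiv ℝ ℓ y (basisVec i) (basisVec j) = 0) :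
    ‖fderiv ℝ (fun y => ℓ y (basisVec i)) y (basisVec j)‖ ≤ K * ‖ℓ y (basisVec i)‖ := by
  rw [fderiv_component h.smooth_ℓ]
  set c := ℓ y (basisVec i) / ℓ y (basisVec 0) with hc
  have h1 := h.integrable (basisVec j) (basisVec i - c • basisVec 0) hj (by
    rw [map_sub, map_smul, smul_eq_mul, hc, div_mul_cancel₀ _ h0, sub_self])
  have h2 : fderiv ℝ ℓ y (basisVec j) (basisVec i)
      = c * extD ℓ y (basisVec j) (basisVec 0) := by
    simp only [extD, map_sub, map_smul, sub_apply, smul_apply, smul_eq_mul] at h1 ⊢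
    linarith
  rw [h2, norm_mul, hc, norm_div, Real.norm_eq_abs, Real.norm_eq_abs, Real.norm_eq_abs]
  have h3 : 0 < |ℓ y (basisVec 0)| := abs_pos.2 h0
  calc |ℓ y (basisVec i)| / |ℓ y (basisVec 0)| * |extD ℓ y (basisVec j) (basisVec 0)|
      ≤ |ℓ y (basisVec i)| / |ℓ y (basisVec 0)| * (K * |ℓ y (basisVec 0)|) := by gcongr
    _ = K * |ℓ y (basisVec i)| := by field_simp

/-- A form of Frobenius' theorem: if `ℓ_1` vanishes, `ℓ_3` vanishes on `y¹ = 0`, and `ℓ_2` vanishes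
on `y¹ = y³ = 0`, then `ℓ` is a multiple of `dy⁰`. The vanishing spreads from the initial surfaces
along `∂_3` and then along `∂_1`, by a linear differential equation. -/
theorem eventually_component_eq_zero {n ℓ : R4 → R4 →L[ℝ] ℝ} {m : R4 → R4 →L[ℝ] ℂ}
    (hadm : ∀ᶠ y in 𝓝 0, IsAdmissible n ℓ m y) (h0 : ℓ 0 (basisVec 0) = 1)
    (h1 : ∀ᶠ y in 𝓝 0, ℓ y (basisVec 1) = 0)
    (h3 : ∀ᶠ y : R4 in 𝓝 0, y 1 = 0 → ℓ y (basisVec 3) = 0)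
    (h2 : ∀ᶠ y : R4 in 𝓝 0, y 1 = 0 → y 3 = 0 → ℓ y (basisVec 2) = 0) :
    ∀ᶠ y in 𝓝 0, ∀ j, j ≠ 0 → ℓ y (basisVec j) = 0 := by
  have hadm0 := hadm.self_of_nhds
  have hc0 : ContinuousAt (fun y => ℓ y (basisVec 0)) 0 :=
    hadm0.smooth_ℓ.continuousAt.clm_apply continuousAt_const
  have hne : ∀ᶠ y in 𝓝 0, ℓ y (basisVec 0) ≠ 0 := hc0.eventually_ne (by simp [h0])
  have hbd : ∀ j, ∃ K, ∀ᶠ y in 𝓝 0,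
      |extD ℓ y (basisVec j) (basisVec 0)| ≤ K * |ℓ y (basisVec 0)| := by
    intro j
    refine ⟨|extD ℓ 0 (basisVec j) (basisVec 0)| + 1, ?_⟩
    have hl := (continuousAt_extD hadm0.smooth_ℓ (basisVec j) (basisVec 0)).abs
    have hr : ContinuousAt (fun y => (|extD ℓ 0 (basisVec j) (basisVec 0)| + 1)
        * |ℓ y (basisVec 0)|) 0 := continuousAt_const.mul hc0.abs
    have := hl.eventually_lt hr (by simp [h0])
    exact this.mono fun y hy => hy.le
  obtain ⟨K₁, hK₁⟩ := hbd 1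
  obtain ⟨K₃, hK₃⟩ := hbd 3
  obtain ⟨r, hr, hball⟩ := Metric.eventually_nhds_iff_ball.1
    (hadm.and (hne.and (hK₁.and (hK₃.and (h1.and (h3.and h2))))))
  have hdiff : ∀ y ∈ Metric.ball (0 : R4) r, ∀ i,
      ContDiffAt ℝ ∞ (fun y => ℓ y (basisVec i)) y :=
    fun y hy i => (hball y hy).1.smooth_ℓ.clm_apply contDiffAt_const
  have hnhds : ∀ y ∈ Metric.ball (0 : R4) r, ∀ᶠ y' in 𝓝 y, y' ∈ Metric.ball (0 : R4) r :=
    fun y hy => Metric.isOpen_ball.mem_nhds hy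
  -- on the hypersurface `y¹ = 0`
  have hsurf : ∀ y ∈ Metric.ball (0 : R4) r, y 1 = 0 → ℓ y (basisVec 2) = 0 := by
    intro y hy hy1
    have := eq_zero_of_norm_fderiv_le (f := fun y => ℓ y (basisVec 2))
      (y := y - y 3 • basisVec 3) (v := y 3 • basisVec 3) (K := |y 3| * K₃) ?_ ?_ ?_
    · simpa using this
    · intro t ht
      exact (hdiff _ (shrink_mem_ball hy 3 ht) 2).differentiableAt (by simp)
    · intro t ht
      have hz := shrink_mem_ball hy 3 ht
      set z := y - y 3 • basisVec 3 + t • y 3 • basisVec 3 with hzdef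
      have hz1 : z 1 = 0 := by simp [hzdef, basisVec_apply, hy1]
      obtain ⟨ha, hb, -, hc, -, hd, -⟩ := hball z hz
      have hder : fderiv ℝ ℓ z (basisVec 2) (basisVec 3) = 0 := by
        rw [← fderiv_component ha.smooth_ℓ]
        refine (hasDerivAt_coordLine (hdiff z hz 3) 2).unique
          ((hasDerivAt_const (0 : ℝ) (0 : ℝ)).congr_of_eventuallyEq ?_)
        filter_upwards [(tendsto_coordLine z 2).eventually (hnhds z hz)] with s hs
        exact (hball _ hs).2.2.2.2.2.1 (by simp [basisVec_apply, hz1])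
      have := ha.norm_fderiv_component_le hb hc (hd hz1) hder
      rw [map_smul, norm_smul, Real.norm_eq_abs, mul_assoc]
      gcongr
    · have hz := flatten_mem_ball hy 3
      exact (hball _ hz).2.2.2.2.2.2 (by simp [basisVec_apply, hy1]) (by simp [basisVec_apply])
  have hall : ∀ i, (∀ y ∈ Metric.ball (0 : R4) r, y 1 = 0 → ℓ y (basisVec i) = 0) →
      ∀ y ∈ Metric.ball (0 : R4) r, ℓ y (basisVec i) = 0 := by
    intro i hi y hy
    have := eq_zero_of_norm_fderiv_le (f := fun y => ℓ y (basisVec i))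
      (y := y - y 1 • basisVec 1) (v := y 1 • basisVec 1) (K := |y 1| * K₁) ?_ ?_ ?_
    · simpa using this
    · intro t ht
      exact (hdiff _ (shrink_mem_ball hy 1 ht) i).differentiableAt (by simp)
    · intro t ht
      have hz := shrink_mem_ball hy 1 ht
      set z := y - y 1 • basisVec 1 + t • y 1 • basisVec 1 with hzdef
      obtain ⟨ha, hb, hc, -, hd, -⟩ := hball z hz
      have hder : fderiv ℝ ℓ z (basisVec i) (basisVec 1) = 0 := by
        rw [← fderiv_component ha.smooth_ℓ]
        refine (hasDerivAt_coordLine (hdiff z hz 1) i).unique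
          ((hasDerivAt_const (0 : ℝ) (0 : ℝ)).congr_of_eventuallyEq ?_)
        filter_upwards [(tendsto_coordLine z i).eventually (hnhds z hz)] with s hs
        exact (hball _ hs).2.2.2.2.1
      have := ha.norm_fderiv_component_le hb hc hd hder
      rw [map_smul, norm_smul, Real.norm_eq_abs, mul_assoc]
      gcongr
    · exact hi _ (flatten_mem_ball hy 1) (by simp [basisVec_apply])
  filter_upwards [Metric.ball_mem_nhds (0 : R4) hr] with y hy j hj
  fin_cases j
  · exact absurd rfl hj
  · exact (hball y hy).2.2.2.2.1
  · exact hall 2 hsurf y hy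
  · exact hall 3 (fun y hy => (hball y hy).2.2.2.2.2.1) y hy

/-- An admissible coframe in coordinates around `0` in which `∂_1` is the frame vector dual to `n`,
`ℓ` is a multiple of `dy⁰`, and the components at the origin are normalized. -/
structure IsFlowAdapted (n ℓ : R4 → R4 →L[ℝ] ℝ) (m : R4 → R4 →L[ℝ] ℂ) : Prop where
  admissible : ∀ᶠ y in 𝓝 0, IsAdmissible n ℓ m y
  ℓ_eq_zero : ∀ᶠ y in 𝓝 0, ∀ j, j ≠ 0 → ℓ y (basisVec j) = 0
  n_one : ∀ᶠ y in 𝓝 0, n y (basisVec 1) = 1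
  m_one : ∀ᶠ y in 𝓝 0, m y (basisVec 1) = 0
  ℓ_zero : ℓ 0 (basisVec 0) = 1
  m_two : m 0 (basisVec 2) = 1
  m_three : m 0 (basisVec 3) = Complex.I

theorem exists_continuousLinearEquiv_of_injective {L : R4 →L[ℝ] R4} (hL : Function.Injective L) :
    ∃ A : R4 ≃L[ℝ] R4, (A : R4 →L[ℝ] R4) = L :=
  ⟨(LinearEquiv.ofInjectiveEndo (L : R4 →ₗ[ℝ] R4) hL).toContinuousLinearEquiv, by ext1 v; rfl⟩

/-- Coordinates built from the flows of the frame vector fields dual to `Re m`, `Im m` and `n`, in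
this order. -/
theorem exists_flow_coordinates {n ℓ : R4 → R4 →L[ℝ] ℝ} {m : R4 → R4 →L[ℝ] ℂ} {x₀ : R4}
    (h : ∀ᶠ x in 𝓝 x₀, IsAdmissible n ℓ m x) :
    ∃ e : OpenPartialHomeomorph R4 R4, 0 ∈ e.source ∧ e 0 = x₀ ∧ ContDiffOn ℝ ∞ e e.source ∧
      ContDiffOn ℝ ∞ e.symm e.target ∧
      IsFlowAdapted (pullback e n) (pullback e ℓ) (pullback e m) := by
  obtain ⟨X₀, hX₀⟩ := exists_dual_vectorField h 1 0 0
  obtain ⟨X₁, hX₁⟩ := exists_dual_vectorField h 0 1 0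
  obtain ⟨X₂, hX₂⟩ := exists_dual_vectorField h 0 0 1
  obtain ⟨X₃, hX₃⟩ := exists_dual_vectorField h 0 0 Complex.I
  -- a curve transversal to the kernel of `ℓ`
  let Q : R4 → R4 := fun y => x₀ + y 0 • X₀ x₀
  have hQ : ContDiff ℝ ∞ Q := by fun_prop
  have hQi : ∀ i : Fin 4, i ≠ 0 → ∀ y (s : ℝ), Q (y + s • basisVec i) = Q y := by
    intro i hi y s
    simp [Q, basisVec_apply, hi.symm]
  obtain ⟨Ψ₂, h20, h2i, h2⟩ := exists_flow_step (hX₂.mono fun x hx => hx.1)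
    (Eventually.of_forall fun y => hQ.contDiffAt) (by simp [Q]) 2 (hQi 2 (by decide))
  have h2s := h2.mono fun y hy => hy.1
  obtain ⟨Ψ₃, h30, h3i, h3⟩ := exists_flow_step (hX₃.mono fun x hx => hx.1) h2s h20 3
    (h2i 3 (by decide) (hQi 3 (by decide)))
  have h3s := h3.mono fun y hy => hy.1
  obtain ⟨Ψ, h10, -, h1⟩ := exists_flow_step (hX₁.mono fun x hx => hx.1) h3s h30 1
    (h3i 1 (by decide) (h2i 1 (by decide) (hQi 1 (by decide))))
  have h1s := h1.mono fun y hy => hy.1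
  have hΨc : Tendsto Ψ (𝓝 0) (𝓝 x₀) := by
    rw [← h10]; exact h1s.self_of_nhds.continuousAt
  have d1 : ∀ᶠ y in 𝓝 0, fderiv ℝ Ψ y (basisVec 1) = X₁ (Ψ y) := h1.mono fun y hy => hy.2.1
  have d3 : ∀ᶠ y : R4 in 𝓝 0, y 1 = 0 → fderiv ℝ Ψ y (basisVec 3) = X₃ (Ψ y) := by
    filter_upwards [h1, h3] with y hy1 hy3 hy
    rw [(hy1.2.2 hy).2 3 (by decide), (hy1.2.2 hy).1, hy3.2.1]
  have d2 : ∀ᶠ y : R4 in 𝓝 0, y 1 = 0 → y 3 = 0 → fderiv ℝ Ψ y (basisVec 2) = X₂ (Ψ y) := by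
    filter_upwards [h1, h3, h2] with y hy1 hy3 hy2 hy hy'
    rw [(hy1.2.2 hy).2 2 (by decide), (hy1.2.2 hy).1, (hy3.2.2 hy').2 2 (by decide),
      (hy3.2.2 hy').1, hy2.2.1]
  have d0 : fderiv ℝ Ψ 0 (basisVec 0) = X₀ x₀ := by
    rw [(h1.self_of_nhds.2.2 rfl).2 0 (by decide), (h3.self_of_nhds.2.2 rfl).2 0 (by decide),
      (h2.self_of_nhds.2.2 rfl).2 0 (by decide)]
    have hd : HasDerivAt (fun s : ℝ => Q (0 + s • basisVec 0)) (X₀ x₀) 0 := by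
      have : HasDerivAt (fun s : ℝ => x₀ + s • X₀ x₀) (X₀ x₀) 0 := by
        simpa using ((hasDerivAt_id (0 : ℝ)).smul_const (X₀ x₀)).const_add x₀
      refine this.congr_of_eventuallyEq (Eventually.of_forall fun s => ?_)
      simp [Q, basisVec_apply]
    exact (hasDerivAt_coordLine hQ.contDiffAt 0).unique hd
  have d1' := d1.self_of_nhds
  have d2' := d2.self_of_nhds rfl rfl
  have d3' := d3.self_of_nhds rfl
  rw [h10] at d1' d2' d3'
  obtain ⟨-, a0, b0, c0⟩ := hX₀.self_of_nhds
  obtain ⟨-, a1, b1, c1⟩ := hX₁.self_of_nhds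
  obtain ⟨-, a2, b2, c2⟩ := hX₂.self_of_nhds
  obtain ⟨-, a3, b3, c3⟩ := hX₃.self_of_nhds
  have hinj : Function.Injective (fderiv ℝ Ψ 0) := by
    rw [injective_iff_map_eq_zero]
    intro w hw
    rw [apply_eq_sum, Fin.sum_univ_four, d0, d1', d2', d3'] at hw
    have e1 := congrArg (ℓ x₀) hw
    have e2 := congrArg (n x₀) hw
    have e3 := congrArg (m x₀) hw
    simp only [map_add, map_smul, a0, a1, a2, a3, map_zero, smul_eq_mul, mul_one, mul_zero,
      add_zero] at e1
    simp only [map_add, map_smul, b0, b1, b2, b3, map_zero, smul_eq_mul, mul_one, mul_zero,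
      add_zero, zero_add] at e2
    simp only [map_add, map_smul, c0, c1, c2, c3, map_zero, smul_zero, zero_add] at e3
    have e4 := congrArg Complex.re e3
    have e5 := congrArg Complex.im e3
    simp at e4 e5
    ext i
    fin_cases i
    · simpa using e1
    · simpa using e2
    · simpa using e4
    · simpa using e5
  obtain ⟨A, hA⟩ := exists_continuousLinearEquiv_of_injective hinj
  obtain ⟨e, he0, -, he, hes, het, heA⟩ := exists_smooth_local_inverse h1s (f' := A)
    (by rw [hA]; exact (h1s.self_of_nhds.differentiableAt (by simp)).hasFDerivAt) univ_mem
  refine ⟨e, he0, by rw [he, h10], hes, het, ?_⟩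
  rw [he]
  have hadm : ∀ᶠ y in 𝓝 0, IsAdmissible (pullback Ψ n) (pullback Ψ ℓ) (pullback Ψ m) y := by
    filter_upwards [hΨc.eventually h, h1s, e.open_source.mem_nhds he0] with y hy hs hy'
    refine hy.pullback hs ?_
    obtain ⟨B, hB⟩ := heA y hy'
    rw [hB.fderiv]
    exact B.injective
  refine ⟨hadm, ?_, ?_, ?_, ?_, ?_, ?_⟩
  · refine eventually_component_eq_zero hadm ?_ ?_ ?_ ?_
    · rw [pullback_apply, d0, h10, a0]
    · filter_upwards [d1, hΨc.eventually hX₁] with y hy hX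
      rw [pullback_apply, hy, hX.2.1]
    · filter_upwards [d3, hΨc.eventually hX₃] with y hy hX hy1
      rw [pullback_apply, hy hy1, hX.2.1]
    · filter_upwards [d2, hΨc.eventually hX₂] with y hy hX hy1 hy3
      rw [pullback_apply, hy hy1 hy3, hX.2.1]
  · filter_upwards [d1, hΨc.eventually hX₁] with y hy hX
    rw [pullback_apply, hy, hX.2.2.1]
  · filter_upwards [d1, hΨc.eventually hX₁] with y hy hX
    rw [pullback_apply, hy, hX.2.2.2]
  · rw [pullback_apply, d0, h10, a0]
  · rw [pullback_apply, d2', h10, c2]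
  · rw [pullback_apply, d3', h10, c3]

end FlowCoordinates

/-! ### Isothermal coordinates on the wave surfaces -/

section IsothermalCoordinates

/-- The projection of the model space to the hyperplane `y¹ = 0`. -/
noncomputable def dropOne : R4 →L[ℝ] R4 :=
  ContinuousLinearMap.id ℝ R4 - (EuclideanSpace.proj 1 : R4 →L[ℝ] ℝ).smulRight (basisVec 1)

theorem dropOne_apply (y : R4) : dropOne y = y - y 1 • basisVec 1 := by
  simp [dropOne]

theorem dropOne_basisVec_one : dropOne (basisVec 1) = 0 := by
  simp [dropOne_apply, basisVec_apply]

theorem dropOne_basisVec {j : Fin 4} (hj : j ≠ 1) : dropOne (basisVec j) = basisVec j := by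
  simp [dropOne_apply, basisVec_apply, hj.symm]

/-- A function that is smooth near the origin has a smooth primitive in the direction of `y¹`. It is
`y¹ ∫₀¹ b (y⁰, t y¹, y², y³) dt`. -/
theorem exists_coordinate_primitive {b : R4 → ℝ} (hb : ∀ᶠ y in 𝓝 0, ContDiffAt ℝ ∞ b y) :
    ∃ v : R4 → ℝ, ContDiff ℝ ∞ v ∧ v 0 = 0 ∧ ∀ᶠ y in 𝓝 0, fderiv ℝ v y (basisVec 1) = b y := by
  obtain ⟨β, hβ, -, hβb⟩ := exists_contDiff_hasCompactSupport_eventuallyEq hb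
  let line : C(unitInterval, R4) := ⟨fun t => (t : ℝ) • basisVec 1, by fun_prop⟩
  let γ : R4 →L[ℝ] C(unitInterval, R4) :=
    (ContinuousLinearMap.const ℝ unitInterval).comp dropOne
      + (EuclideanSpace.proj 1 : R4 →L[ℝ] ℝ).smulRight line
  let ev : C(unitInterval, ℝ) →L[ℝ] ℝ := ContinuousMap.evalCLM ℝ 1
  let J : C(unitInterval, ℝ) →L[ℝ] C(unitInterval, ℝ) := pathIntegral
  let v : R4 → ℝ := fun y => y 1 * (ev.comp J) (superposition hβ.continuous (γ y))
  have hcoord : ContDiff ℝ ∞ fun y : R4 => y 1 := by fun_prop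
  have hv : ContDiff ℝ ∞ v := hcoord.mul ((ev.comp J).contDiff.comp
    ((contDiff_superposition hβ).comp γ.contDiff))
  have hint : ∀ y, v y = ∫ r in (0 : ℝ)..(y 1), β (dropOne y + r • basisVec 1) := by
    intro y
    have h1 : (ev.comp J) (superposition hβ.continuous (γ y))
        = ∫ t in (0 : ℝ)..1, β (dropOne y + (y 1 * t) • basisVec 1) := by
      change (∫ t in (0 : ℝ)..1, _) = _
      refine intervalIntegral.integral_congr fun t ht => ?_
      rw [uIcc_of_le zero_le_one] at ht
      refine (Set.IccExtend_of_mem zero_le_one (superposition hβ.continuous (γ y)) ht).trans ?_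
      change β (dropOne y + y 1 • (t • basisVec 1)) = _
      rw [smul_smul]
    change y 1 * (ev.comp J) _ = _
    rw [h1, intervalIntegral.mul_integral_comp_mul_left
      (f := fun r => β (dropOne y + r • basisVec 1))]
    simp
  refine ⟨v, hv, by simp [v], ?_⟩
  filter_upwards [hβb] with y hy
  rw [← hy]
  have hc : Continuous fun r : ℝ => β (dropOne y + r • basisVec 1) := by
    have := hβ.continuous
    fun_prop
  have h2 : HasDerivAt (fun s => ∫ r in (0 : ℝ)..s, β (dropOne y + r • basisVec 1)) (β y)
      (y 1 + 0) := by
    have := intervalIntegral.integral_hasDerivAt_right (hc.intervalIntegrable 0 (y 1 + 0))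
      (hc.stronglyMeasurableAtFilter _ _) hc.continuousAt
    simpa [dropOne_apply] using this
  refine (hasDerivAt_coordLine hv.contDiffAt 1).unique
    ((h2.comp_const_add (y 1) 0).congr_of_eventuallyEq (Eventually.of_forall fun s => ?_))
  simp only [hint, map_add, map_smul, dropOne_basisVec_one, smul_zero, add_zero]
  simp [basisVec_apply]

theorem contDiffAt_div_complex {f g : R4 → ℂ} {y : R4} (hf : ContDiffAt ℝ ∞ f y)
    (hg : ContDiffAt ℝ ∞ g y) (h : g y ≠ 0) : ContDiffAt ℝ ∞ (fun z => f z / g z) y := by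
  simp only [div_eq_mul_inv]
  exact hf.mul (hg.inv h)

/-- The ratio of the components of `m` modulo `ℓ` does not depend on `y¹`, since `m` only rotates
along `∂_1`. -/
theorem IsFlowAdapted.ratio_eventually_eq {n ℓ : R4 → R4 →L[ℝ] ℝ} {m : R4 → R4 →L[ℝ] ℂ}
    (h : IsFlowAdapted n ℓ m) :
    ∀ᶠ y in 𝓝 0, m y (basisVec 3) / m y (basisVec 2)
      = m (dropOne y) (basisVec 3) / m (dropOne y) (basisVec 2) := by
  have hne : ∀ᶠ y in 𝓝 0, m y (basisVec 2) ≠ 0 :=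
    (h.admissible.self_of_nhds.smooth_m.continuousAt.clm_apply continuousAt_const).eventually_ne
      (by simp [h.m_two])
  obtain ⟨r, hr, hball⟩ := Metric.eventually_nhds_iff_ball.1
    (h.admissible.and (h.ℓ_eq_zero.and (h.m_one.and hne)))
  have hderiv : ∀ y ∈ Metric.ball (0 : R4) r,
      HasFDerivAt (fun y => m y (basisVec 3) / m y (basisVec 2))
        (fderiv ℝ (fun y => m y (basisVec 3) / m y (basisVec 2)) y) y ∧
      fderiv ℝ (fun y => m y (basisVec 3) / m y (basisVec 2)) y (basisVec 1) = 0 := by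
    intro y hy
    obtain ⟨ha, hl, hm1, hm2⟩ := hball y hy
    obtain ⟨ψ, hψ⟩ := ha.rotation (basisVec 1) (hl 1 (by decide)) hm1
    have hs : ∀ j, ContDiffAt ℝ ∞ (fun y => m y (basisVec j)) y :=
      fun j => ha.smooth_m.clm_apply contDiffAt_const
    have hcomp : ∀ j, j ≠ 0 →
        fderiv ℝ m y (basisVec 1) (basisVec j) = Complex.I * ψ * m y (basisVec j) := by
      intro j hj
      have h1 := hψ (basisVec j) (hl j hj)
      have h2 : fderiv ℝ m y (basisVec j) (basisVec 1) = 0 := by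
        rw [← fderiv_component ha.smooth_m]
        have : (fun y => m y (basisVec 1)) =ᶠ[𝓝 y] fun _ => 0 := by
          filter_upwards [Metric.isOpen_ball.mem_nhds hy] with z hz
          exact (hball z hz).2.2.1
        rw [this.fderiv_eq]
        simp
      rwa [extD, h2, sub_zero] at h1
    have hd : DifferentiableAt ℝ (fun y => m y (basisVec 3) / m y (basisVec 2)) y :=
      ContDiffAt.differentiableAt (contDiffAt_div_complex (hs 3) (hs 2) hm2) (by simp)
    refine ⟨hd.hasFDerivAt, ?_⟩
    have h3 := (hasDerivAt_coordLine (hs 3) 1).div (hasDerivAt_coordLine (hs 2) 1)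
      (by simpa using hm2)
    have h4 : HasDerivAt (fun s : ℝ => m (y + s • basisVec 1) (basisVec 3)
        / m (y + s • basisVec 1) (basisVec 2))
        (fderiv ℝ (fun y => m y (basisVec 3) / m y (basisVec 2)) y (basisVec 1)) 0 :=
      hasDerivAt_coordLine (contDiffAt_div_complex (hs 3) (hs 2) hm2) 1
    rw [h4.unique h3, fderiv_component ha.smooth_m, fderiv_component ha.smooth_m,
      hcomp 3 (by decide), hcomp 2 (by decide)]
    simp only [zero_smul, add_zero]
    rw [div_eq_zero_iff]
    left
    ring
  filter_upwards [Metric.ball_mem_nhds (0 : R4) hr] with y hy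
  have := eq_zero_of_norm_fderiv_le (f := fun z => m z (basisVec 3) / m z (basisVec 2)
      - m (dropOne y) (basisVec 3) / m (dropOne y) (basisVec 2))
      (y := y - y 1 • basisVec 1) (v := y 1 • basisVec 1) (K := 0) ?_ ?_ ?_
  · simp only [sub_add_cancel] at this
    exact sub_eq_zero.1 this
  · intro t ht
    exact (hderiv _ (shrink_mem_ball hy 1 ht)).1.differentiableAt.sub_const _
  · intro t ht
    rw [fderiv_sub_const, map_smul, (hderiv _ (shrink_mem_ball hy 1 ht)).2]
    simp
  · rw [dropOne_apply, sub_self]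

/-- An admissible coframe in coordinates `(u, v, x¹, x²)` around `0` in which it has the normal form
up to a boost and a spin: `ℓ ∝ du`, `n(∂_v) ℓ(∂_u) = 1`, and `m` is a multiple of `dx¹ + i dx²`
modulo `du`. The positivity conditions allow smooth choices of the boost and of the spin. -/
structure IsNormalUpToGauge (n ℓ : R4 → R4 →L[ℝ] ℝ) (m : R4 → R4 →L[ℝ] ℂ) (y : R4) : Prop where
  admissible : IsAdmissible n ℓ m y
  ℓ_eq_zero : ∀ j, j ≠ 0 → ℓ y (basisVec j) = 0
  ℓ_pos : 0 < ℓ y (basisVec 0)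
  n_mul_ℓ : n y (basisVec 1) * ℓ y (basisVec 0) = 1
  m_one : m y (basisVec 1) = 0
  m_three : m y (basisVec 3) = Complex.I * m y (basisVec 2)
  m_two_pos : 0 < (m y (basisVec 2)).re

/-- The coordinates `(y⁰, v, Re w, Im w)`, where `∂_1 v = ℓ_0` and where `w` solves the Beltrami
equation that makes `m` a multiple of `dw` modulo `dy⁰`. -/
theorem exists_isothermal_coordinates {n ℓ : R4 → R4 →L[ℝ] ℝ} {m : R4 → R4 →L[ℝ] ℂ}
    (h : IsFlowAdapted n ℓ m) :
    ∃ e : OpenPartialHomeomorph R4 R4, 0 ∈ e.source ∧ e 0 = 0 ∧ ContDiffOn ℝ ∞ e e.source ∧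
      ContDiffOn ℝ ∞ e.symm e.target ∧
      ∀ᶠ z in 𝓝 0, IsNormalUpToGauge (pullback e.symm n) (pullback e.symm ℓ) (pullback e.symm m) z := by
  have hadm0 := h.admissible.self_of_nhds
  have hm2s : ∀ᶠ y in 𝓝 0, m y (basisVec 2) ≠ 0 :=
    (hadm0.smooth_m.continuousAt.clm_apply continuousAt_const).eventually_ne (by simp [h.m_two])
  let ν : R4 → ℂ := fun y => m y (basisVec 3) / m y (basisVec 2)
  have hν : ∀ᶠ y in 𝓝 0, ContDiffAt ℝ ∞ ν y := by
    filter_upwards [h.admissible, hm2s] with y hy hm2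
    have hs : ∀ j, ContDiffAt ℝ ∞ (fun y => m y (basisVec j)) y :=
      fun j => hy.smooth_m.clm_apply contDiffAt_const
    exact contDiffAt_div_complex (hs 3) (hs 2) hm2
  have hν0 : ν 0 = Complex.I := by simp [ν, h.m_two, h.m_three]
  obtain ⟨w₀, hw₀, hw₀pos, hw₀eq⟩ := exists_beltrami_solution hν hν0
  obtain ⟨v, hv, hv0, hveq⟩ := exists_coordinate_primitive (b := fun y => ℓ y (basisVec 0))
    (h.admissible.mono fun y hy => hy.smooth_ℓ.clm_apply contDiffAt_const)
  -- the Beltrami solution on `y¹ = 0`, extended independently of `y¹`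
  let w : R4 → ℂ := fun y => w₀ (dropOne y) - w₀ 0
  have hw : ContDiff ℝ ∞ w := (hw₀.comp dropOne.contDiff).sub contDiff_const
  have hwd : ∀ y X, fderiv ℝ w y X = fderiv ℝ w₀ (dropOne y) (dropOne X) := by
    intro y X
    have h1 : HasFDerivAt w₀ (fderiv ℝ w₀ (dropOne y)) (dropOne y) :=
      (hw₀.differentiable (by simp) _).hasFDerivAt
    have h2 := (h1.comp y dropOne.hasFDerivAt).sub_const (w₀ 0)
    have h3 : fderiv ℝ w y = _ := h2.fderiv
    rw [h3]; rfl
  have hdrop : Tendsto dropOne (𝓝 0) (𝓝 0) := by simpa using dropOne.continuous.tendsto 0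
  have hw1 : ∀ y, fderiv ℝ w y (basisVec 1) = 0 := fun y => by
    rw [hwd, dropOne_basisVec_one, map_zero]
  have hwpos : ∀ y, 0 < (fderiv ℝ w y (basisVec 2)).re := fun y => by
    rw [hwd, dropOne_basisVec (by decide)]; exact hw₀pos _
  have hwν : ∀ᶠ y in 𝓝 0, fderiv ℝ w y (basisVec 3) = ν y * fderiv ℝ w y (basisVec 2) := by
    filter_upwards [hdrop.eventually hw₀eq, h.ratio_eventually_eq] with y hy hr
    rw [hwd, hwd, dropOne_basisVec (by decide), dropOne_basisVec (by decide), hy]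
    congr 1
    exact hr.symm
  let Θ : R4 → R4 := fun y => WithLp.toLp 2 ![y 0, v y, (w y).re, (w y).im]
  have hΘ : ContDiff ℝ ∞ Θ := by
    rw [contDiff_euclidean]
    intro i
    fin_cases i
    · change ContDiff ℝ ∞ fun y : R4 => y 0
      fun_prop
    · exact hv
    · exact Complex.reCLM.contDiff.comp hw
    · exact Complex.imCLM.contDiff.comp hw
  have hΘd : ∀ y X, (fderiv ℝ Θ y X) 0 = X 0 ∧ (fderiv ℝ Θ y X) 1 = fderiv ℝ v y X ∧
      (((fderiv ℝ Θ y X) 2 : ℝ) : ℂ) + Complex.I * ((fderiv ℝ Θ y X) 3 : ℝ) = fderiv ℝ w y X := by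
    intro y X
    have hc : ∀ i : Fin 4, (fderiv ℝ Θ y X) i = fderiv ℝ (fun y => Θ y i) y X := by
      intro i
      have h1 : HasFDerivAt Θ (fderiv ℝ Θ y) y := (hΘ.differentiable (by simp) y).hasFDerivAt
      have h2 := ((EuclideanSpace.proj i : R4 →L[ℝ] ℝ).hasFDerivAt (x := Θ y)).comp y h1
      have h3 : fderiv ℝ (fun y => Θ y i) y = _ := h2.fderiv
      rw [h3]; rfl
    have hwy : HasFDerivAt w (fderiv ℝ w y) y := (hw.differentiable (by simp) y).hasFDerivAt
    refine ⟨?_, ?_, ?_⟩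
    · rw [hc 0]
      have h3 : fderiv ℝ (fun y => Θ y 0) y = _ :=
        ((EuclideanSpace.proj 0 : R4 →L[ℝ] ℝ).hasFDerivAt (x := y)).fderiv
      rw [h3]; rfl
    · rw [hc 1]; rfl
    · have h3 : fderiv ℝ (fun y => Θ y 2) y = _ :=
        ((Complex.reCLM.hasFDerivAt (x := w y)).comp y hwy).fderiv
      have h4 : fderiv ℝ (fun y => Θ y 3) y = _ :=
        ((Complex.imCLM.hasFDerivAt (x := w y)).comp y hwy).fderiv
      rw [hc 2, hc 3, h3, h4]
      apply Complex.ext <;> simp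
  have hνc : ContinuousAt ν 0 := hν.self_of_nhds.continuousAt
  have hνim : ∀ᶠ y in 𝓝 0, (ν y).im ≠ 0 :=
    (Complex.continuous_im.continuousAt.comp hνc).eventually_ne (by simp [hν0])
  have hℓpos : ∀ᶠ y in 𝓝 0, 0 < ℓ y (basisVec 0) :=
    (hadm0.smooth_ℓ.continuousAt.clm_apply continuousAt_const).eventually_const_lt
      (by simp [h.ℓ_zero])
  -- the factor in `m = (m_2 / ∂_2 w) dw` modulo `dy⁰`
  have hmw : ∀ᶠ y in 𝓝 0, 0 < (m y (basisVec 2) / fderiv ℝ w y (basisVec 2)).re := by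
    have hw2 : fderiv ℝ w 0 (basisVec 2) ≠ 0 := by
      intro h0; have := hwpos 0; rw [h0] at this; simp at this
    have h1 : ContinuousAt (fun y => m y (basisVec 2) / fderiv ℝ w y (basisVec 2)) 0 :=
      (hadm0.smooth_m.continuousAt.clm_apply continuousAt_const).div
        ((hw.continuous_fderiv (by simp)).continuousAt.clm_apply continuousAt_const) hw2
    refine (Complex.continuous_re.continuousAt.comp h1).eventually_const_lt ?_
    simp only [Function.comp, h.m_two, one_div, Complex.inv_re]
    exact div_pos (hwpos 0) (Complex.normSq_pos.2 hw2)
  have hgood := h.admissible.and (h.ℓ_eq_zero.and (h.n_one.and (h.m_one.and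
    (hm2s.and (hveq.and (hwν.and (hνim.and (hℓpos.and hmw))))))))
  -- a vector annihilated by `dy⁰` and `dw` is a multiple of `∂_1`
  have hker : ∀ y, fderiv ℝ w y (basisVec 3) = ν y * fderiv ℝ w y (basisVec 2) → (ν y).im ≠ 0 →
      ∀ X : R4, X 0 = 0 → fderiv ℝ w y X = 0 → X = X 1 • basisVec 1 := by
    intro y h3 him X hX0 hX
    rw [apply_eq_sum, Fin.sum_univ_four, hX0, hw1, h3] at hX
    have hw2 : fderiv ℝ w y (basisVec 2) ≠ 0 := by
      intro h0; have := hwpos y; rw [h0] at this; simp at this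
    simp only [zero_smul, smul_zero, zero_add, Complex.real_smul] at hX
    have h5 : ((X 2 : ℂ) + X 3 * ν y) * fderiv ℝ w y (basisVec 2) = 0 := by
      linear_combination hX
    have h6 := (mul_eq_zero.1 h5).resolve_right hw2
    have h7 := congrArg Complex.im h6
    have h8 := congrArg Complex.re h6
    simp at h7 h8
    have hX3 : X 3 = 0 := h7.resolve_right him
    rw [hX3] at h8
    simp at h8
    ext i
    fin_cases i
    · simp [basisVec_apply, hX0]
    · simp [basisVec_apply]
    · simp [basisVec_apply, h8]
    · simp [basisVec_apply, hX3]
  have hinj : Function.Injective (fderiv ℝ Θ 0) := by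
    rw [injective_iff_map_eq_zero]
    intro X hX
    obtain ⟨-, -, -, -, -, g1, g2, g3, g4, -⟩ := hgood.self_of_nhds
    obtain ⟨k0, k1, k2⟩ := hΘd 0 X
    rw [hX] at k0 k1 k2
    simp only [PiLp.zero_apply, Complex.ofReal_zero, mul_zero, add_zero] at k0 k1 k2
    have hXe := hker 0 g2 g3 X k0.symm k2.symm
    rw [hXe, map_smul, g1, smul_eq_mul] at k1
    have : X 1 = 0 := (mul_eq_zero.1 k1.symm).resolve_right g4.ne'
    rw [hXe, this, zero_smul]
  obtain ⟨A, hA⟩ := exists_continuousLinearEquiv_of_injective hinj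
  obtain ⟨e, he0, hsub, he, hes, het, heA⟩ := exists_smooth_local_inverse
    (Eventually.of_forall fun y => hΘ.contDiffAt) (f' := A) (a := 0)
    (by rw [hA]; exact (hΘ.differentiable (by simp) 0).hasFDerivAt) hgood
  have hΘ0 : e 0 = 0 := by
    rw [he]
    ext i
    fin_cases i <;> simp [Θ, hv0, w]
  refine ⟨e, he0, hΘ0, hes, het, ?_⟩
  have h0t : (0 : R4) ∈ e.target := by
    have := e.map_source he0
    rwa [hΘ0] at this
  filter_upwards [e.open_target.mem_nhds h0t] with z hz
  have hys := e.map_target hz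
  obtain ⟨f1, f2, f3, f4, f5, g1, g2, g3, g4, g5⟩ := hsub hys
  obtain ⟨B, hB⟩ := heA _ hys
  have hsymm : HasFDerivAt e.symm (B.symm : R4 →L[ℝ] R4) z :=
    e.hasFDerivAt_symm hz (by rw [he]; exact hB)
  set y := e.symm z with hy
  have hsz : ContDiffAt ℝ ∞ e.symm z := het.contDiffAt (e.open_target.mem_nhds hz)
  -- the components of a vector in the two coordinate systems
  have hrel : ∀ Z : R4, (fderiv ℝ e.symm z Z) 0 = Z 0 ∧ fderiv ℝ v y (fderiv ℝ e.symm z Z) = Z 1 ∧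
      fderiv ℝ w y (fderiv ℝ e.symm z Z) = (Z 2 : ℂ) + Complex.I * (Z 3 : ℂ) := by
    intro Z
    have h1 : fderiv ℝ Θ y (fderiv ℝ e.symm z Z) = Z := by
      rw [hsymm.fderiv, hB.fderiv]; exact B.apply_symm_apply Z
    obtain ⟨k0, k1, k2⟩ := hΘd y (fderiv ℝ e.symm z Z)
    rw [h1] at k0 k1 k2
    exact ⟨k0.symm, k1.symm, k2.symm⟩
  have hw2 : fderiv ℝ w y (basisVec 2) ≠ 0 := by
    intro h0; have := hwpos y; rw [h0] at this; simp at this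
  have hℓX : ∀ Z, pullback e.symm ℓ z Z = Z 0 * ℓ y (basisVec 0) := by
    intro Z
    rw [pullback_apply, ← hy, apply_eq_sum, Fin.sum_univ_four, f2 1 (by decide),
      f2 2 (by decide), f2 3 (by decide), (hrel Z).1]
    simp
  have hmX : ∀ Z : R4, Z 0 = 0 → pullback e.symm m z Z
      = m y (basisVec 2) / fderiv ℝ w y (basisVec 2) * ((Z 2 : ℂ) + Complex.I * (Z 3 : ℂ)) := by
    intro Z hZ
    obtain ⟨k0, -, k2⟩ := hrel Z
    rw [hZ] at k0
    have hm3 : m y (basisVec 3) = ν y * m y (basisVec 2) := by simp only [ν]; field_simp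
    rw [← k2, pullback_apply, ← hy]
    set X := fderiv ℝ e.symm z Z
    have hmy : m y X = ((X 2 : ℂ) + X 3 * ν y) * m y (basisVec 2) := by
      rw [apply_eq_sum, Fin.sum_univ_four, k0, f4, hm3]
      simp only [zero_smul, smul_zero, zero_add, Complex.real_smul]
      ring
    have hwy : fderiv ℝ w y X = ((X 2 : ℂ) + X 3 * ν y) * fderiv ℝ w y (basisVec 2) := by
      rw [apply_eq_sum, Fin.sum_univ_four, k0, hw1, g2]
      simp only [zero_smul, smul_zero, zero_add, Complex.real_smul]
      ring
    rw [hmy, hwy]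
    field_simp
  refine ⟨f1.pullback hsz ?_, ?_, ?_, ?_, ?_, ?_, ?_⟩
  · change Function.Injective (fderiv ℝ e.symm z)
    rw [hsymm.fderiv]; exact B.symm.injective
  · intro j hj
    rw [hℓX]; simp [basisVec_apply, hj.symm]
  · rw [hℓX]; simpa [basisVec_apply] using g4
  · obtain ⟨k0, k1, k2⟩ := hrel (basisVec 1)
    have hX := hker y g2 g3 _ (by rw [k0]; simp [basisVec_apply]) (by rw [k2]; simp [basisVec_apply])
    rw [hX, map_smul, g1] at k1
    rw [hℓX, pullback_apply, ← hy, hX, map_smul, f3]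
    simpa [basisVec_apply] using k1
  · rw [hmX _ (by simp [basisVec_apply])]; simp [basisVec_apply]
  · rw [hmX _ (by simp [basisVec_apply]), hmX _ (by simp [basisVec_apply])]
    simp [basisVec_apply]
    ring
  · rw [hmX _ (by simp [basisVec_apply])]
    simpa [basisVec_apply] using g5

end IsothermalCoordinates

/-! ### The normal form on the model space -/

section NormalForm

/-- The canonical form of a null coframe in the coordinates `(u, v, x¹, x²)` on `s`, for the boost
`λ = boost` and the spin `θ = spin`. -/
structure HasNormalForm (n ℓ : R4 → R4 →L[ℝ] ℝ) (m : R4 → R4 →L[ℝ] ℂ) (s : Set R4)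
    (boost spin : R4 → ℝ) (H W₁ W₂ : ℝ → ℝ → ℝ → ℝ → ℝ) (M₀ : ℝ → ℝ → ℝ → ℝ → ℂ)
    (M₁ : ℝ → ℝ → ℝ → ℂ) : Prop where
  smooth_boost : ContDiffOn ℝ ∞ boost s
  smooth_spin : ContDiffOn ℝ ∞ spin s
  smooth_H : ContDiffOn ℝ ∞ (fun x : R4 => H (x 0) (x 1) (x 2) (x 3)) s
  smooth_W₁ : ContDiffOn ℝ ∞ (fun x : R4 => W₁ (x 0) (x 1) (x 2) (x 3)) s
  smooth_W₂ : ContDiffOn ℝ ∞ (fun x : R4 => W₂ (x 0) (x 1) (x 2) (x 3)) s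
  smooth_M₀ : ContDiffOn ℝ ∞ (fun x : R4 => M₀ (x 0) (x 1) (x 2) (x 3)) s
  smooth_M₁ : ContDiffOn ℝ ∞ (fun x : R4 => M₁ (x 0) (x 2) (x 3)) s
  ℓ_eq : ∀ x ∈ s, ∀ w, Real.exp (boost x) * ℓ x w = w 0
  n_eq : ∀ x ∈ s, ∀ w, Real.exp (-boost x) * n x w = w 1 + H (x 0) (x 1) (x 2) (x 3) * w 0
    + W₁ (x 0) (x 1) (x 2) (x 3) * w 2 + W₂ (x 0) (x 1) (x 2) (x 3) * w 3
  m_eq : ∀ x ∈ s, ∀ w, Complex.exp (Complex.I * (spin x : ℂ)) * m x w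
    = M₀ (x 0) (x 1) (x 2) (x 3) * (w 0 : ℂ)
      + M₁ (x 0) (x 2) (x 3) * ((w 2 : ℂ) + Complex.I * (w 3 : ℂ))

theorem vec_eta (x : R4) : (!₂[x 0, x 1, x 2, x 3] : R4) = x := by
  ext i
  fin_cases i <;> rfl

theorem vec_dropOne (x : R4) : (!₂[x 0, 0, x 2, x 3] : R4) = dropOne x := by
  ext i
  fin_cases i <;> simp [dropOne_apply, basisVec_apply]

/-- Along `∂_1` the form `m` only rotates, so that the modulus of `m_2` does not depend on `y¹`. -/
theorem norm_component_dropOne {n ℓ : R4 → R4 →L[ℝ] ℝ} {m : R4 → R4 →L[ℝ] ℂ} {r : ℝ}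
    (h : ∀ y ∈ Metric.ball (0 : R4) r, IsNormalUpToGauge n ℓ m y) {y : R4}
    (hy : y ∈ Metric.ball (0 : R4) r) :
    ‖m y (basisVec 2)‖ = ‖m (dropOne y) (basisVec 2)‖ := by
  let f : R4 → ℝ := fun z => ‖m z (basisVec 2)‖ ^ 2
  have hs : ∀ z ∈ Metric.ball (0 : R4) r, ContDiffAt ℝ ∞ (fun y => m y (basisVec 2)) z :=
    fun z hz => (h z hz).admissible.smooth_m.clm_apply contDiffAt_const
  have hf : ∀ z ∈ Metric.ball (0 : R4) r, ContDiffAt ℝ ∞ f z := fun z hz => (hs z hz).norm_sq ℝ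
  have hd : ∀ z ∈ Metric.ball (0 : R4) r, fderiv ℝ f z (basisVec 1) = 0 := by
    intro z hz
    obtain ⟨ha, hl, -, -, hm1, -, -⟩ := h z hz
    obtain ⟨ψ, hψ⟩ := ha.rotation (basisVec 1) (hl 1 (by decide)) hm1
    have h1 := hψ (basisVec 2) (hl 2 (by decide))
    have h2 : fderiv ℝ m z (basisVec 2) (basisVec 1) = 0 := by
      rw [← fderiv_component ha.smooth_m]
      have : (fun y => m y (basisVec 1)) =ᶠ[𝓝 z] fun _ => 0 := by
        filter_upwards [Metric.isOpen_ball.mem_nhds hz] with x hx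
        exact (h x hx).m_one
      rw [this.fderiv_eq]
      simp
    rw [extD, h2, sub_zero, ← fderiv_component ha.smooth_m] at h1
    have h3 := ((hs z hz).differentiableAt (by simp)).hasFDerivAt.norm_sq
    have h4 : fderiv ℝ f z = _ := h3.fderiv
    rw [h4]
    simp only [smul_apply, ContinuousLinearMap.comp_apply, h1]
    simp [Complex.inner]
    ring
  have key : f y = f (dropOne y) := by
    have := eq_zero_of_norm_fderiv_le (f := fun z => f z - f (dropOne y))
      (y := y - y 1 • basisVec 1) (v := y 1 • basisVec 1) (K := 0) ?_ ?_ ?_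
    · simp only [sub_add_cancel] at this
      exact sub_eq_zero.1 this
    · intro t ht
      exact ((hf _ (shrink_mem_ball hy 1 ht)).differentiableAt (by simp)).sub_const _
    · intro t ht
      rw [fderiv_sub_const, map_smul, hd _ (shrink_mem_ball hy 1 ht)]
      simp
    · rw [dropOne_apply, sub_self]
  exact (sq_eq_sq₀ (norm_nonneg _) (norm_nonneg _)).1 key

/-- A boost by `-log ℓ_0` and a spin by `-arg m_2` remove the remaining freedom. -/
theorem exists_hasNormalForm_of_isNormalUpToGauge {n ℓ : R4 → R4 →L[ℝ] ℝ} {m : R4 → R4 →L[ℝ] ℂ}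
    {r : ℝ} (h : ∀ y ∈ Metric.ball (0 : R4) r, IsNormalUpToGauge n ℓ m y) :
    ∃ boost spin H W₁ W₂ M₀ M₁,
      HasNormalForm n ℓ m (Metric.ball (0 : R4) r) boost spin H W₁ W₂ M₀ M₁ := by
  -- the boost is `-log c`, and `θ` is the spin
  let c : R4 → ℝ := fun y => ℓ y (basisVec 0)
  let θ : R4 → ℝ := fun y => -(Complex.log (m y (basisVec 2))).im
  have hslit : ∀ y ∈ Metric.ball (0 : R4) r, m y (basisVec 2) ∈ Complex.slitPlane :=
    fun y hy => Or.inl (h y hy).m_two_pos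
  have hn : ∀ j, ∀ y ∈ Metric.ball (0 : R4) r, ContDiffAt ℝ ∞ (fun y => n y (basisVec j)) y :=
    fun j y hy => (h y hy).admissible.smooth_n.clm_apply contDiffAt_const
  have hm : ∀ j, ∀ y ∈ Metric.ball (0 : R4) r, ContDiffAt ℝ ∞ (fun y => m y (basisVec j)) y :=
    fun j y hy => (h y hy).admissible.smooth_m.clm_apply contDiffAt_const
  have hc : ∀ y ∈ Metric.ball (0 : R4) r, ContDiffAt ℝ ∞ c y :=
    fun y hy => (h y hy).admissible.smooth_ℓ.clm_apply contDiffAt_const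
  have hθ : ∀ y ∈ Metric.ball (0 : R4) r, ContDiffAt ℝ ∞ θ y := by
    intro y hy
    have h1 : ContDiffAt ℝ ∞ Complex.log (m y (basisVec 2)) :=
      (Complex.contDiffAt_log (hslit y hy)).restrict_scalars ℝ
    exact (Complex.imCLM.contDiff.contDiffAt.comp y (h1.comp y (hm 2 y hy))).neg
  have hphase : ∀ y ∈ Metric.ball (0 : R4) r, ContDiffAt ℝ ∞
      (fun y => Complex.exp (Complex.I * (θ y : ℂ))) y := by
    intro y hy
    have h1 : ContDiffAt ℝ ∞ (fun y => Complex.I * (θ y : ℂ)) y :=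
      contDiffAt_const.mul (Complex.ofRealCLM.contDiff.contDiffAt.comp y (hθ y hy))
    exact (Complex.contDiff_exp (n := ∞)).contDiffAt.comp y h1
  have hexp : ∀ y ∈ Metric.ball (0 : R4) r, Real.exp (-Real.log (c y)) = (c y)⁻¹ := by
    intro y hy
    rw [Real.exp_neg, Real.exp_log (h y hy).ℓ_pos]
  have hexp' : ∀ y ∈ Metric.ball (0 : R4) r, Real.exp (- -Real.log (c y)) = c y := by
    intro y hy
    rw [neg_neg, Real.exp_log (h y hy).ℓ_pos]
  have hrot : ∀ y ∈ Metric.ball (0 : R4) r,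
      Complex.exp (Complex.I * (θ y : ℂ)) * m y (basisVec 2) = (‖m y (basisVec 2)‖ : ℂ) := by
    intro y hy
    have h0 : m y (basisVec 2) ≠ 0 := Complex.slitPlane_ne_zero (hslit y hy)
    have h1 : (θ y : ℂ) = -(Complex.arg (m y (basisVec 2)) : ℂ) := by
      simp [θ, Complex.log_im]
    have h2 := Complex.norm_mul_exp_arg_mul_I (m y (basisVec 2))
    rw [h1]
    calc _ = Complex.exp (Complex.I * -(Complex.arg (m y (basisVec 2)) : ℂ)) *
          (‖m y (basisVec 2)‖ * Complex.exp (Complex.arg (m y (basisVec 2)) * Complex.I)) := by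
            rw [h2]
      _ = ‖m y (basisVec 2)‖ * Complex.exp (Complex.I * -(Complex.arg (m y (basisVec 2)) : ℂ)
            + Complex.arg (m y (basisVec 2)) * Complex.I) := by rw [Complex.exp_add]; ring
      _ = _ := by ring_nf; simp
  refine ⟨fun y => -Real.log (c y), θ,
    fun a b d f => c !₂[a, b, d, f] * n !₂[a, b, d, f] (basisVec 0),
    fun a b d f => c !₂[a, b, d, f] * n !₂[a, b, d, f] (basisVec 2),
    fun a b d f => c !₂[a, b, d, f] * n !₂[a, b, d, f] (basisVec 3),
    fun a b d f => Complex.exp (Complex.I * (θ !₂[a, b, d, f] : ℂ)) * m !₂[a, b, d, f] (basisVec 0),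
    fun a d f => (‖m !₂[a, 0, d, f] (basisVec 2)‖ : ℂ), ?_, ?_, ?_, ?_, ?_, ?_, ?_, ?_, ?_, ?_⟩
  · intro y hy
    exact (((hc y hy).log (h y hy).ℓ_pos.ne').neg).contDiffWithinAt
  · exact fun y hy => (hθ y hy).contDiffWithinAt
  · simp only [vec_eta]
    exact fun y hy => ((hc y hy).mul (hn 0 y hy)).contDiffWithinAt
  · simp only [vec_eta]
    exact fun y hy => ((hc y hy).mul (hn 2 y hy)).contDiffWithinAt
  · simp only [vec_eta]
    exact fun y hy => ((hc y hy).mul (hn 3 y hy)).contDiffWithinAt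
  · simp only [vec_eta]
    exact fun y hy => ((hphase y hy).mul (hm 0 y hy)).contDiffWithinAt
  · simp only [vec_dropOne]
    have h1 : ContDiffOn ℝ ∞ (fun y => Complex.exp (Complex.I * (θ y : ℂ)) * m y (basisVec 2))
        (Metric.ball (0 : R4) r) :=
      fun y hy => ((hphase y hy).mul (hm 2 y hy)).contDiffWithinAt
    refine h1.congr fun y hy => ?_
    rw [hrot y hy, norm_component_dropOne h hy]
  · intro y hy w
    rw [hexp y hy, apply_eq_sum, Fin.sum_univ_four, (h y hy).ℓ_eq_zero 1 (by decide),
      (h y hy).ℓ_eq_zero 2 (by decide), (h y hy).ℓ_eq_zero 3 (by decide)]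
    have := (h y hy).ℓ_pos.ne'
    simp only [c, smul_eq_mul, mul_zero, add_zero]
    field_simp
  · intro y hy w
    have h1 : n y (basisVec 1) * c y = 1 := (h y hy).n_mul_ℓ
    simp only [vec_eta]
    rw [hexp' y hy, apply_eq_sum, Fin.sum_univ_four]
    simp only [smul_eq_mul]
    linear_combination w 1 * h1
  · intro y hy w
    simp only [vec_eta, vec_dropOne]
    rw [← norm_component_dropOne h hy, ← hrot y hy, apply_eq_sum, Fin.sum_univ_four,
      (h y hy).m_one, (h y hy).m_three]
    simp only [Complex.real_smul]
    ring

/-- The canonical form on a subset, for coframes that agree there. -/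
theorem HasNormalForm.mono_congr {n ℓ n' ℓ' : R4 → R4 →L[ℝ] ℝ} {m m' : R4 → R4 →L[ℝ] ℂ}
    {s t : Set R4} {boost spin H W₁ W₂ M₀ M₁}
    (h : HasNormalForm n ℓ m s boost spin H W₁ W₂ M₀ M₁) (hts : t ⊆ s)
    (hn : ∀ y ∈ t, n' y = n y) (hℓ : ∀ y ∈ t, ℓ' y = ℓ y) (hm : ∀ y ∈ t, m' y = m y) :
    HasNormalForm n' ℓ' m' t boost spin H W₁ W₂ M₀ M₁ where
  smooth_boost := h.smooth_boost.mono hts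
  smooth_spin := h.smooth_spin.mono hts
  smooth_H := h.smooth_H.mono hts
  smooth_W₁ := h.smooth_W₁.mono hts
  smooth_W₂ := h.smooth_W₂.mono hts
  smooth_M₀ := h.smooth_M₀.mono hts
  smooth_M₁ := h.smooth_M₁.mono hts
  ℓ_eq y hy w := by rw [hℓ y hy]; exact h.ℓ_eq y (hts hy) w
  n_eq y hy w := by rw [hn y hy]; exact h.n_eq y (hts hy) w
  m_eq y hy w := by rw [hm y hy]; exact h.m_eq y (hts hy) w

/-- The local normal form of an admissible null coframe on the model space. -/
theorem exists_normal_coordinates {n ℓ : R4 → R4 →L[ℝ] ℝ} {m : R4 → R4 →L[ℝ] ℂ} {x₀ : R4}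
    (h : ∀ᶠ x in 𝓝 x₀, IsAdmissible n ℓ m x) :
    ∃ e : OpenPartialHomeomorph R4 R4, x₀ ∈ e.source ∧ ContDiffOn ℝ ∞ e e.source ∧
      ContDiffOn ℝ ∞ e.symm e.target ∧ ∃ boost spin H W₁ W₂ M₀ M₁,
      HasNormalForm (pullback e.symm n) (pullback e.symm ℓ) (pullback e.symm m) e.target
        boost spin H W₁ W₂ M₀ M₁ := by
  obtain ⟨e₁, h1s, h10, h1d, h1d', h1⟩ := exists_flow_coordinates h
  obtain ⟨e₂, h2s, h20, h2d, h2d', h2⟩ := exists_isothermal_coordinates h1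
  obtain ⟨r, hr, hball⟩ := Metric.eventually_nhds_iff_ball.1 h2
  obtain ⟨boost, spin, H, W₁, W₂, M₀, M₁, hN⟩ := exists_hasNormalForm_of_isNormalUpToGauge hball
  -- the target is cut down to a ball, since `M₁` refers to the values of `m` on `y¹ = 0`
  let e := (e₁.symm.trans e₂).trans (OpenPartialHomeomorph.ofSet (Metric.ball (0 : R4) r)
    Metric.isOpen_ball)
  have hx₀ : e₁.symm x₀ = 0 := by rw [← h10]; exact e₁.left_inv h1s
  have htarget : ∀ y ∈ e.target, y ∈ Metric.ball (0 : R4) r ∧ y ∈ e₂.target ∧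
      e₂.symm y ∈ e₁.source := by
    intro y hy
    simp [e] at hy ⊢
    tauto
  have hsource : ∀ x ∈ e.source, x ∈ e₁.target ∧ e₁.symm x ∈ e₂.source := by
    intro y hy
    simp [e] at hy ⊢
    tauto
  have hfun : ∀ x, e x = e₂ (e₁.symm x) := fun x => rfl
  have hsymm : ⇑e.symm = e₁ ∘ e₂.symm := rfl
  have hd₁ : ∀ y ∈ e.target, ContDiffAt ℝ ∞ e₁ (e₂.symm y) := fun y hy =>
    h1d.contDiffAt (e₁.open_source.mem_nhds (htarget y hy).2.2)
  have hd₂ : ∀ y ∈ e.target, ContDiffAt ℝ ∞ e₂.symm y := fun y hy =>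
    h2d'.contDiffAt (e₂.open_target.mem_nhds (htarget y hy).2.1)
  have hpull : ∀ {F : Type} [NormedAddCommGroup F] [NormedSpace ℝ F] (α : R4 → R4 →L[ℝ] F),
      ∀ y ∈ e.target, pullback e.symm α y = pullback e₂.symm (pullback e₁ α) y := by
    intro F _ _ α y hy
    rw [hsymm]
    exact pullback_comp α ((hd₂ y hy).differentiableAt (by simp))
      ((hd₁ y hy).differentiableAt (by simp))
  refine ⟨e, ?_, ?_, ?_, boost, spin, H, W₁, W₂, M₀, M₁,
    hN.mono_congr (fun y hy => (htarget y hy).1) (hpull n) (hpull ℓ) (hpull m)⟩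
  · have : x₀ ∈ e₁.target := by rw [← h10]; exact e₁.map_source h1s
    simp [e, this, hx₀, h2s, h20, hr]
  · intro x hx
    exact ((h2d.contDiffAt (e₂.open_source.mem_nhds (hsource x hx).2)).comp x
      (h1d'.contDiffAt (e₁.open_target.mem_nhds (hsource x hx).1))).contDiffWithinAt
  · intro y hy
    exact ((hd₁ y hy).comp y (hd₂ y hy)).contDiffWithinAt

end NormalForm

/-! ### Frame expansions and charts -/

section FrameExpansion

open Matrix

theorem sum_mul_mul_eq_dotProduct (C : Matrix (Fin 4) (Fin 4) ℂ) (u v : Fin 4 → ℂ) :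
    ∑ b, ∑ c, u b * v c * C b c = u ⬝ᵥ (C *ᵥ v) := by
  simp only [dotProduct, mulVec, Finset.mul_sum]
  exact Finset.sum_congr rfl fun b _ => Finset.sum_congr rfl fun c _ => by ring

/-- The value of a bilinear form on two vectors in terms of its components in a frame, the columns
of `F`. -/
theorem bilinear_frame_expansion (B F : Matrix (Fin 4) (Fin 4) ℂ) (u v : Fin 4 → ℂ) :
    ∑ μ, ∑ ν, (F *ᵥ u) μ * (F *ᵥ v) ν * B μ ν
      = ∑ b, ∑ c, u b * v c * ∑ μ, ∑ ν, B μ ν * F μ b * F ν c := by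
  have h : ∀ b c, ∑ μ, ∑ ν, B μ ν * F μ b * F ν c = (Fᵀ * (B * F)) b c := by
    intro b c
    simp only [mul_apply, transpose_apply, Finset.mul_sum]
    exact Finset.sum_congr rfl fun μ _ => Finset.sum_congr rfl fun ν _ => by ring
  simp only [h]
  rw [sum_mul_mul_eq_dotProduct, sum_mul_mul_eq_dotProduct, ← mulVec_mulVec, dotProduct_mulVec u,
    vecMul_transpose, mulVec_mulVec]

end FrameExpansion

section Charts

variable {M : Type*} [TopologicalSpace M] [ChartedSpace R4 M]
  {F : Type*} [NormedAddCommGroup F] [NormedSpace ℝ F]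

theorem SmoothForm.contDiffAt_inChart {α : OneForm M F} (hα : SmoothForm α)
    {φ : OpenPartialHomeomorph M R4} (hφ : φ ∈ atlas R4 M) {x : R4} (hx : x ∈ φ.target) :
    ContDiffAt ℝ ∞ (inChart φ α) x := by
  refine ContDiffOn.contDiffAt (s := φ.target) (contDiffOn_clm_apply.2 fun Y => ?_)
    (φ.open_target.mem_nhds hx)
  simp only [apply_eq_sum _ Y]
  exact ContDiffOn.sum fun μ _ => contDiffOn_const.smul (hα φ hφ μ)

/-- The exterior derivative in coordinate components. -/
theorem extD_eq_sum {α : R4 → R4 →L[ℝ] ℂ} {x : R4} (hα : ContDiffAt ℝ ∞ α x) (X Y : R4) :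
    extD α x X Y = ∑ μ, ∑ ν, (X μ : ℂ) * (Y ν : ℂ) *
      (pd μ (fun y => α y (basisVec ν)) x - pd ν (fun y => α y (basisVec μ)) x) := by
  have h : ∀ Z W : R4, fderiv ℝ α x Z W = ∑ μ, ∑ ν, (Z μ : ℂ) * (W ν : ℂ) *
      pd μ (fun y => α y (basisVec ν)) x := by
    intro Z W
    rw [apply_eq_sum (fderiv ℝ α x) Z, sum_apply]
    refine Finset.sum_congr rfl fun μ _ => ?_
    rw [smul_apply, apply_eq_sum, Finset.smul_sum]
    refine Finset.sum_congr rfl fun ν _ => ?_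
    rw [pd, fderiv_component hα, Complex.real_smul, Complex.real_smul, mul_assoc]
  rw [extD, h, h, Finset.sum_comm (f := fun μ ν => (Y μ : ℂ) * (X ν : ℂ) *
      pd μ (fun y => α y (basisVec ν)) x), ← Finset.sum_sub_distrib]
  refine Finset.sum_congr rfl fun μ _ => ?_
  rw [← Finset.sum_sub_distrib]
  exact Finset.sum_congr rfl fun ν _ => by ring

theorem surjective_mfderiv_symm [IsManifold (𝓡 4) ∞ M] {φ : OpenPartialHomeomorph M R4}
    (hφ : φ ∈ atlas R4 M) {x : R4} (hx : x ∈ φ.target) :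
    Function.Surjective (mfderiv (𝓡 4) (𝓡 4) φ.symm x) := by
  have : IsManifold (𝓡 4) 1 M := IsManifold.of_le (n := ∞) (by simp)
  exact (mdifferentiable_of_mem_atlas hφ).symm.mfderiv_surjective hx

/-- A change of coordinates acts on the local expressions of one-forms by pull-back. -/
theorem inChart_trans [IsManifold (𝓡 4) ∞ M] {φ : OpenPartialHomeomorph M R4}
    (hφ : φ ∈ atlas R4 M) {e : OpenPartialHomeomorph R4 R4} (he : ContDiffOn ℝ ∞ e.symm e.target)
    (α : OneForm M F) {x : R4} (hx : x ∈ (φ.trans e).target) :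
    inChart (φ.trans e) α x = pullback e.symm (inChart φ α) x := by
  have : IsManifold (𝓡 4) 1 M := IsManifold.of_le (n := ∞) (by simp)
  have hx' : x ∈ e.target ∧ e.symm x ∈ φ.target := by simpa using hx
  have h1 : MDifferentiableAt (𝓡 4) (𝓡 4) e.symm x :=
    ((he.contDiffAt (e.open_target.mem_nhds hx'.1)).differentiableAt (by simp)).mdifferentiableAt
  have h2 : MDifferentiableAt (𝓡 4) (𝓡 4) φ.symm (e.symm x) :=
    mdifferentiableAt_atlas_symm hφ hx'.2
  have h3 : mfderiv (𝓡 4) (𝓡 4) (φ.trans e).symm x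
      = (mfderiv (𝓡 4) (𝓡 4) φ.symm (e.symm x)).comp (mfderiv (𝓡 4) (𝓡 4) e.symm x) :=
    mfderiv_comp x h2 h1
  ext w
  simp only [inChart, pullback, h3, mfderiv_eq_fderiv]
  rfl

theorem trans_mem_maximalAtlas [IsManifold (𝓡 4) ∞ M] {φ : OpenPartialHomeomorph M R4}
    (hφ : φ ∈ atlas R4 M) {e : OpenPartialHomeomorph R4 R4} (he : ContDiffOn ℝ ∞ e e.source)
    (hes : ContDiffOn ℝ ∞ e.symm e.target) :
    φ.trans e ∈ IsManifold.maximalAtlas (𝓡 4) ∞ M := by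
  have heG : e ∈ contDiffGroupoid ∞ (𝓡 4) := by
    rw [contDiffGroupoid, mem_groupoid_of_pregroupoid]
    simp [contDiffPregroupoid, he, hes]
  intro f hf
  have h1 : φ.symm.trans f ∈ contDiffGroupoid ∞ (𝓡 4) := HasGroupoid.compatible hφ hf
  have h2 : f.symm.trans φ ∈ contDiffGroupoid ∞ (𝓡 4) := HasGroupoid.compatible hf hφ
  refine ⟨?_, ?_⟩
  · rw [OpenPartialHomeomorph.trans_symm_eq_symm_trans_symm, OpenPartialHomeomorph.trans_assoc]
    exact (contDiffGroupoid ∞ (𝓡 4)).trans ((contDiffGroupoid ∞ (𝓡 4)).symm heG) h1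
  · rw [← OpenPartialHomeomorph.trans_assoc]
    exact (contDiffGroupoid ∞ (𝓡 4)).trans h2 heG

end Charts

/-! ### From torsion and connection to an admissible coframe -/

section Admissible

open Matrix

variable {M : Type*} [TopologicalSpace M] [ChartedSpace R4 M]

/-- The values `h^a(X)` of the coframe on a real vector, in a chart. -/
noncomputable def coframeValue (G : NullGeometry M) (φ : OpenPartialHomeomorph M R4) (x X : R4) :
    Fin 4 → ℂ :=
  fun a => inChart φ (G.coframe a) x X

/-- The values `ω^a_b(X)` of the connection on a real vector, in a chart. -/
noncomputable def connValue (G : NullGeometry M) (φ : OpenPartialHomeomorph M R4) (x X : R4)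
    (a b : Fin 4) : ℂ :=
  inChart φ (G.conn a b) x X

theorem coframeValue_eq (G : NullGeometry M) (φ : OpenPartialHomeomorph M R4) (x X : R4) :
    coframeValue G φ x X = ![(inChart φ G.n x X : ℂ), (inChart φ G.ℓ x X : ℂ),
      (starRingEnd ℂ) (inChart φ G.m x X), inChart φ G.m x X] := by
  ext a
  fin_cases a <;> rfl

theorem inChart_eq_sum {α : OneForm M ℂ} (φ : OpenPartialHomeomorph M R4) (x X : R4) :
    inChart φ α x X = ∑ μ, component φ α μ x * (X μ : ℂ) := by
  rw [apply_eq_sum]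
  exact Finset.sum_congr rfl fun μ _ => by rw [Complex.real_smul, mul_comm]; rfl

variable [IsManifold (𝓡 4) ∞ M]

theorem isUnit_det_coframe (G : NullGeometry M) {φ : OpenPartialHomeomorph M R4}
    (hφ : φ ∈ atlas R4 M) {x : R4} (hx : x ∈ φ.target) :
    IsUnit (Matrix.of fun a μ => component φ (G.coframe a) μ x).det := by
  rw [← Matrix.isUnit_iff_isUnit_det, ← Matrix.linearIndependent_rows_iff_isUnit,
    Fintype.linearIndependent_iff]
  intro c hc
  refine Fintype.linearIndependent_iff.1 (G.independent (φ.symm x)) c ?_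
  ext w
  obtain ⟨X, hX⟩ : ∃ X : R4, mfderiv (𝓡 4) (𝓡 4) φ.symm x X = w :=
    surjective_mfderiv_symm hφ hx w
  have h1 : ∑ a, c a * inChart φ (G.coframe a) x X = 0 := by
    have h2 : ∀ a, inChart φ (G.coframe a) x X
        = ∑ μ, component φ (G.coframe a) μ x * (X μ : ℂ) := fun a => inChart_eq_sum φ x X
    simp only [h2, Finset.mul_sum]
    rw [Finset.sum_comm]
    refine Finset.sum_eq_zero fun μ _ => ?_
    have := congrFun hc μ
    simp only [Finset.sum_apply, Pi.smul_apply, Matrix.row_apply, Matrix.of_apply, smul_eq_mul,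
      Pi.zero_apply] at this
    simp only [← mul_assoc]
    rw [← Finset.sum_mul, this, zero_mul]
  rw [← hX, _root_.sum_apply]
  exact h1

/-- The expansion of a real vector in the complex null frame. -/
theorem frame_mulVec_coframeValue (G : NullGeometry M) {φ : OpenPartialHomeomorph M R4}
    (hφ : φ ∈ atlas R4 M) {x : R4} (hx : x ∈ φ.target) (X : R4) :
    G.frame φ x *ᵥ coframeValue G φ x X = fun μ => (X μ : ℂ) := by
  have h1 : coframeValue G φ x X
      = (Matrix.of fun a μ => component φ (G.coframe a) μ x) *ᵥ fun μ => (X μ : ℂ) := by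
    ext a
    exact inChart_eq_sum φ x X
  rw [h1, NullGeometry.frame, mulVec_mulVec, Matrix.nonsing_inv_mul _ (isUnit_det_coframe G hφ hx),
    one_mulVec]

/-- Cartan's first structure equation `dh^a + ω^a_b ∧ h^b = T^a`, with the torsion two-form expanded
in its frame components. -/
theorem cartan_structure (G : NullGeometry M) {φ : OpenPartialHomeomorph M R4}
    (hφ : φ ∈ atlas R4 M) {x : R4} (hx : x ∈ φ.target) (a : Fin 4)
    (hs : ContDiffAt ℝ ∞ (inChart φ (G.coframe a)) x) (X Y : R4) :
    extD (inChart φ (G.coframe a)) x X Y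
        + ∑ b, connValue G φ x X a b * coframeValue G φ x Y b
        - ∑ b, connValue G φ x Y a b * coframeValue G φ x X b
      = ∑ b, ∑ c, coframeValue G φ x X b * coframeValue G φ x Y c *
          ∑ μ, ∑ ν, G.torsionCoord φ a μ ν x * G.frame φ x μ b * G.frame φ x ν c := by
  have h0 := bilinear_frame_expansion (fun μ ν => G.torsionCoord φ a μ ν x) (G.frame φ x)
    (coframeValue G φ x X) (coframeValue G φ x Y)
  rw [← h0, frame_mulVec_coframeValue G hφ hx, frame_mulVec_coframeValue G hφ hx, extD_eq_sum hs]
  have h1 : ∀ Z W : R4, ∑ b, connValue G φ x Z a b * coframeValue G φ x W b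
      = ∑ μ, ∑ ν, (Z μ : ℂ) * (W ν : ℂ) *
        ∑ b, component φ (G.conn a b) μ x * component φ (G.coframe b) ν x := by
    intro Z W
    simp only [connValue, coframeValue, inChart_eq_sum, Finset.sum_mul_sum]
    simp only [Finset.mul_sum]
    rw [Finset.sum_comm]
    refine Finset.sum_congr rfl fun μ _ => ?_
    rw [Finset.sum_comm]
    exact Finset.sum_congr rfl fun ν _ => Finset.sum_congr rfl fun b _ => by ring
  rw [h1, h1 Y X, Finset.sum_comm (f := fun μ ν => (Y μ : ℂ) * (X ν : ℂ) *
        ∑ b, component φ (G.conn a b) μ x * component φ (G.coframe b) ν x),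
    ← Finset.sum_add_distrib, ← Finset.sum_sub_distrib]
  refine Finset.sum_congr rfl fun μ _ => ?_
  rw [← Finset.sum_add_distrib, ← Finset.sum_sub_distrib]
  refine Finset.sum_congr rfl fun ν _ => ?_
  have h2 : ∀ κ, (fun y => inChart φ (G.coframe a) y (basisVec κ)) = component φ (G.coframe a) κ :=
    fun _ => rfl
  simp only [NullGeometry.torsionCoord, h2]
  ring

/-- If `κ = σ = ρ = 0`, then `ω^3_0 = ω_{20}` is a multiple of `ℓ`. -/
theorem connValue_three_zero (G : NullGeometry M) {φ : OpenPartialHomeomorph M R4}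
    (hφ : φ ∈ atlas R4 M) {x : R4} (hx : x ∈ φ.target) (hκ : G.kappa φ x = 0)
    (hσ : G.sigma φ x = 0) (hρ : G.rho φ x = 0) {X : R4} (hX : inChart φ G.ℓ x X = 0) :
    connValue G φ x X 3 0 = 0 := by
  have h1 : connValue G φ x X 3 0 = ∑ c, G.spinCoeff φ 2 0 c x * coframeValue G φ x X c := by
    have h2 : ∀ c, G.spinCoeff φ 2 0 c x
        = ∑ μ, component φ (G.conn 3 0) μ x * G.frame φ x μ c := by
      intro c
      rw [NullGeometry.spinCoeff, Finset.sum_eq_single 3 ?_ (by simp)]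
      · simp [eta]
      · intro d _ hd
        fin_cases d <;> simp [eta] at hd ⊢
    have h3 := frame_mulVec_coframeValue G hφ hx X
    simp only [connValue, inChart_eq_sum, h2, Finset.sum_mul]
    rw [Finset.sum_comm]
    refine Finset.sum_congr rfl fun μ _ => ?_
    rw [← congrFun h3 μ]
    simp only [mulVec, dotProduct, Finset.mul_sum, mul_assoc]
  simp only [NullGeometry.kappa, NullGeometry.sigma, NullGeometry.rho, neg_eq_zero] at hκ hσ hρ
  rw [h1, Fin.sum_univ_four, hκ, hσ, hρ, coframeValue_eq]
  simp [hX]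

/-- On the kernel of `ℓ`, the vanishing of `κ, σ, ρ` together with reality and antisymmetry kills
`ω^3_0`, `ω^2_0`, `ω^1_2` and `ω^1_3`, so that there the structure equation for `h^1 = ℓ` reduces to
`dℓ = 0` and, if one argument is in the null direction dual to `n`, the one for `h^3 = m` reduces to
`dm = -ω^3_3 ∧ m`, with imaginary `ω^3_3`; the torsion components that could contribute have positive
boost weight. -/
theorem isAdmissible_inChart (G : NullGeometry M) (hII : G.TorsionTypeII)
    {φ : OpenPartialHomeomorph M R4} (hφ : φ ∈ atlas R4 M) {x : R4} (hx : x ∈ φ.target)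
    (hκ : G.kappa φ x = 0) (hσ : G.sigma φ x = 0) (hρ : G.rho φ x = 0) :
    IsAdmissible (inChart φ G.n) (inChart φ G.ℓ) (inChart φ G.m) x := by
  have hsn := G.smooth_n.contDiffAt_inChart hφ hx
  have hsℓ := G.smooth_ℓ.contDiffAt_inChart hφ hx
  have hsm := G.smooth_m.contDiffAt_inChart hφ hx
  have hreal : ∀ X a b, (starRingEnd ℂ) (connValue G φ x X a b)
      = connValue G φ x X (Equiv.swap 2 3 a) (Equiv.swap 2 3 b) :=
    fun X a b => G.real_conn a b _ _
  have hanti : ∀ X a b, ∑ c, eta a c * connValue G φ x X c b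
      + ∑ c, eta b c * connValue G φ x X c a = 0 :=
    fun X a b => G.antisymm a b _ _
  have h30 : ∀ X, inChart φ G.ℓ x X = 0 → connValue G φ x X 3 0 = 0 :=
    fun X hX => connValue_three_zero G hφ hx hκ hσ hρ hX
  have h20 : ∀ X, inChart φ G.ℓ x X = 0 → connValue G φ x X 2 0 = 0 := by
    intro X hX
    have := hreal X 3 0
    rw [h30 X hX, map_zero] at this
    exact this.symm
  have h10 : ∀ X, connValue G φ x X 1 0 = 0 := by
    intro X
    have := hanti X 0 0
    simp only [Fin.sum_univ_four, eta] at this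
    simp at this
    exact this
  have h12 : ∀ X, inChart φ G.ℓ x X = 0 → connValue G φ x X 1 2 = 0 := by
    intro X hX
    have := hanti X 0 2
    simp only [Fin.sum_univ_four, eta] at this
    simp [h30 X hX] at this
    exact this
  have h13 : ∀ X, inChart φ G.ℓ x X = 0 → connValue G φ x X 1 3 = 0 := by
    intro X hX
    have := hanti X 0 3
    simp only [Fin.sum_univ_four, eta] at this
    simp [h20 X hX] at this
    exact this
  have h32 : ∀ X, connValue G φ x X 3 2 = 0 := by
    intro X
    have := hanti X 2 2
    simp only [Fin.sum_univ_four, eta] at this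
    simp at this
    exact this
  have h33 : ∀ X, (connValue G φ x X 3 3).re = 0 := by
    intro X
    have h1 := hanti X 2 3
    simp only [Fin.sum_univ_four, eta] at h1
    simp at h1
    have h2 : (starRingEnd ℂ) (connValue G φ x X 3 3) = connValue G φ x X 2 2 := hreal X 3 3
    rw [← h2] at h1
    have := congrArg Complex.re h1
    simp at this
    linarith
  -- every row of `η` has a single nonzero entry, so that lowering an index is invertible termwise
  have htor : ∀ a d : Fin 4, (∀ e, e ≠ d → eta a e = 0) → eta a d ≠ 0 → ∀ b c,
      0 < boostWeight a + boostWeight b + boostWeight c →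
      ∑ μ, ∑ ν, G.torsionCoord φ d μ ν x * G.frame φ x μ b * G.frame φ x ν c = 0 := by
    intro a d had h0 b c hpos
    have h1 := hII a b c hpos φ hφ x hx
    rw [NullGeometry.torsion, Finset.sum_eq_single d (fun e _ he => by simp [had e he])
      (by simp)] at h1
    have h2 : eta a d * ∑ μ, ∑ ν, G.torsionCoord φ d μ ν x * G.frame φ x μ b * G.frame φ x ν c
        = 0 := by
      rw [← h1]
      simp only [Finset.mul_sum, mul_assoc]
    exact (mul_eq_zero.1 h2).resolve_left h0
  have hcs : ContDiffAt ℝ ∞ (inChart φ (G.coframe 1)) x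
    := ContDiffAt.clm_comp (g := fun _ => Complex.ofRealCLM) contDiffAt_const hsℓ
  refine ⟨hsn, hsℓ, hsm, ?_, ?_, ?_⟩
  · intro X h1 h2 h3
    have h4 := frame_mulVec_coframeValue G hφ hx X
    rw [coframeValue_eq, h1, h2, h3] at h4
    ext μ
    have h5 := congrFun h4 μ
    simp [mulVec, dotProduct, Fin.sum_univ_four] at h5
    simpa using h5.symm
  · intro X Y hX hY
    have h1 := cartan_structure G hφ hx 1 hcs X Y
    have h2 : extD (inChart φ (G.coframe 1)) x X Y = ((extD (inChart φ G.ℓ) x X Y : ℝ) : ℂ) := by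
      have h3 : fderiv ℝ (inChart φ (G.coframe 1)) x = _ :=
        ((hasFDerivAt_const Complex.ofRealCLM x).clm_comp
          (hsℓ.differentiableAt (by simp)).hasFDerivAt).fderiv
      rw [extD, h3]
      simp [extD]
    rw [Finset.sum_eq_zero, Finset.sum_eq_zero, Finset.sum_eq_zero, h2] at h1
    · simpa using h1
    · intro b _
      refine Finset.sum_eq_zero fun c _ => ?_
      by_cases hb : b = 1
      · simp [hb, coframeValue_eq, hX]
      by_cases hc : c = 1
      · simp [hc, coframeValue_eq, hY]
      rw [htor 0 1 (fun e he => by fin_cases e <;> simp [eta] at he ⊢) (by simp [eta]) b c (by decide +revert), mul_zero]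
    · intro b _
      fin_cases b
      · simp [h10]
      · simp [coframeValue_eq, hX]
      · simp [h12 Y hY]
      · simp [h13 Y hY]
    · intro b _
      fin_cases b
      · simp [h10]
      · simp [coframeValue_eq, hY]
      · simp [h12 X hX]
      · simp [h13 X hX]
  · intro X hX hmX
    refine ⟨-(connValue G φ x X 3 3).im, fun Y hY => ?_⟩
    have h1 := cartan_structure G hφ hx 3 hsm X Y
    have hω : connValue G φ x X 3 3 = Complex.I * ((connValue G φ x X 3 3).im : ℂ) := by
      apply Complex.ext <;> simp [h33]
    have hb0 : ∀ b, b ≠ 0 → coframeValue G φ x X b = 0 := by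
      intro b hb
      rw [coframeValue_eq, hX, hmX]
      fin_cases b <;> simp at hb ⊢
    rw [Finset.sum_eq_single 3, Finset.sum_eq_zero, Finset.sum_eq_zero] at h1
    · have h2 : extD (inChart φ G.m) x X Y + connValue G φ x X 3 3 * inChart φ G.m x Y = 0 := by
        rw [sub_zero] at h1
        exact h1
      rw [hω] at h2
      push_cast
      linear_combination h2
    · intro b _
      refine Finset.sum_eq_zero fun c _ => ?_
      by_cases hb : b = 0
      · by_cases hc : c = 1
        · simp [hc, coframeValue_eq, hY]
        rw [htor 2 3 (fun e he => by fin_cases e <;> simp [eta] at he ⊢) (by simp [eta]) b c (by decide +revert), mul_zero]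
      · simp [hb0 b hb]
    · intro b _
      by_cases hb : b = 0
      · simp [hb, h30 Y hY]
      · simp [hb0 b hb]
    · intro b _ hb
      fin_cases b
      · simp [h30 X hX]
      · simp [coframeValue_eq, hY]
      · simp [h32]
      · simp at hb
    · simp

end Admissible

end Teleparallel

theorem mainTheorem5 {M : Type*} [TopologicalSpace M] [ChartedSpace Teleparallel.R4 M]
    [IsManifold (𝓡 4) ∞ M] (G : Teleparallel.NullGeometry M)
    (hII : G.TorsionTypeII)
    (hκ : ∀ φ ∈ atlas Teleparallel.R4 M, ∀ x ∈ φ.target, G.kappa φ x = 0)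
    (hσ : ∀ φ ∈ atlas Teleparallel.R4 M, ∀ x ∈ φ.target, G.sigma φ x = 0)
    (hρ : ∀ φ ∈ atlas Teleparallel.R4 M, ∀ x ∈ φ.target, G.rho φ x = 0) (p : M) :
    -- local coordinates `(u, v, x¹, x²)` around `p`
    ∃ φ ∈ IsManifold.maximalAtlas (𝓡 4) ∞ M, p ∈ φ.source ∧
    -- a boost `(ℓ, n) ↦ (e^λ ℓ, e^{-λ} n)` and a spin `m ↦ e^{iθ} m`
    ∃ boost spin : M → ℝ,
      ContMDiffOn (𝓡 4) 𝓘(ℝ, ℝ) ∞ boost φ.source ∧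
      ContMDiffOn (𝓡 4) 𝓘(ℝ, ℝ) ∞ spin φ.source ∧
    -- the functions in the canonical form, with arguments in the order `u, v, x¹, x²`
    ∃ (H W₁ W₂ : ℝ → ℝ → ℝ → ℝ → ℝ) (M₀ : ℝ → ℝ → ℝ → ℝ → ℂ) (M₁ : ℝ → ℝ → ℝ → ℂ),
      ContDiffOn ℝ ∞ (fun x : Teleparallel.R4 => H (x 0) (x 1) (x 2) (x 3)) φ.target ∧
      ContDiffOn ℝ ∞ (fun x : Teleparallel.R4 => W₁ (x 0) (x 1) (x 2) (x 3)) φ.target ∧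
      ContDiffOn ℝ ∞ (fun x : Teleparallel.R4 => W₂ (x 0) (x 1) (x 2) (x 3)) φ.target ∧
      ContDiffOn ℝ ∞ (fun x : Teleparallel.R4 => M₀ (x 0) (x 1) (x 2) (x 3)) φ.target ∧
      ContDiffOn ℝ ∞ (fun x : Teleparallel.R4 => M₁ (x 0) (x 2) (x 3)) φ.target ∧
      -- `w = (du, dv, dx¹, dx²)` in the following three identities of one-forms
      ∀ x ∈ φ.target, ∀ w : Teleparallel.R4,
        Real.exp (boost (φ.symm x)) * Teleparallel.inChart φ G.ℓ x w = w 0 ∧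
        Real.exp (-boost (φ.symm x)) * Teleparallel.inChart φ G.n x w
          = w 1 + H (x 0) (x 1) (x 2) (x 3) * w 0
            + W₁ (x 0) (x 1) (x 2) (x 3) * w 2 + W₂ (x 0) (x 1) (x 2) (x 3) * w 3 ∧
        Complex.exp (Complex.I * (spin (φ.symm x) : ℂ)) * Teleparallel.inChart φ G.m x w
          = M₀ (x 0) (x 1) (x 2) (x 3) * (w 0 : ℂ)
            + M₁ (x 0) (x 2) (x 3) * ((w 2 : ℂ) + Complex.I * (w 3 : ℂ)) := by
  have hadm : ∀ᶠ x in 𝓝 (chartAt Teleparallel.R4 p p), Teleparallel.IsAdmissible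
      (Teleparallel.inChart (chartAt Teleparallel.R4 p) G.n)
      (Teleparallel.inChart (chartAt Teleparallel.R4 p) G.ℓ)
      (Teleparallel.inChart (chartAt Teleparallel.R4 p) G.m) x := by
    have hφ := chart_mem_atlas Teleparallel.R4 p
    filter_upwards [(chartAt Teleparallel.R4 p).open_target.mem_nhds
      (mem_chart_target Teleparallel.R4 p)] with x hx
    exact Teleparallel.isAdmissible_inChart G hII hφ hx (hκ _ hφ x hx) (hσ _ hφ x hx) (hρ _ hφ x hx)
  obtain ⟨e, he0, he, hes, boost, spin, H, W₁, W₂, M₀, M₁, h⟩ :=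
    Teleparallel.exists_normal_coordinates hadm
  set φ := chartAt Teleparallel.R4 p with hφdef
  have hφ : φ ∈ atlas Teleparallel.R4 M := chart_mem_atlas Teleparallel.R4 p
  have hmax := Teleparallel.trans_mem_maximalAtlas hφ he hes
  have hsub : (φ.trans e).target ⊆ e.target := fun x hx => by
    simp only [OpenPartialHomeomorph.trans_target, mem_inter_iff] at hx
    exact hx.1
  have hsmooth : ∀ f : Teleparallel.R4 → ℝ, ContDiffOn ℝ ∞ f e.target →
      ContMDiffOn (𝓡 4) 𝓘(ℝ, ℝ) ∞ (f ∘ φ.trans e) (φ.trans e).source := fun f hf =>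
    (hf.mono hsub).contMDiffOn.comp (contMDiffOn_of_mem_maximalAtlas hmax)
      fun q hq => (φ.trans e).map_source hq
  have hin : ∀ {F : Type} [NormedAddCommGroup F] [NormedSpace ℝ F] (α : Teleparallel.OneForm M F),
      ∀ x ∈ (φ.trans e).target, Teleparallel.inChart (φ.trans e) α x
        = Teleparallel.pullback e.symm (Teleparallel.inChart φ α) x :=
    fun α x hx => Teleparallel.inChart_trans hφ hes α hx
  refine ⟨φ.trans e, hmax, ?_, boost ∘ φ.trans e, spin ∘ φ.trans e, hsmooth _ h.smooth_boost,
    hsmooth _ h.smooth_spin, H, W₁, W₂, M₀, M₁, h.smooth_H.mono hsub, h.smooth_W₁.mono hsub,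
    h.smooth_W₂.mono hsub, h.smooth_M₀.mono hsub, h.smooth_M₁.mono hsub, fun x hx w => ?_⟩
  · rw [OpenPartialHomeomorph.trans_source]
    exact ⟨mem_chart_source Teleparallel.R4 p, he0⟩
  · simp only [Function.comp_apply, (φ.trans e).right_inv hx, hin _ x hx]
    exact ⟨h.ℓ_eq x (hsub hx) w, h.n_eq x (hsub hx) w, h.m_eq x (hsub hx) w⟩
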